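/- Let $\mathfrak g$ be a finite-dimensional complex semisimple Lie algebra with a Cartan subalgebra and simple roots $(\alpha_i)_{i\in I}$, let $a_{ij}=\alpha_j(\alpha_i^\vee)$, and let $d_i$ be positive integers with $d_ia_{ij}=d_ja_{ji}$. Let $k$ be a field of characteristic $0$, let $q\in k$ be nonzero and not a root of unity, and put $q_i=q^{d_i}$. Let $U_q(\mathfrak g)$ be the $k$-algebra with generators $E_i,F_i,K_i^{\pm1}$ ($i\in I$) and relations $K_iK_i^{-1}=K_i^{-1}K_i=1$, $K_iK_j=K_jK_i$, $K_iE_jK_i^{-1}=q^{d_ia_{ij}}E_j$, $K_iF_jK_i^{-1}=q^{-d_ia_{ij}}F_j$, $E_iF_j-F_jE_i=\delta_{ij}\frac{K_i-K_i^{-1}}{q_i-q_i^{-1}}$, together with the quantum Serre relations $\sum_{s=0}^{1-a_{ij}}(-1)^s\binom{1-a_{ij}}{s}_{q_i}E_i^{1-a_{ij}-s}E_jE_i^s=0$ for $i\ne j$ and the same relations with $F$ in place of $E$. Its comultiplication is $\Delta(E_i)=E_i\otimes1+K_i\otimes E_i$, $\Delta(F_i)=F_i\otimes K_i^{-1}+1\otimes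 F_i$, $\Delta(K_i)=K_i\otimes K_i$, with the corresponding antipode $S$ given by $S(E_i)=-K_i^{-1}E_i$, $S(F_i)=-F_iK_i$, $S(K_i)=K_i^{-1}$. The left adjoint action is $\operatorname{ad}_L(a)(b)=a_{(1)}\,b\,S(a_{(2)})$. For a set $S\subseteq I$ of simple roots let $U_q(\mathfrak l_S)\subseteq U_q(\mathfrak g)$ be the subalgebra generated by $E_i,F_i$ ($i\in S$) and all $K_j^{\pm1}$ ($j\in I$). For $v\in U_q(\mathfrak g)$ put $M(v)=\{\operatorname{ad}_L(a)(v): a\in U_q(\mathfrak l_S)\}$, and let $F_S=\{v\in U_q(\mathfrak g): \dim_k M(v)<\infty\}$. A highest weight vector is a nonzero $w\in U_q(\mathfrak g)$ with $\operatorname{ad}_L(E_i)(w)=0$ for all $i\in S$ for which there is an integral weight $\mu$ with $\operatorname{ad}_L(K_j)(w)=q^{d_j\mu(\alpha_j^\vee)}w$ for all $j\in I$. Then for every $v\in F_S$ there are finitely many highest weight vectors $w_1,\dots,w_n\in M(v)$ (with $n\ge 0$; $n=0$ occurs for $v=0$) such that each $M(w_i)$ is an irreducible $U_q(\mathfrak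 l_S)$-submodule of $M(v)$ and $$M(v)=\sum_{i=1}^n M(w_i).$$ In particular every cyclic adjoint module is generated by finitely many irreducible cyclic submodules. -/

import Mathlib

noncomputable section

open scoped TensorProduct

namespace QuantumLevi

/-! ### Quantum integers and the quantum Serre polynomial -/

/-- `q` is nonzero and not a root of unity. -/
structure IsGeneric {k : Type*} [Field k] (q : k) : Prop where
  ne_zero : q ≠ 0
  pow_ne_one : ∀ n : ℕ, 0 < n → q ^ n ≠ 1

section QuantumNumbers

variable {k : Type*} [Field k]

/-- The quantum integer `[n]_q = (q^n - q^(-n)) / (q - q^(-1))`. -/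
def qnum (q : k) (n : ℕ) : k := (q ^ n - (q ^ n)⁻¹) / (q - q⁻¹)

/-- The quantum factorial `[n]_q! = [1]_q [2]_q ⋯ [n]_q`. -/
def qfact (q : k) (n : ℕ) : k := ∏ i ∈ Finset.range n, qnum q (i + 1)

/-- The quantum binomial coefficient `[n]_q! / ([s]_q! [n-s]_q!)`, zero for `s > n`. -/
def qbinom (q : k) (n s : ℕ) : k :=
  if s ≤ n then qfact q n / (qfact q s * qfact q (n - s)) else 0

/-- The quantum Serre expression
`∑_{s=0}^{n} (-1)^s [n choose s]_q e^(n-s) f e^s` in an associative algebra. -/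
def serre {B : Type*} [Ring B] [Algebra k B] (q : k) (n : ℕ) (e f : B) : B :=
  ∑ s ∈ Finset.range (n + 1), ((-1) ^ s * qbinom q n s) • (e ^ (n - s) * f * e ^ s)

theorem IsGeneric.pow {q : k} (hq : IsGeneric q) {d : ℕ} (hd : 0 < d) : IsGeneric (q ^ d) :=
  ⟨pow_ne_zero _ hq.ne_zero, fun n hn => by
    rw [← pow_mul]; exact hq.pow_ne_one _ (Nat.mul_pos hd hn)⟩

theorem IsGeneric.inv {q : k} (hq : IsGeneric q) : IsGeneric q⁻¹ :=
  ⟨inv_ne_zero hq.ne_zero, fun n hn => by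
    rw [inv_pow, ne_eq, inv_eq_one]; exact hq.pow_ne_one n hn⟩

theorem IsGeneric.pow_sub_inv_ne_zero {q : k} (hq : IsGeneric q) {n : ℕ} (hn : 0 < n) :
    q ^ n - (q ^ n)⁻¹ ≠ 0 := by
  have h0 : q ^ n ≠ 0 := pow_ne_zero _ hq.ne_zero
  intro h
  apply hq.pow_ne_one (n + n) (by omega)
  rw [sub_eq_zero] at h
  rw [pow_add]
  nth_rewrite 1 [h]
  exact inv_mul_cancel₀ h0

theorem IsGeneric.sub_inv_ne_zero {q : k} (hq : IsGeneric q) : q - q⁻¹ ≠ 0 := by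
  simpa using hq.pow_sub_inv_ne_zero (n := 1) one_pos

theorem qnum_ne_zero {q : k} (hq : IsGeneric q) {n : ℕ} (hn : 0 < n) : qnum q n ≠ 0 :=
  div_ne_zero (hq.pow_sub_inv_ne_zero hn) hq.sub_inv_ne_zero

theorem qfact_ne_zero {q : k} (hq : IsGeneric q) (n : ℕ) : qfact q n ≠ 0 :=
  Finset.prod_ne_zero_iff.2 fun i _ => qnum_ne_zero hq (Nat.succ_pos i)

theorem qfact_succ (q : k) (n : ℕ) : qfact q (n + 1) = qfact q n * qnum q (n + 1) :=
  Finset.prod_range_succ _ _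

theorem qnum_inv (q : k) (n : ℕ) : qnum q⁻¹ n = qnum q n := by
  unfold qnum
  rw [inv_pow, inv_inv, inv_inv, ← neg_sub, ← neg_sub q, neg_div_neg_eq]

theorem qbinom_inv (q : k) (n s : ℕ) : qbinom q⁻¹ n s = qbinom q n s := by
  simp only [qbinom, qfact, qnum_inv]

theorem qbinom_symm (q : k) {n s : ℕ} (h : s ≤ n) : qbinom q n (n - s) = qbinom q n s := by
  simp only [qbinom, h, Nat.sub_le, if_true, Nat.sub_sub_self h]
  rw [mul_comm]

theorem qbinom_zero {q : k} (hq : IsGeneric q) (n : ℕ) : qbinom q n 0 = 1 := by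
  have := qfact_ne_zero hq n
  have h0 : qfact q 0 = 1 := Finset.prod_range_zero _
  rw [qbinom, if_pos (Nat.zero_le n), h0, one_mul, Nat.sub_zero, div_self this]

theorem qbinom_of_lt (q : k) {n s : ℕ} (h : n < s) : qbinom q n s = 0 := by
  simp [qbinom, h]

/-- The Pascal rule for quantum binomial coefficients. -/
theorem qbinom_succ {q : k} (hq : IsGeneric q) (n s : ℕ) :
    q ^ (s + 1) * qbinom q (n + 1) (s + 1) =
      qbinom q n (s + 1) + q ^ (n + 1) * qbinom q n s := by
  rcases lt_trichotomy n s with h | rfl | h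
  · rw [qbinom_of_lt q h, qbinom_of_lt q (by omega), qbinom_of_lt q (by omega)]; simp
  · rw [qbinom_of_lt q (Nat.lt_succ_self n)]
    have h1 := qfact_ne_zero hq n
    have h2 := qfact_ne_zero hq (n + 1)
    have e1 : qbinom q (n + 1) (n + 1) = 1 := by
      rw [← qbinom_symm q le_rfl, Nat.sub_self, qbinom_zero hq]
    have e2 : qbinom q n n = 1 := by
      rw [← qbinom_symm q le_rfl, Nat.sub_self, qbinom_zero hq]
    rw [e1, e2]; ring
  · obtain ⟨r, rfl⟩ : ∃ r, n = s + 1 + r := ⟨n - (s + 1), by omega⟩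
    have h1 := qfact_ne_zero hq s
    have h2 := qfact_ne_zero hq r
    have h3 := qnum_ne_zero hq (Nat.succ_pos s)
    have h4 := qnum_ne_zero hq (Nat.succ_pos r)
    have hq0 := hq.ne_zero
    have a1 : s + 1 + r + 1 - (s + 1) = r + 1 := by omega
    have a2 : s + 1 + r - (s + 1) = r := by omega
    have a3 : s + 1 + r - s = r + 1 := by omega
    simp only [qbinom, a1, a2, a3, qfact_succ q (s + 1 + r), qfact_succ q r, qfact_succ q s]
    rw [if_pos (by omega), if_pos (by omega), if_pos (by omega)]
    have key : q ^ (s + 1) * qnum q (s + 1 + r + 1) =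
        qnum q (r + 1) + q ^ (s + 1 + r + 1) * qnum q (s + 1) := by
      unfold qnum
      have := hq.sub_inv_ne_zero
      rw [← mul_div_assoc, ← mul_div_assoc, ← add_div]
      congr 1
      field_simp
      ring
    rw [mul_div_assoc', mul_left_comm, key]
    field_simp

end QuantumNumbers

section Serre

variable {k : Type*} [Field k] {B : Type*} [Ring B] [Algebra k B]

theorem map_serre {C : Type*} [Ring C] [Algebra k C] (φ : B →ₐ[k] C) (q : k) (n : ℕ) (e f : B) :
    φ (serre q n e f) = serre q n (φ e) (φ f) := by
  simp [serre, map_sum]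

theorem serre_add (q : k) (n : ℕ) (e f g : B) :
    serre q n e (f + g) = serre q n e f + serre q n e g := by
  simp only [serre, ← Finset.sum_add_distrib, mul_add, add_mul, smul_add]

theorem serre_inv (q : k) (n : ℕ) (e f : B) : serre q⁻¹ n e f = serre q n e f := by
  simp only [serre, qbinom_inv]

theorem serre_smul (q : k) (n : ℕ) (α β : k) (e f : B) :
    serre q n (α • e) (β • f) = (α ^ n * β) • serre q n e f := by
  simp only [serre, Finset.smul_sum]
  refine Finset.sum_congr rfl fun s hs => ?_
  have hs' : s ≤ n := Nat.lt_succ_iff.1 (Finset.mem_range.1 hs)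
  obtain ⟨r, rfl⟩ := Nat.exists_eq_add_of_le hs'
  simp only [smul_pow, smul_mul_assoc, mul_smul_comm, smul_smul]
  congr 1
  rw [Nat.add_sub_cancel_left, pow_add]
  ring

theorem unop_serre (q : k) (n : ℕ) (e f : Bᵐᵒᵖ) :
    (serre q n e f).unop = (-1 : k) ^ n • serre q n e.unop f.unop := by
  simp only [serre, Finset.smul_sum]
  rw [Finset.unop_sum, ← Finset.sum_range_reflect]
  refine Finset.sum_congr rfl fun s hs => ?_
  have hs' : s ≤ n := Nat.lt_succ_iff.1 (Finset.mem_range.1 hs)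
  have e1 : n + 1 - 1 - s = n - s := by omega
  have e2 : (-1 : k) ^ (n - s) = (-1) ^ n * (-1) ^ s := by
    obtain ⟨r, rfl⟩ := Nat.exists_eq_add_of_le hs'
    rw [Nat.add_sub_cancel_left, pow_add]
    have : (-1 : k) ^ s * (-1) ^ s = 1 := by rw [← mul_pow]; simp
    linear_combination (-(-1 : k) ^ r) * this
  simp only [e1, Nat.sub_sub_self hs', qbinom_symm q hs', e2, MulOpposite.unop_smul, smul_smul,
    mul_assoc, MulOpposite.unop_mul, MulOpposite.unop_pow]

/-- Iterated `p`-commutators of `e` with `f`. -/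
def iter (p : k) (a : ℤ) (e f : B) : ℕ → B
  | 0 => f
  | m + 1 => e * iter p a e f m - p ^ (a + 2 * m) • (iter p a e f m * e)

theorem iter_eq_sum {p : k} (hp : IsGeneric p) (a : ℤ) (e f : B) (m : ℕ) :
    iter p a e f m = ∑ s ∈ Finset.range (m + 1),
      ((-1) ^ s * p ^ ((s : ℤ) * (m - 1 + a)) * qbinom p m s) • (e ^ (m - s) * f * e ^ s) := by
  induction m with
  | zero => simp [iter, qbinom_zero hp]
  | succ m ih =>
    have hp0 := hp.ne_zero
    rw [iter, ih, Finset.mul_sum, Finset.sum_mul, Finset.smul_sum]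
    rw [Finset.sum_range_succ' _ (m + 1)]
    have h1 : ∑ s ∈ Finset.range (m + 1), e * (((-1) ^ s * p ^ ((s : ℤ) * (m - 1 + a)) *
          qbinom p m s) • (e ^ (m - s) * f * e ^ s)) =
        ∑ s ∈ Finset.range (m + 1), ((-1) ^ (s + 1) * p ^ (((s + 1 : ℕ) : ℤ) * (m - 1 + a)) *
          qbinom p m (s + 1)) • (e ^ (m - s) * f * e ^ (s + 1)) + e ^ (m + 1) * f := by
      have h2 : ∀ s ∈ Finset.range (m + 1), e * (((-1) ^ s * p ^ ((s : ℤ) * (m - 1 + a)) *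
          qbinom p m s) • (e ^ (m - s) * f * e ^ s)) =
          ((-1) ^ s * p ^ ((s : ℤ) * (m - 1 + a)) *
          qbinom p m s) • (e ^ (m + 1 - s) * f * e ^ s) := by
        intro s hs
        have hs' : s ≤ m := Nat.lt_succ_iff.1 (Finset.mem_range.1 hs)
        rw [mul_smul_comm, Nat.succ_sub hs', pow_succ']; simp only [mul_assoc]
      rw [Finset.sum_congr rfl h2, Finset.sum_range_succ']
      rw [Finset.sum_range_succ _ m, qbinom_of_lt p (Nat.lt_succ_self m)]
      simp [qbinom_zero hp]
    rw [h1]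
    rw [add_sub_right_comm, ← Finset.sum_sub_distrib]
    congr 1
    · refine Finset.sum_congr rfl fun s hs => ?_
      have e1 : m + 1 - (s + 1) = m - s := by omega
      rw [e1, smul_mul_assoc, mul_assoc _ (e ^ s) e, ← pow_succ, smul_smul, ← sub_smul]
      congr 1
      have hP := qbinom_succ hp m s
      have x1 : p ^ (((s + 1 : ℕ) : ℤ) * ((m + 1 : ℕ) - 1 + a)) =
          p ^ (((s + 1 : ℕ) : ℤ) * (m - 1 + a)) * p ^ (s + 1) := by
        rw [← zpow_natCast p (s + 1), ← zpow_add₀ hp0]; congr 1; push_cast; ring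
      have x2 : p ^ (a + 2 * (m : ℤ)) * p ^ ((s : ℤ) * (m - 1 + a)) =
          p ^ (((s + 1 : ℕ) : ℤ) * (m - 1 + a)) * p ^ (m + 1) := by
        rw [← zpow_natCast p (m + 1), ← zpow_add₀ hp0, ← zpow_add₀ hp0]
        congr 1; push_cast; ring
      rw [x1]
      linear_combination (-(-1) ^ (s + 1) * p ^ (((s + 1 : ℕ) : ℤ) * (m - 1 + a))) * hP -
        ((-1) ^ s * qbinom p m s) * x2
    · simp [qbinom_zero hp]

theorem serre_eq_iter {p : k} (hp : IsGeneric p) {a : ℤ} {n : ℕ} (hn : (n : ℤ) = 1 - a)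
    (e f : B) : serre p n e f = iter p a e f n := by
  rw [iter_eq_sum hp, serre]
  refine Finset.sum_congr rfl fun s _ => ?_
  have : (n : ℤ) - 1 + a = 0 := by omega
  simp [this]

theorem comm_iter {p : k} (hp : IsGeneric p) {a : ℤ} {x y g : B} (hyx : y * x = p ^ 2 • (x * y))
    (hyg : y * g = p ^ a • (g * y)) (m : ℕ) :
    y * iter p a x g m = p ^ (a + 2 * m) • (iter p a x g m * y) := by
  have hp0 := hp.ne_zero
  induction m with
  | zero => simpa [iter] using hyg
  | succ m ih =>
    have hexp : p ^ (a + 2 * ((m + 1 : ℕ) : ℤ)) = p ^ 2 * p ^ (a + 2 * (m : ℤ)) := by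
      rw [← zpow_natCast p 2, ← zpow_add₀ hp0]; congr 1; push_cast; ring
    rw [hexp, iter, mul_sub, sub_mul, smul_sub]
    congr 1
    · rw [← mul_assoc, hyx, smul_mul_assoc, mul_assoc, ih, mul_smul_comm, smul_smul, mul_assoc]
    · rw [mul_smul_comm, ← mul_assoc, ih, smul_mul_assoc, mul_assoc _ y x, hyx, mul_smul_comm,
        smul_mul_assoc]
      simp only [smul_smul, mul_assoc]
      congr 1
      ring

theorem serre_add_left {p : k} (hp : IsGeneric p) {a : ℤ} {n : ℕ} (hn : (n : ℤ) = 1 - a)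
    {x y g : B} (hyx : y * x = p ^ 2 • (x * y)) (hyg : y * g = p ^ a • (g * y)) :
    serre p n (x + y) g = serre p n x g := by
  rw [serre_eq_iter hp hn, serre_eq_iter hp hn]
  generalize n = m
  induction m with
  | zero => rfl
  | succ m ih =>
    rw [iter, ih, iter, add_mul, mul_add, comm_iter hp hyx hyg, smul_add]
    abel

theorem serre_twist {p : k} (hp : IsGeneric p) {a : ℤ} {n : ℕ} (hn : (n : ℤ) = 1 - a)
    {c c' e f : B} (hcc : c * c' = c' * c) (hec : e * c = p ^ 2 • (c * e))
    (hfc : f * c = p ^ a • (c * f)) (hec' : e * c' = p ^ a • (c' * e))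
    (h0 : serre p n e f = 0) : serre p n (c * e) (c' * f) = 0 := by
  have hp0 := hp.ne_zero
  rw [serre_eq_iter hp hn] at h0 ⊢
  have hcomm : ∀ m, iter p a e f m * c = p ^ (a + 2 * m) • (c * iter p a e f m) := by
    intro m
    induction m with
    | zero => simpa [iter] using hfc
    | succ m ih =>
      have hexp : p ^ (a + 2 * ((m + 1 : ℕ) : ℤ)) = p ^ 2 * p ^ (a + 2 * (m : ℤ)) := by
        rw [← zpow_natCast p 2, ← zpow_add₀ hp0]; congr 1; push_cast; ring
      rw [hexp, iter, mul_sub, sub_mul, smul_sub]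
      congr 1
      · rw [mul_assoc, ih, mul_smul_comm, ← mul_assoc, hec, smul_mul_assoc, smul_smul, mul_assoc,
          mul_comm (p ^ 2)]
      · rw [smul_mul_assoc, mul_assoc, hec, mul_smul_comm, ← mul_assoc, ih, smul_mul_assoc,
          mul_smul_comm]
        simp only [smul_smul, mul_assoc]
        congr 1
        ring
  have hpow : ∀ m : ℕ, e * (c ^ m * c') = p ^ (a + 2 * m) • (c ^ m * c' * e) := by
    intro m
    induction m with
    | zero => simpa using hec'
    | succ m ih =>
      have hexp : p ^ (a + 2 * ((m + 1 : ℕ) : ℤ)) = p ^ 2 * p ^ (a + 2 * (m : ℤ)) := by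
        rw [← zpow_natCast p 2, ← zpow_add₀ hp0]; congr 1; push_cast; ring
      rw [hexp, pow_succ', mul_assoc c, ← mul_assoc e, hec, smul_mul_assoc, mul_assoc c, ih,
        mul_smul_comm, smul_smul]
      simp only [mul_assoc]
  have hcc' : ∀ m : ℕ, c ^ m * c' * c = c ^ (m + 1) * c' := by
    intro m
    rw [mul_assoc, ← hcc, ← mul_assoc, ← pow_succ]
  have key : ∀ m, ∃ κ : k, iter p a (c * e) (c' * f) m = κ • (c ^ m * c' * iter p a e f m) := by
    intro m
    induction m with
    | zero => exact ⟨1, by simp [iter]⟩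
    | succ m ih =>
      obtain ⟨κ, hκ⟩ := ih
      refine ⟨κ * p ^ (a + 2 * (m : ℤ)), ?_⟩
      rw [iter, hκ, iter]
      have h1 : c * e * (κ • (c ^ m * c' * iter p a e f m)) =
          (κ * p ^ (a + 2 * (m : ℤ))) • (c ^ (m + 1) * c' * (e * iter p a e f m)) := by
        rw [mul_smul_comm, mul_assoc c, ← mul_assoc e, hpow, smul_mul_assoc, mul_smul_comm,
          smul_smul, pow_succ']
        simp only [mul_assoc]
      have h2 : κ • (c ^ m * c' * iter p a e f m) * (c * e) =
          (κ * p ^ (a + 2 * (m : ℤ))) • (c ^ (m + 1) * c' * (iter p a e f m * e)) := by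
        rw [smul_mul_assoc, ← mul_assoc, mul_assoc _ _ c, hcomm, mul_smul_comm, smul_mul_assoc,
          smul_smul, ← mul_assoc, hcc']
        simp only [mul_assoc]
      rw [h1, h2, mul_sub, smul_sub, mul_smul_comm]
      congr 1
      rw [smul_comm]
  obtain ⟨κ, hκ⟩ := key n
  rw [hκ, h0, mul_zero, smul_zero]

end Serre

/-! ### The quantized enveloping algebra -/

/-- A symmetrizable Cartan matrix `a` with a chosen positive integral symmetrization:
`a i j` is the value of the simple root `α_j` on the simple coroot `α_i^∨`, and
`d i * a i j` is the pairing `⟨α_i, α_j⟩`. -/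
structure CartanDatum (I : Type*) where
  a : I → I → ℤ
  d : I → ℕ
  a_self : ∀ i, a i i = 2
  a_nonpos : ∀ i j, i ≠ j → a i j ≤ 0
  d_pos : ∀ i, 0 < d i
  symm : ∀ i j, (d i : ℤ) * a i j = d j * a j i

/-- The generators `E_i`, `F_i`, `K_i`, `K_i⁻¹`. -/
inductive Gen (I : Type*)
  | E (i : I) : Gen I
  | F (i : I) : Gen I
  | K (i : I) : Gen I
  | Kinv (i : I) : Gen I

section Algebra

variable {k : Type*} [Field k] {I : Type*}

/-- The defining relations of the quantized enveloping algebra, with `q_i = q ^ d_i`. -/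
inductive Rel (D : CartanDatum I) (q : k) :
    FreeAlgebra k (Gen I) → FreeAlgebra k (Gen I) → Prop
  | K_Kinv (i : I) : Rel D q (.ι k (.K i) * .ι k (.Kinv i)) 1
  | Kinv_K (i : I) : Rel D q (.ι k (.Kinv i) * .ι k (.K i)) 1
  | K_K (i j : I) : Rel D q (.ι k (.K i) * .ι k (.K j)) (.ι k (.K j) * .ι k (.K i))
  | K_E (i j : I) : Rel D q (.ι k (.K i) * .ι k (.E j) * .ι k (.Kinv i))
      (q ^ (D.d i * D.a i j) • .ι k (.E j))
  | K_F (i j : I) : Rel D q (.ι k (.K i) * .ι k (.F j) * .ι k (.Kinv i))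
      (q ^ (-(D.d i * D.a i j)) • .ι k (.F j))
  | E_F (i : I) : Rel D q (.ι k (.E i) * .ι k (.F i) - .ι k (.F i) * .ι k (.E i))
      ((q ^ D.d i - (q ^ D.d i)⁻¹)⁻¹ • (.ι k (.K i) - .ι k (.Kinv i)))
  | E_F_of_ne (i j : I) (h : i ≠ j) :
      Rel D q (.ι k (.E i) * .ι k (.F j) - .ι k (.F j) * .ι k (.E i)) 0
  | serre_E (i j : I) (h : i ≠ j) :
      Rel D q (serre (q ^ D.d i) (1 - D.a i j).toNat (.ι k (.E i)) (.ι k (.E j))) 0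
  | serre_F (i j : I) (h : i ≠ j) :
      Rel D q (serre (q ^ D.d i) (1 - D.a i j).toNat (.ι k (.F i)) (.ι k (.F j))) 0

/-- The quantized enveloping algebra attached to `D`, by generators and relations. -/
def Uq (D : CartanDatum I) (q : k) : Type _ := RingQuot (Rel D q)

instance (D : CartanDatum I) (q : k) : Ring (Uq D q) := inferInstanceAs (Ring (RingQuot (Rel D q)))

instance (D : CartanDatum I) (q : k) : Algebra k (Uq D q) :=
  inferInstanceAs (Algebra k (RingQuot (Rel D q)))

namespace Uq

variable (D : CartanDatum I) (q : k)

/-- The canonical projection from the free algebra. -/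
def mk : FreeAlgebra k (Gen I) →ₐ[k] Uq D q := RingQuot.mkAlgHom k (Rel D q)

/-- The generator `E_i`. -/
def E (i : I) : Uq D q := mk D q (.ι k (.E i))
/-- The generator `F_i`. -/
def F (i : I) : Uq D q := mk D q (.ι k (.F i))
/-- The generator `K_i`. -/
def K (i : I) : Uq D q := mk D q (.ι k (.K i))
/-- The generator `K_i⁻¹`. -/
def Kinv (i : I) : Uq D q := mk D q (.ι k (.Kinv i))

variable {D q}

theorem mk_rel {x y : FreeAlgebra k (Gen I)} (h : Rel D q x y) : mk D q x = mk D q y :=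
  RingQuot.mkAlgHom_rel k h

theorem K_mul_Kinv (i : I) : K D q i * Kinv D q i = 1 := by
  simpa [K, Kinv] using mk_rel (Rel.K_Kinv (D := D) (q := q) i)

theorem Kinv_mul_K (i : I) : Kinv D q i * K D q i = 1 := by
  simpa [K, Kinv] using mk_rel (Rel.Kinv_K (D := D) (q := q) i)

theorem K_mul_K (i j : I) : K D q i * K D q j = K D q j * K D q i := by
  simpa [K, Kinv] using mk_rel (Rel.K_K (D := D) (q := q) i j)

theorem K_E_Kinv (i j : I) :
    K D q i * E D q j * Kinv D q i = q ^ (D.d i * D.a i j) • E D q j := by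
  simpa [K, Kinv, E] using mk_rel (Rel.K_E (D := D) (q := q) i j)

theorem K_F_Kinv (i j : I) :
    K D q i * F D q j * Kinv D q i = q ^ (-(D.d i * D.a i j)) • F D q j := by
  simpa only [K, Kinv, F, map_mul, map_smul] using mk_rel (Rel.K_F (D := D) (q := q) i j)

theorem E_F (i : I) : E D q i * F D q i - F D q i * E D q i =
    (q ^ D.d i - (q ^ D.d i)⁻¹)⁻¹ • (K D q i - Kinv D q i) := by
  simpa only [K, Kinv, E, F, map_mul, map_smul, map_sub] using
    mk_rel (Rel.E_F (D := D) (q := q) i)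

theorem E_F_of_ne {i j : I} (h : i ≠ j) : E D q i * F D q j = F D q j * E D q i := by
  have := mk_rel (Rel.E_F_of_ne (D := D) (q := q) i j h)
  simpa only [E, F, map_mul, map_zero, map_sub, sub_eq_zero] using this

theorem serre_E {i j : I} (h : i ≠ j) :
    serre (q ^ D.d i) (1 - D.a i j).toNat (E D q i) (E D q j) = 0 := by
  simpa only [E, map_serre, map_zero] using mk_rel (Rel.serre_E (D := D) (q := q) i j h)

theorem serre_F {i j : I} (h : i ≠ j) :
    serre (q ^ D.d i) (1 - D.a i j).toNat (F D q i) (F D q j) = 0 := by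
  simpa only [F, map_serre, map_zero] using mk_rel (Rel.serre_F (D := D) (q := q) i j h)

theorem K_mul_E (i j : I) :
    K D q i * E D q j = q ^ (D.d i * D.a i j) • (E D q j * K D q i) := by
  rw [← smul_mul_assoc, ← K_E_Kinv, mul_assoc _ (Kinv D q i), Kinv_mul_K, mul_one]

theorem K_mul_F (i j : I) :
    K D q i * F D q j = q ^ (-(D.d i * D.a i j)) • (F D q j * K D q i) := by
  rw [← smul_mul_assoc, ← K_F_Kinv, mul_assoc _ (Kinv D q i), Kinv_mul_K, mul_one]

theorem E_mul_Kinv (i j : I) :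
    E D q j * Kinv D q i = q ^ (D.d i * D.a i j) • (Kinv D q i * E D q j) := by
  rw [← mul_smul_comm, ← K_E_Kinv, mul_assoc (K D q i), ← mul_assoc, Kinv_mul_K, one_mul]

theorem F_mul_Kinv (i j : I) :
    F D q j * Kinv D q i = q ^ (-(D.d i * D.a i j)) • (Kinv D q i * F D q j) := by
  rw [← mul_smul_comm, ← K_F_Kinv, mul_assoc (K D q i), ← mul_assoc, Kinv_mul_K, one_mul]

theorem E_mul_K (hq : IsGeneric q) (i j : I) :
    E D q j * K D q i = q ^ (-(D.d i * D.a i j)) • (K D q i * E D q j) := by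
  rw [K_mul_E, smul_smul, ← zpow_add₀ hq.ne_zero]; simp

theorem F_mul_K (hq : IsGeneric q) (i j : I) :
    F D q j * K D q i = q ^ (D.d i * D.a i j) • (K D q i * F D q j) := by
  rw [K_mul_F, smul_smul, ← zpow_add₀ hq.ne_zero]; simp

theorem Kinv_mul_E (hq : IsGeneric q) (i j : I) :
    Kinv D q i * E D q j = q ^ (-(D.d i * D.a i j)) • (E D q j * Kinv D q i) := by
  rw [E_mul_Kinv, smul_smul, ← zpow_add₀ hq.ne_zero]; simp

theorem Kinv_mul_F (hq : IsGeneric q) (i j : I) :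
    Kinv D q i * F D q j = q ^ (D.d i * D.a i j) • (F D q j * Kinv D q i) := by
  rw [F_mul_Kinv, smul_smul, ← zpow_add₀ hq.ne_zero]; simp

theorem Kinv_mul_Kinv (i j : I) : Kinv D q i * Kinv D q j = Kinv D q j * Kinv D q i := by
  calc Kinv D q i * Kinv D q j
      = Kinv D q i * Kinv D q j * (K D q i * K D q j) * (Kinv D q j * Kinv D q i) := by
        rw [mul_assoc, mul_assoc (K D q i), ← mul_assoc (K D q j), K_mul_Kinv, one_mul,
          K_mul_Kinv, mul_one]
    _ = Kinv D q j * Kinv D q i := by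
        rw [K_mul_K i j, mul_assoc (Kinv D q i), ← mul_assoc (Kinv D q j), Kinv_mul_K, one_mul,
          Kinv_mul_K, one_mul]

theorem K_mul_Kinv_comm (i j : I) : K D q i * Kinv D q j = Kinv D q j * K D q i := by
  calc K D q i * Kinv D q j = Kinv D q j * (K D q j * K D q i) * Kinv D q j := by
        rw [← mul_assoc, Kinv_mul_K, one_mul]
    _ = _ := by rw [← K_mul_K, mul_assoc, mul_assoc, K_mul_Kinv, mul_one]

/-- The universal property of the presentation. -/
def lift {B : Type*} [Ring B] [Algebra k B] (φ : Gen I → B)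
    (h : ∀ ⦃x y⦄, Rel D q x y → FreeAlgebra.lift k φ x = FreeAlgebra.lift k φ y) :
    Uq D q →ₐ[k] B :=
  RingQuot.liftAlgHom k ⟨FreeAlgebra.lift k φ, h⟩

theorem lift_mk {B : Type*} [Ring B] [Algebra k B] (φ : Gen I → B)
    (h : ∀ ⦃x y⦄, Rel D q x y → FreeAlgebra.lift k φ x = FreeAlgebra.lift k φ y)
    (x : FreeAlgebra k (Gen I)) : lift φ h (mk D q x) = FreeAlgebra.lift k φ x :=
  RingQuot.liftAlgHom_mkAlgHom_apply k _ _ _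

theorem qpow (D : CartanDatum I) (q : k) (i : I) (z : ℤ) :
    (q ^ D.d i) ^ z = q ^ ((D.d i : ℤ) * z) := by
  rw [zpow_mul, zpow_natCast]

theorem qpow_two (D : CartanDatum I) (q : k) (i : I) :
    (q ^ D.d i) ^ 2 = q ^ ((D.d i : ℤ) * D.a i i) := by
  rw [D.a_self, zpow_mul, zpow_natCast, zpow_ofNat]

theorem toNat_eq (D : CartanDatum I) {i j : I} (h : i ≠ j) :
    ((1 - D.a i j).toNat : ℤ) = 1 - D.a i j :=
  Int.toNat_of_nonneg (by have := D.a_nonpos i j h; omega)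


/-! ### Comultiplication and antipode -/

theorem K_K_Kinv (i j : I) : K D q i * K D q j * Kinv D q i = K D q j := by
  rw [K_mul_K, mul_assoc, K_mul_Kinv, mul_one]

theorem K_Kinv_Kinv (i j : I) : K D q i * Kinv D q j * Kinv D q i = Kinv D q j := by
  rw [K_mul_Kinv_comm, mul_assoc, K_mul_Kinv, mul_one]

/-- The comultiplication on the generators. -/
def comulGen (D : CartanDatum I) (q : k) : Gen I → Uq D q ⊗[k] Uq D q
  | .E i => E D q i ⊗ₜ 1 + K D q i ⊗ₜ E D q i
  | .F i => F D q i ⊗ₜ Kinv D q i + 1 ⊗ₜ F D q i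
  | .K i => K D q i ⊗ₜ K D q i
  | .Kinv i => Kinv D q i ⊗ₜ Kinv D q i

theorem tmul_pow' (x y : Uq D q) (n : ℕ) : (x ⊗ₜ[k] y) ^ n = (x ^ n) ⊗ₜ[k] (y ^ n) :=
  Algebra.TensorProduct.tmul_pow _ _ _

theorem serre_tmul_right (p : k) (n : ℕ) {c c' : Uq D q} (hcc : c * c' = c' * c) (e f : Uq D q) :
    serre p n (c ⊗ₜ[k] e) (c' ⊗ₜ[k] f) = (c ^ n * c') ⊗ₜ[k] serre p n e f := by
  simp only [serre, TensorProduct.tmul_sum]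
  refine Finset.sum_congr rfl fun s hs => ?_
  have hs' : s ≤ n := Nat.lt_succ_iff.1 (Finset.mem_range.1 hs)
  have hc : c ^ (n - s) * c' * c ^ s = c ^ n * c' := by
    rw [mul_assoc, ← (Commute.pow_left hcc s).eq, ← mul_assoc, ← pow_add, Nat.sub_add_cancel hs']
  rw [tmul_pow', tmul_pow', Algebra.TensorProduct.tmul_mul_tmul,
    Algebra.TensorProduct.tmul_mul_tmul, hc, TensorProduct.tmul_smul]

theorem serre_tmul_left (p : k) (n : ℕ) {c c' : Uq D q} (hcc : c * c' = c' * c) (e f : Uq D q) :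
    serre p n (e ⊗ₜ[k] c) (f ⊗ₜ[k] c') = serre p n e f ⊗ₜ[k] (c ^ n * c') := by
  simp only [serre, TensorProduct.sum_tmul]
  refine Finset.sum_congr rfl fun s hs => ?_
  have hs' : s ≤ n := Nat.lt_succ_iff.1 (Finset.mem_range.1 hs)
  have hc : c ^ (n - s) * c' * c ^ s = c ^ n * c' := by
    rw [mul_assoc, ← (Commute.pow_left hcc s).eq, ← mul_assoc, ← pow_add, Nat.sub_add_cancel hs']
  rw [tmul_pow', tmul_pow', Algebra.TensorProduct.tmul_mul_tmul,
    Algebra.TensorProduct.tmul_mul_tmul, hc, TensorProduct.smul_tmul']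

theorem comul_serre_E (hq : IsGeneric q) {i j : I} (h : i ≠ j) :
    serre (q ^ D.d i) (1 - D.a i j).toNat (comulGen D q (.E i)) (comulGen D q (.E j)) = 0 := by
  have hp := hq.pow (D.d_pos i)
  have hn := toNat_eq D h
  have hn' : ((1 - D.a i j).toNat : ℤ) = 1 - D.a i j := hn
  simp only [comulGen]
  have s1 : serre (q ^ D.d i) (1 - D.a i j).toNat
      (E D q i ⊗ₜ[k] (1 : Uq D q) + K D q i ⊗ₜ E D q i) (E D q j ⊗ₜ 1) = 0 := by
    rw [serre_add_left hp hn, serre_tmul_left _ _ rfl, serre_E h, TensorProduct.zero_tmul]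
    · rw [Algebra.TensorProduct.tmul_mul_tmul, Algebra.TensorProduct.tmul_mul_tmul, K_mul_E,
        qpow_two, one_mul, mul_one, TensorProduct.smul_tmul']
    · rw [Algebra.TensorProduct.tmul_mul_tmul, Algebra.TensorProduct.tmul_mul_tmul, K_mul_E,
        qpow, one_mul, mul_one, TensorProduct.smul_tmul']
  have s2 : serre (q ^ D.d i) (1 - D.a i j).toNat
      (E D q i ⊗ₜ[k] (1 : Uq D q) + K D q i ⊗ₜ E D q i) (K D q j ⊗ₜ E D q j) = 0 := by
    rw [add_comm, ← serre_inv, serre_add_left hp.inv hn, serre_inv,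
      serre_tmul_right _ _ (K_mul_K i j), serre_E h, TensorProduct.tmul_zero]
    · rw [Algebra.TensorProduct.tmul_mul_tmul, Algebra.TensorProduct.tmul_mul_tmul,
        E_mul_K hq, inv_pow, qpow_two, one_mul, mul_one, TensorProduct.smul_tmul', zpow_neg]
    · rw [Algebra.TensorProduct.tmul_mul_tmul, Algebra.TensorProduct.tmul_mul_tmul,
        E_mul_K hq, inv_zpow, qpow, one_mul, mul_one, TensorProduct.smul_tmul', zpow_neg, D.symm]
  rw [serre_add, s1, s2, add_zero]

theorem comul_serre_F (hq : IsGeneric q) {i j : I} (h : i ≠ j) :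
    serre (q ^ D.d i) (1 - D.a i j).toNat (comulGen D q (.F i)) (comulGen D q (.F j)) = 0 := by
  have hp := hq.pow (D.d_pos i)
  have hn := toNat_eq D h
  simp only [comulGen]
  have s1 : serre (q ^ D.d i) (1 - D.a i j).toNat
      (F D q i ⊗ₜ[k] Kinv D q i + 1 ⊗ₜ F D q i) (F D q j ⊗ₜ Kinv D q j) = 0 := by
    rw [← serre_inv, serre_add_left hp.inv hn, serre_inv,
      serre_tmul_left _ _ (Kinv_mul_Kinv i j), serre_F h, TensorProduct.zero_tmul]
    · rw [Algebra.TensorProduct.tmul_mul_tmul, Algebra.TensorProduct.tmul_mul_tmul,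
        F_mul_Kinv, inv_pow, qpow_two, one_mul, mul_one, TensorProduct.tmul_smul, zpow_neg]
    · rw [Algebra.TensorProduct.tmul_mul_tmul, Algebra.TensorProduct.tmul_mul_tmul,
        F_mul_Kinv, inv_zpow, qpow, one_mul, mul_one, TensorProduct.tmul_smul, zpow_neg, D.symm]
  have s2 : serre (q ^ D.d i) (1 - D.a i j).toNat
      (F D q i ⊗ₜ[k] Kinv D q i + 1 ⊗ₜ F D q i) (1 ⊗ₜ F D q j) = 0 := by
    rw [add_comm, serre_add_left hp hn, serre_tmul_right _ _ rfl, serre_F h,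
      TensorProduct.tmul_zero]
    · rw [Algebra.TensorProduct.tmul_mul_tmul, Algebra.TensorProduct.tmul_mul_tmul,
        Kinv_mul_F hq, qpow_two, one_mul, mul_one, TensorProduct.tmul_smul]
    · rw [Algebra.TensorProduct.tmul_mul_tmul, Algebra.TensorProduct.tmul_mul_tmul,
        Kinv_mul_F hq, qpow, one_mul, mul_one, TensorProduct.tmul_smul]
  rw [serre_add, s1, s2, add_zero]

/-- The mixed term in the commutator of `Δ(E_i)` and `Δ(F_j)` cancels. -/
theorem comul_E_F (hq : IsGeneric q) (i j : I) :
    comulGen D q (.E i) * comulGen D q (.F j) - comulGen D q (.F j) * comulGen D q (.E i) =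
      (E D q i * F D q j - F D q j * E D q i) ⊗ₜ Kinv D q j +
        K D q i ⊗ₜ (E D q i * F D q j - F D q j * E D q i) := by
  have hmix : (K D q i * F D q j) ⊗ₜ[k] (E D q i * Kinv D q j) =
      (F D q j * K D q i) ⊗ₜ[k] (Kinv D q j * E D q i) := by
    rw [K_mul_F, E_mul_Kinv, TensorProduct.tmul_smul, ← TensorProduct.smul_tmul', smul_smul,
      ← zpow_add₀ hq.ne_zero, D.symm, add_neg_cancel, zpow_zero, one_smul]
  simp only [comulGen, add_mul, mul_add, Algebra.TensorProduct.tmul_mul_tmul, one_mul, mul_one,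
    TensorProduct.sub_tmul, TensorProduct.tmul_sub, hmix]
  abel

/-- The comultiplication: the algebra homomorphism with
`Δ(E_i) = E_i ⊗ 1 + K_i ⊗ E_i`, `Δ(F_i) = F_i ⊗ K_i⁻¹ + 1 ⊗ F_i`, `Δ(K_i) = K_i ⊗ K_i`. -/
def comul (D : CartanDatum I) (hq : IsGeneric q) : Uq D q →ₐ[k] Uq D q ⊗[k] Uq D q :=
  lift (comulGen D q) <| by
    intro x y hxy
    induction hxy with
    | K_Kinv i =>
      simp [comulGen, K_mul_Kinv, Algebra.TensorProduct.one_def]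
    | Kinv_K i =>
      simp [comulGen, Kinv_mul_K, Algebra.TensorProduct.one_def]
    | K_K i j =>
      simp [comulGen, K_mul_K i j]
    | K_E i j =>
      simp [comulGen, mul_add, add_mul, K_E_Kinv, K_K_Kinv, K_mul_Kinv,
        TensorProduct.smul_tmul']
    | K_F i j =>
      simp only [comulGen, mul_add, add_mul, K_F_Kinv, K_Kinv_Kinv, K_mul_Kinv, map_mul, map_smul,
        FreeAlgebra.lift_ι_apply, Algebra.TensorProduct.tmul_mul_tmul, mul_one, smul_add,
        TensorProduct.smul_tmul', TensorProduct.tmul_smul]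
    | E_F i =>
      simp only [map_sub, map_mul, map_smul, FreeAlgebra.lift_ι_apply, comul_E_F hq, E_F]
      simp only [comulGen, TensorProduct.sub_tmul, TensorProduct.tmul_sub, TensorProduct.tmul_smul,
        ← TensorProduct.smul_tmul', ← smul_add]
      congr 1
      abel
    | E_F_of_ne i j h =>
      simp only [map_sub, map_mul, map_zero, FreeAlgebra.lift_ι_apply, comul_E_F hq, E_F_of_ne h,
        sub_self, TensorProduct.zero_tmul, TensorProduct.tmul_zero, add_zero]
    | serre_E i j h =>
      simp only [map_serre, map_zero, FreeAlgebra.lift_ι_apply, comul_serre_E hq h]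
    | serre_F i j h =>
      simp only [map_serre, map_zero, FreeAlgebra.lift_ι_apply, comul_serre_F hq h]

/-- The antipode on the generators, with values in the opposite algebra. -/
def antipodeGen (D : CartanDatum I) (q : k) : Gen I → (Uq D q)ᵐᵒᵖ
  | .E i => .op (-(Kinv D q i * E D q i))
  | .F i => .op (-(F D q i * K D q i))
  | .K i => .op (Kinv D q i)
  | .Kinv i => .op (K D q i)

theorem antipode_serre_E (hq : IsGeneric q) {i j : I} (h : i ≠ j) :
    serre (q ^ D.d i) (1 - D.a i j).toNat (antipodeGen D q (.E i)) (antipodeGen D q (.E j)) =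
      0 := by
  apply MulOpposite.unop_injective
  rw [unop_serre]
  simp only [antipodeGen, MulOpposite.unop_op, MulOpposite.unop_zero]
  rw [← neg_one_smul k (Kinv D q i * E D q i), ← neg_one_smul k (Kinv D q j * E D q j), serre_smul,
    serre_twist (hq.pow (D.d_pos i)) (toNat_eq D h) (Kinv_mul_Kinv i j) _ _ _ (serre_E h),
    smul_zero, smul_zero]
  · rw [E_mul_Kinv, qpow_two]
  · rw [E_mul_Kinv, qpow]
  · rw [E_mul_Kinv, qpow, D.symm]

theorem antipode_serre_F (hq : IsGeneric q) {i j : I} (h : i ≠ j) :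
    serre (q ^ D.d i) (1 - D.a i j).toNat (antipodeGen D q (.F i)) (antipodeGen D q (.F j)) =
      0 := by
  apply MulOpposite.unop_injective
  rw [unop_serre]
  simp only [antipodeGen, MulOpposite.unop_op, MulOpposite.unop_zero]
  rw [F_mul_K hq, F_mul_K hq, ← neg_smul, ← neg_smul, serre_smul,
    serre_twist (hq.pow (D.d_pos i)) (toNat_eq D h) (K_mul_K i j) _ _ _ (serre_F h),
    smul_zero, smul_zero]
  · rw [F_mul_K hq, qpow_two]
  · rw [F_mul_K hq, qpow]
  · rw [F_mul_K hq, qpow, D.symm]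

theorem antipode_E_F (hq : IsGeneric q) (i j : I) :
    antipodeGen D q (.E i) * antipodeGen D q (.F j) -
      antipodeGen D q (.F j) * antipodeGen D q (.E i) =
      .op (-(q ^ (D.d j * D.a j j - D.d j * D.a j i) •
        (Kinv D q i * K D q j * (E D q i * F D q j - F D q j * E D q i)))) := by
  have h1 : F D q j * K D q j * (Kinv D q i * E D q i) =
      q ^ (D.d j * D.a j j - D.d j * D.a j i) •
        (Kinv D q i * K D q j * (F D q j * E D q i)) := by
    calc F D q j * K D q j * (Kinv D q i * E D q i)
        = F D q j * K D q j * Kinv D q i * E D q i := by simp only [mul_assoc]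
      _ = q ^ (D.d j * D.a j j) • (K D q j * (F D q j * Kinv D q i) * E D q i) := by
          rw [F_mul_K hq]; simp only [smul_mul_assoc, mul_assoc]
      _ = _ := by
          rw [F_mul_Kinv, mul_smul_comm, smul_mul_assoc, smul_smul, ← zpow_add₀ hq.ne_zero,
            D.symm i j, ← sub_eq_add_neg, ← K_mul_Kinv_comm]
          simp only [mul_assoc]
  have h2 : Kinv D q i * E D q i * (F D q j * K D q j) =
      q ^ (D.d j * D.a j j - D.d j * D.a j i) •
        (Kinv D q i * K D q j * (E D q i * F D q j)) := by
    calc Kinv D q i * E D q i * (F D q j * K D q j)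
        = q ^ (D.d j * D.a j j) • (Kinv D q i * (E D q i * K D q j) * F D q j) := by
          rw [F_mul_K hq]; simp only [mul_smul_comm, mul_assoc]
      _ = _ := by
          rw [E_mul_K hq, mul_smul_comm, smul_mul_assoc, smul_smul, ← zpow_add₀ hq.ne_zero,
            ← sub_eq_add_neg]
          simp only [mul_assoc]
  simp only [antipodeGen, ← MulOpposite.op_mul, ← MulOpposite.op_sub, neg_mul_neg]
  rw [h1, h2, mul_sub, smul_sub, neg_sub]

/-- The antipode, as an algebra homomorphism to the opposite algebra:
`S(E_i) = -K_i⁻¹ E_i`, `S(F_i) = -F_i K_i`, `S(K_i) = K_i⁻¹`. -/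
def antipode (D : CartanDatum I) (hq : IsGeneric q) : Uq D q →ₐ[k] (Uq D q)ᵐᵒᵖ :=
  lift (antipodeGen D q) <| by
    intro x y hxy
    induction hxy with
    | K_Kinv i =>
      simp [antipodeGen, ← MulOpposite.op_mul, K_mul_Kinv]
    | Kinv_K i =>
      simp [antipodeGen, ← MulOpposite.op_mul, Kinv_mul_K]
    | K_K i j =>
      simp [antipodeGen, ← MulOpposite.op_mul, Kinv_mul_Kinv i j]
    | K_E i j =>
      simp only [map_mul, map_smul, FreeAlgebra.lift_ι_apply, antipodeGen, ← MulOpposite.op_mul,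
        ← MulOpposite.op_smul]
      rw [neg_mul, mul_neg, smul_neg, ← mul_assoc (K D q i), ← mul_assoc (K D q i),
        K_mul_Kinv_comm, mul_assoc (Kinv D q j), mul_assoc (Kinv D q j), K_E_Kinv, mul_smul_comm]
    | K_F i j =>
      simp only [map_mul, map_smul, FreeAlgebra.lift_ι_apply, antipodeGen, ← MulOpposite.op_mul,
        ← MulOpposite.op_smul]
      rw [neg_mul, mul_neg, smul_neg, mul_assoc (F D q j), K_mul_Kinv_comm,
        ← mul_assoc (F D q j), ← mul_assoc (K D q i), ← mul_assoc (K D q i), K_F_Kinv,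
        smul_mul_assoc]
    | E_F i =>
      simp only [map_sub, map_mul, map_smul, FreeAlgebra.lift_ι_apply, antipode_E_F hq, E_F,
        sub_self, zpow_zero, one_smul, Kinv_mul_K, one_mul]
      simp only [antipodeGen, ← MulOpposite.op_sub, ← MulOpposite.op_smul]
      rw [← smul_neg, neg_sub]
    | E_F_of_ne i j h =>
      simp only [map_sub, map_mul, map_zero, FreeAlgebra.lift_ι_apply, antipode_E_F hq,
        E_F_of_ne h, sub_self, mul_zero, smul_zero, neg_zero, MulOpposite.op_zero]
    | serre_E i j h =>
      simp only [map_serre, map_zero, FreeAlgebra.lift_ι_apply, antipode_serre_E hq h]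
    | serre_F i j h =>
      simp only [map_serre, map_zero, FreeAlgebra.lift_ι_apply, antipode_serre_F hq h]

theorem comul_E (hq : IsGeneric q) (i : I) :
    comul D hq (E D q i) = E D q i ⊗ₜ 1 + K D q i ⊗ₜ E D q i := by
  rw [comul, E, lift_mk, FreeAlgebra.lift_ι_apply]; rfl

theorem comul_F (hq : IsGeneric q) (i : I) :
    comul D hq (F D q i) = F D q i ⊗ₜ Kinv D q i + 1 ⊗ₜ F D q i := by
  rw [comul, F, lift_mk, FreeAlgebra.lift_ι_apply]; rfl

theorem comul_K (hq : IsGeneric q) (i : I) :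
    comul D hq (K D q i) = K D q i ⊗ₜ K D q i := by
  rw [comul, K, lift_mk, FreeAlgebra.lift_ι_apply]; rfl

theorem comul_Kinv (hq : IsGeneric q) (i : I) :
    comul D hq (Kinv D q i) = Kinv D q i ⊗ₜ Kinv D q i := by
  rw [comul, Kinv, lift_mk, FreeAlgebra.lift_ι_apply]; rfl

theorem antipode_E (hq : IsGeneric q) (i : I) :
    antipode D hq (E D q i) = .op (-(Kinv D q i * E D q i)) := by
  rw [antipode, E, lift_mk, FreeAlgebra.lift_ι_apply]; rfl

theorem antipode_F (hq : IsGeneric q) (i : I) :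
    antipode D hq (F D q i) = .op (-(F D q i * K D q i)) := by
  rw [antipode, F, lift_mk, FreeAlgebra.lift_ι_apply]; rfl

theorem antipode_K (hq : IsGeneric q) (i : I) :
    antipode D hq (K D q i) = .op (Kinv D q i) := by
  rw [antipode, K, lift_mk, FreeAlgebra.lift_ι_apply]; rfl

theorem antipode_Kinv (hq : IsGeneric q) (i : I) :
    antipode D hq (Kinv D q i) = .op (K D q i) := by
  rw [antipode, Kinv, lift_mk, FreeAlgebra.lift_ι_apply]; rfl

end Uq

/-! ### The adjoint action and its cyclic submodules -/

open Uq

variable (D : CartanDatum I) {q : k} (hq : IsGeneric q)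

/-- Right multiplication, as a homomorphism `Uᵐᵒᵖ → End(U)`. -/
def rightMul : (Uq D q)ᵐᵒᵖ →ₐ[k] Module.End k (Uq D q) := Algebra.lsmul k k (Uq D q)

theorem rightMul_apply (y : (Uq D q)ᵐᵒᵖ) (b : Uq D q) : rightMul D y b = b * y.unop := rfl

theorem commute_lmul_rightMul (x : Uq D q) (y : (Uq D q)ᵐᵒᵖ) :
    Commute (Algebra.lmul k (Uq D q) x) (rightMul D y) :=
  LinearMap.ext fun b => (mul_assoc x b y.unop).symm

/-- For fixed `b`, the linear map `U ⊗ U → U`, `x ⊗ y ↦ x b S(y)`, bundled as the algebra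
homomorphism `U ⊗ U → End(U)`, `x ⊗ y ↦ (b ↦ x b S(y))`. -/
def sandwich : Uq D q ⊗[k] Uq D q →ₐ[k] Module.End k (Uq D q) :=
  Algebra.TensorProduct.lift (Algebra.lmul k (Uq D q)) ((rightMul D).comp (antipode D hq))
    fun x y => commute_lmul_rightMul D x (antipode D hq y)

theorem sandwich_tmul (x y b : Uq D q) :
    sandwich D hq (x ⊗ₜ y) b = x * b * (antipode D hq y).unop := by
  rw [mul_assoc]
  exact DFunLike.congr_fun (Algebra.TensorProduct.lift_tmul (Algebra.lmul k (Uq D q))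
    ((rightMul D).comp (antipode D hq)) _ x y) b

/-- The left adjoint action `ad_L(a)(b) = a₍₁₎ b S(a₍₂₎)`. -/
def adL : Uq D q →ₐ[k] Module.End k (Uq D q) := (sandwich D hq).comp (comul D hq)

theorem adL_E (i : I) (b : Uq D q) :
    adL D hq (E D q i) b = E D q i * b - K D q i * b * Kinv D q i * E D q i := by
  simp [adL, comul_E, sandwich_tmul, antipode_E, mul_assoc, sub_eq_add_neg]

theorem adL_F (i : I) (b : Uq D q) :
    adL D hq (F D q i) b = (F D q i * b - b * F D q i) * K D q i := by
  simp [adL, comul_F, sandwich_tmul, antipode_F, antipode_Kinv, mul_assoc, sub_eq_add_neg, add_mul]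

theorem adL_K (i : I) (b : Uq D q) :
    adL D hq (K D q i) b = K D q i * b * Kinv D q i := by
  simp [adL, comul_K, sandwich_tmul, antipode_K]

variable (q) in
/-- The quantum Levi subalgebra, generated by `E_i`, `F_i` for `i ∈ S` and all `K_j^{±1}`. -/
def levi (S : Set I) : Subalgebra k (Uq D q) :=
  Algebra.adjoin k (E D q '' S ∪ F D q '' S ∪ Set.range (K D q) ∪ Set.range (Kinv D q))

/-- The cyclic adjoint module `M(v) = {ad_L(a)(v) : a ∈ U_q(l_S)}`. -/
def cyclic (S : Set I) (v : Uq D q) : Submodule k (Uq D q) :=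
  (Subalgebra.toSubmodule (levi D q S)).map ((adL D hq).toLinearMap.flip v)

theorem mem_cyclic {S : Set I} {v x : Uq D q} :
    x ∈ cyclic D hq S v ↔ ∃ a ∈ levi D q S, adL D hq a v = x := by
  simp [cyclic]

/-- The relative locally finite part `F_S`. -/
def locallyFinitePart (S : Set I) : Set (Uq D q) :=
  {v | FiniteDimensional k (cyclic D hq S v)}

/-- `N` is a `U_q(l_S)`-submodule of `U_q(g)` for the left adjoint action. -/
def IsLeviSubmodule (S : Set I) (N : Submodule k (Uq D q)) : Prop :=
  ∀ a ∈ levi D q S, ∀ x ∈ N, adL D hq a x ∈ N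

/-- `N` is an irreducible `U_q(l_S)`-submodule of `U_q(g)` for the left adjoint action. -/
def IsIrreducibleLeviSubmodule (S : Set I) (N : Submodule k (Uq D q)) : Prop :=
  IsLeviSubmodule D hq S N ∧ N ≠ ⊥ ∧
    ∀ N' ≤ N, IsLeviSubmodule D hq S N' → N' = ⊥ ∨ N' = N

/-- `w` has weight `μ`, where `μ` is the integral weight with `⟨μ, α_j^∨⟩ = μ j`, so that
`⟨μ, α_j⟩ = d_j μ_j`. -/
def HasWeight (w : Uq D q) (μ : I → ℤ) : Prop :=
  ∀ j, adL D hq (K D q j) w = q ^ (D.d j * μ j) • w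

/-- `w` is a highest weight vector for the left adjoint action of `U_q(l_S)`. -/
def IsHighestWeightVector (S : Set I) (w : Uq D q) : Prop :=
  w ≠ 0 ∧ (∃ μ : I → ℤ, HasWeight D hq w μ) ∧ ∀ i ∈ S, adL D hq (E D q i) w = 0

end Algebra

section Lie

open LieAlgebra.IsKilling

variable {L : Type*} [LieRing L] [LieAlgebra ℂ L] [FiniteDimensional ℂ L]
  [LieAlgebra.IsSemisimple ℂ L] {H : LieSubalgebra ℂ L} [H.IsCartanSubalgebra]

/-- The Cartan integer `a_ij = α_j(α_i^∨)` of simple roots `α_i`, `α_j`. -/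
def cartanInt (b : (rootSystem H).Base) (i j : b.support) : ℤ := b.cartanMatrix j i

/-- The Cartan datum of a complex semisimple Lie algebra with Cartan subalgebra `H` and simple
roots `b`, with a choice of symmetrizing positive integers. -/
def lieDatum (b : (rootSystem H).Base) (d : b.support → ℕ) (hd : ∀ i, 0 < d i)
    (hsymm : ∀ i j, (d i : ℤ) * cartanInt b i j = d j * cartanInt b j i) :
    CartanDatum b.support where
  a := cartanInt b
  d := d
  a_self i := b.cartanMatrix_apply_same i
  a_nonpos i j h := b.cartanMatrix_le_zero_of_ne j i h.symm
  d_pos := hd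
  symm := hsymm

end Lie

end QuantumLevi

end

open QuantumLevi

/-! Conjugation by the `K_j` splits `U_q(g)` into root-lattice weight spaces, and every adjoint
submodule inherits this splitting. For `v` in the locally finite part, `M(v)` is therefore a
finite-dimensional weight module for the quantum Levi subalgebra, and the theorem is complete
reducibility for such modules. The proof follows the classical pattern: a Casimir operator separates
comparable dominant weights. No Serre relation is used on these modules (`IsWeightModule` does not
record them).

The Casimir operator comes from a bilinear form on the free algebra for which multiplication by a
generator is adjoint to a skew derivation (`form`, `skewRight`, `skewLeft`). The same skew
derivations describe commutators of products of `E`s with `F_i`, and of products of `F`s with `K_i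
E_i`. In a finite-dimensional algebra the radical of the form acts by zero (`lift_eq_zero`,
`lower_eq_zero`): by induction on degree the image of a radical element commutes with all `F_i` (or
all `K_i E_i`), finite type gives an `i` for which its weight has a definite sign, and rank one
theory (`highest_weight_nonneg`, through `eq_zero_of_commute_F` and `eq_zero_of_commute_KE`) forces
it to vanish. Hence the canonical tensor of the form makes sense, and contracting it by
multiplication gives `Ω` (`IsQuantumFamily.exists_casimir`). Multiplying `Ω` by `q ^ casimirExp β`
on the weight `β` gives an operator that commutes with the action and is the scalar `q ^ casimirExp
β` on a singular vector of weight `β`, also when the vector is singular only modulo a stable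
subspace (`IsWeightModule.exists_casimir`).

The exponent is `-(β, β + 2ρ)`, and it differs at two dominant weights whose difference is a nonzero
sum of simple roots of the Levi (`casimirExp_ne`). It follows that a singular weight vector
generates an irreducible module (`eq_generated_of_le`). It also follows that singular vectors
generate everything (`iSup_generated`): a vector singular modulo their span is corrected, by a
polynomial in the Casimir operator, to one that is truly singular. Lie theory enters only through
positivity of the root form (`exists_pos_cartanMatrix`). -/

namespace QuantumLevi

/-! ### Rank one: highest weights are nonnegative -/

section RankOne

variable {k : Type*} [Field k] {q : k}

theorem IsGeneric.zpow_eq_one (hq : IsGeneric q) {a : ℤ} (h : q ^ a = 1) : a = 0 := by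
  by_contra ha
  have h1 : q ^ a.natAbs = 1 := by
    rcases Int.natAbs_eq a with h2 | h2
    · rw [h2] at h; rwa [zpow_natCast] at h
    · rw [h2] at h; rwa [zpow_neg, inv_eq_one, zpow_natCast] at h
  exact hq.pow_ne_one _ (Int.natAbs_pos.2 ha) h1

theorem IsGeneric.zpow_injective (hq : IsGeneric q) : Function.Injective fun a : ℤ => q ^ a := by
  intro a b h
  have : q ^ (a - b) = 1 := by
    rw [zpow_sub₀ hq.ne_zero, div_eq_one_iff_eq (zpow_ne_zero _ hq.ne_zero)]; exact h
  have := hq.zpow_eq_one this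
  omega

theorem IsGeneric.zpow_sub_ne_zero (hq : IsGeneric q) {a : ℤ} (ha : a ≠ 0) :
    q ^ a - q ^ (-a) ≠ 0 := by
  intro h
  have := hq.zpow_injective (sub_eq_zero.1 h)
  omega

variable {V : Type*} [AddCommGroup V] [Module k V]

/-- A highest weight vector of a finite-dimensional representation of a rank one quantum group has
nonnegative weight. -/
theorem highest_weight_nonneg [FiniteDimensional k V] (hq : IsGeneric q) {d : ℕ} (hd : 0 < d)
    {e f κ κ' : Module.End k V} (hκ : κ' * κ = 1)
    (hf : κ * f = q ^ (-(2 * d : ℤ)) • (f * κ)) (hef : e * f - f * e = κ - κ')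
    {v : V} (hv : v ≠ 0) (he : e v = 0) {m : ℤ} (hm : κ v = q ^ m • v) : 0 ≤ m := by
  by_contra! hneg
  have hq0 := hq.ne_zero
  have hκn : ∀ n : ℕ, κ ((f ^ n) v) = q ^ (m - 2 * d * n) • (f ^ n) v := by
    intro n
    induction n with
    | zero => simpa using hm
    | succ n ih =>
      have := LinearMap.congr_fun hf ((f ^ n) v)
      rw [Module.End.mul_apply, LinearMap.smul_apply, Module.End.mul_apply, ih, map_smul,
        smul_smul, ← zpow_add₀ hq0] at this
      rw [pow_succ', Module.End.mul_apply, this]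
      congr 2
      push_cast; ring
  have hκn' : ∀ n : ℕ, κ' ((f ^ n) v) = q ^ (-(m - 2 * d * n)) • (f ^ n) v := by
    intro n
    have h1 := LinearMap.congr_fun hκ ((f ^ n) v)
    rw [Module.End.mul_apply, hκn, map_smul, Module.End.one_apply] at h1
    conv_rhs => rw [← h1]
    rw [smul_smul, ← zpow_add₀ hq0, neg_add_cancel, zpow_zero, one_smul]
  -- The usual formula for `e f^(n+1) v`, with the denominator of the quantum integer cleared. The
  -- relation `hef` has no denominator, so the second factor on the right appears undivided.
  have hen : ∀ n : ℕ, (q ^ (d : ℤ) - q ^ (-(d : ℤ))) • e ((f ^ (n + 1)) v) =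
      ((q ^ (d * (n + 1) : ℤ) - q ^ (-(d * (n + 1) : ℤ))) *
        (q ^ (m - d * n) - q ^ (-(m - d * n)))) • (f ^ n) v := by
    intro n
    have step : ∀ n : ℕ, e ((f ^ (n + 1)) v) = f (e ((f ^ n) v)) +
        (q ^ (m - 2 * d * n) - q ^ (-(m - 2 * d * n))) • (f ^ n) v := by
      intro n
      have := LinearMap.congr_fun hef ((f ^ n) v)
      simp only [LinearMap.sub_apply, Module.End.mul_apply] at this
      rw [hκn, hκn', ← sub_smul] at this
      rw [← this, pow_succ', Module.End.mul_apply]; abel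
    induction n with
    | zero => rw [step]; simp [he, smul_smul]
    | succ n ih =>
      rw [step, smul_add, ← map_smul, ih, map_smul, ← Module.End.mul_apply, ← pow_succ', smul_smul,
        ← add_smul]
      congr 1
      have hx := zpow_ne_zero (d * n : ℤ) hq0
      have hy := zpow_ne_zero m hq0
      have hQ := zpow_ne_zero (d : ℤ) hq0
      have e1 : q ^ (d * (n + 1) : ℤ) = q ^ (d * n : ℤ) * q ^ (d : ℤ) := by
        rw [← zpow_add₀ hq0, mul_add, mul_one]
      have e2 : q ^ (d * ((n + 1 : ℕ) + 1) : ℤ) = q ^ (d * n : ℤ) * (q ^ (d : ℤ)) ^ 2 := by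
        rw [pow_two, ← zpow_add₀ hq0, ← zpow_add₀ hq0]; push_cast; congr 1; ring
      have e3 : q ^ (m - d * (n + 1 : ℕ)) = q ^ m / (q ^ (d * n : ℤ) * q ^ (d : ℤ)) := by
        rw [← zpow_add₀ hq0, ← zpow_sub₀ hq0]; push_cast; congr 1
      have e4 : q ^ (m - 2 * d * (n + 1 : ℕ)) = q ^ m / (q ^ (d * n : ℤ) * q ^ (d : ℤ)) ^ 2 := by
        rw [← zpow_add₀ hq0, pow_two, ← zpow_add₀ hq0, ← zpow_sub₀ hq0]
        congr 1; push_cast; ring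
      simp only [zpow_neg, e1, e2, e3, e4, zpow_sub₀ hq0]
      field_simp
      ring
  -- For `m < 0` the exponents `d (n + 1)` and `m - d n` are never zero, so no power of `f` kills
  -- `v`.
  have hne : ∀ n : ℕ, (f ^ n) v ≠ 0 := by
    intro n
    induction n with
    | zero => simpa using hv
    | succ n ih =>
      intro h0
      have := hen n
      rw [h0, map_zero, smul_zero, eq_comm, smul_eq_zero] at this
      refine this.elim (mul_ne_zero (hq.zpow_sub_ne_zero ?_) (hq.zpow_sub_ne_zero ?_)) ih
      · positivity
      · have : (0 : ℤ) ≤ d * n := by positivity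
        omega
  -- The vectors `f^n v` would be eigenvectors of `κ` for infinitely many distinct eigenvalues,
  -- against finite dimension.
  have hfin : Set.Finite {c : k | κ.HasEigenvalue c} := Module.End.finite_hasEigenvalue κ
  refine Set.infinite_univ (α := ℕ) (Set.Finite.preimage (f := fun n : ℕ => q ^ (m - 2 * d * n))
    ?_ hfin |>.subset fun n _ => ?_)
  · intro a _ b _ h
    have := hq.zpow_injective h
    have h2 : (d : ℤ) * a = d * b := by linarith
    exact_mod_cast mul_left_cancel₀ (by positivity : (d : ℤ) ≠ 0) h2
  · exact Module.End.hasEigenvalue_of_hasEigenvector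
      ⟨Module.End.mem_eigenspace_iff.2 (hκn n), hne n⟩

end RankOne

/-! ### Rank one acting on an algebra by an adjoint action -/

section RankOneAlgebra

variable {k : Type*} [Field k] {q : k} {A : Type*} [Ring A] [Algebra k A]

/-- The adjoint action of `E` on an algebra containing a rank one quantum group. -/
def adE (E K K' : A) : Module.End k A :=
  LinearMap.mulLeft k E - LinearMap.mulLeft k K' ∘ₗ LinearMap.mulRight k (K * E)

/-- The adjoint action of `F` on an algebra containing a rank one quantum group. -/
def adF (F K' : A) : Module.End k A :=
  LinearMap.mulRight k K' ∘ₗ (LinearMap.mulLeft k F - LinearMap.mulRight k F)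

/-- The linear map `b ↦ x b y`. -/
def conj (x y : A) : Module.End k A := LinearMap.mulLeft k x ∘ₗ LinearMap.mulRight k y

theorem adE_apply (E K K' b : A) : adE (k := k) E K K' b = E * b - K' * (b * (K * E)) := rfl

theorem adF_apply (F K' b : A) : adF (k := k) F K' b = (F * b - b * F) * K' := rfl

theorem conj_apply (x y b : A) : conj (k := k) x y b = x * (b * y) := rfl

theorem conj_mul_conj {x x' y y' : A} (h : x * x' = 1) (h' : y' * y = 1) :
    conj (k := k) x y * conj x' y' = 1 :=
  LinearMap.ext fun b => by
    simp only [Module.End.mul_apply, conj_apply, Module.End.one_apply]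
    rw [mul_assoc x' , ← mul_assoc x, h, one_mul, mul_assoc, h', mul_one]

theorem mul_inv_comm_of {c : k} {X K K' : A} (hKK' : K * K' = 1) (hK'K : K' * K = 1)
    (h : K * X = c • (X * K)) : X * K' = c • (K' * X) := by
  calc X * K' = K' * (K * X) * K' := by rw [← mul_assoc, hK'K, one_mul]
    _ = c • (K' * X) := by
      rw [h, mul_smul_comm, smul_mul_assoc, mul_assoc, mul_assoc, hKK', mul_one]

theorem conj_eq_smul {c : k} {b K K' : A} (hKK' : K * K' = 1) (h : K * b = c • (b * K)) :
    conj (k := k) K K' b = c • b := by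
  rw [conj_apply, ← mul_assoc, h, smul_mul_assoc, mul_assoc, hKK', mul_one]

theorem conj_inv_eq_smul {c : k} (hc : c ≠ 0) {b K K' : A} (hK'K : K' * K = 1)
    (h : K * b = c • (b * K)) : conj (k := k) K' K b = c⁻¹ • b := by
  rw [conj_apply, ← inv_smul_smul₀ hc (b * K), ← h, mul_smul_comm, ← mul_assoc, hK'K, one_mul]

theorem conj_mul_adE {c : k} {E K K' : A} (hK'K : K' * K = 1) (hKK' : K * K' = 1)
    (hKE : K * E = c • (E * K)) :
    conj K K' * adE E K K' = c • (adE (k := k) E K K' * conj K K') := by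
  refine LinearMap.ext fun b => ?_
  simp only [Module.End.mul_apply, LinearMap.smul_apply, conj_apply, adE_apply]
  have h1 : K * (E * b * K') = c • (E * (K * (b * K'))) := by
    rw [← mul_assoc, ← mul_assoc, hKE, smul_mul_assoc, smul_mul_assoc]; simp only [mul_assoc]
  have h2 : K * (K' * (b * (K * E)) * K') = c • (K' * (K * (b * K') * (K * E))) := by
    calc K * (K' * (b * (K * E)) * K') = (K * K') * b * (K * E) * K' := by
          simp only [mul_assoc]
      _ = c • ((K' * K) * b * (K' * K) * E) := by
          rw [hKE, hKK', hK'K, mul_smul_comm, smul_mul_assoc, mul_assoc, mul_assoc E, hKK']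
          simp only [one_mul, mul_one]
      _ = _ := by simp only [mul_assoc]
  rw [sub_mul, mul_sub, h1, h2, smul_sub]

theorem conj_mul_adF {c : k} {F K K' : A} (hKK' : K * K' = 1) (hK'K : K' * K = 1)
    (hKF : K * F = c • (F * K)) :
    conj K K' * adF F K' = c • (adF (k := k) F K' * conj K K') := by
  refine LinearMap.ext fun b => ?_
  simp only [Module.End.mul_apply, LinearMap.smul_apply, conj_apply, adF_apply]
  have hFK := mul_inv_comm_of hKK' hK'K hKF
  have h1 : K * (F * b * K' * K') = c • (F * (K * (b * K')) * K') := by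
    rw [← mul_assoc, ← mul_assoc, ← mul_assoc, hKF]; simp only [smul_mul_assoc, mul_assoc]
  have h2 : K * (b * F * K' * K') = c • (K * (b * K') * F * K') := by
    rw [mul_assoc b, hFK]; simp only [smul_mul_assoc, mul_smul_comm, mul_assoc]
  rw [sub_mul, sub_mul, mul_sub, h1, h2, sub_mul, smul_sub]

/-- These operators are the adjoint action for the coproduct obtained from that of `adL` by
exchanging `K` and `K⁻¹`. With this choice the kernel of `adE` is the commutant of `K E` and the
kernel of `adF` is the commutant of `F`, the two commutants met later. Together with `conj` they
make the algebra itself a rank one representation. -/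
theorem adE_mul_adF_sub {c δ : k} (hc : c ≠ 0) {E F K K' : A} (hKK' : K * K' = 1)
    (hK'K : K' * K = 1) (hKE : K * E = c • (E * K)) (hKF : K * F = c⁻¹ • (F * K))
    (hEF : E * F - F * E = δ • (K - K')) :
    adE E K K' * adF F K' - adF F K' * adE E K K' = δ • (conj (k := k) K K' - conj K' K) := by
  refine LinearMap.ext fun b => ?_
  simp only [LinearMap.sub_apply, Module.End.mul_apply, LinearMap.smul_apply, conj_apply,
    adF_apply, adE_apply]
  have hFK := mul_inv_comm_of hKK' hK'K hKF
  have hKEK : K * E * K' = c • E := by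
    rw [hKE, smul_mul_assoc, mul_assoc, hKK', mul_one]
  have t1 : K' * ((F * b - b * F) * K' * (K * E)) = K' * F * b * E - K' * b * F * E := by
    rw [mul_assoc _ K', ← mul_assoc K' K, hK'K, one_mul]; noncomm_ring
  have t2 : F * (K' * (b * (K * E))) * K' = K' * F * b * E := by
    calc F * (K' * (b * (K * E))) * K' = (F * K') * b * (K * E * K') := by
          simp only [mul_assoc]
      _ = K' * F * b * E := by
          rw [hFK, hKEK]; simp only [smul_mul_assoc, mul_smul_comm, smul_smul]
          rw [mul_inv_cancel₀ hc, one_smul]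
  have t3 : K' * (b * (K * E)) * F * K' = K' * b * (E * F) := by
    calc K' * (b * (K * E)) * F * K' = K' * b * (K * E * (F * K')) := by
          simp only [mul_assoc]
      _ = c⁻¹ • (K' * b * (K * E * K' * F)) := by
          rw [hFK]; simp only [mul_smul_comm, mul_assoc]
      _ = _ := by
          rw [hKEK]; simp only [smul_mul_assoc, mul_smul_comm, smul_smul]
          rw [inv_mul_cancel₀ hc, one_smul]
  have e1 : (F * (E * b - K' * (b * (K * E))) - (E * b - K' * (b * (K * E))) * F) * K' =
      F * E * b * K' - F * (K' * (b * (K * E))) * K' - E * b * F * K' +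
        K' * (b * (K * E)) * F * K' := by noncomm_ring
  rw [t1, e1, t2, t3]
  calc E * ((F * b - b * F) * K') - (K' * F * b * E - K' * b * F * E) -
        (F * E * b * K' - K' * F * b * E - E * b * F * K' + K' * b * (E * F))
      = (E * F - F * E) * b * K' - K' * b * (E * F - F * E) := by noncomm_ring
    _ = _ := by
      rw [hEF, smul_mul_assoc, smul_mul_assoc, mul_smul_comm, ← smul_sub]
      congr 1; noncomm_ring

/-- In a finite-dimensional algebra containing a rank one quantum group, no nonzero element of
negative weight commutes with `K E`. -/
theorem eq_zero_of_commute_KE [FiniteDimensional k A] (hq : IsGeneric q) {d : ℕ} (hd : 0 < d)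
    {E F K K' : A} {δ : k}
    (hδ : δ ≠ 0) (hKK' : K * K' = 1) (hK'K : K' * K = 1)
    (hKE : K * E = q ^ (2 * d : ℤ) • (E * K)) (hKF : K * F = q ^ (-(2 * d : ℤ)) • (F * K))
    (hEF : E * F - F * E = δ • (K - K')) {b : A} {m : ℤ} (hm : m < 0)
    (hKb : K * b = q ^ m • (b * K)) (hb : K * E * b = b * (K * E)) : b = 0 := by
  by_contra hb0
  have hc : q ^ (2 * d : ℤ) ≠ 0 := zpow_ne_zero _ hq.ne_zero
  have h := adE_mul_adF_sub hc hKK' hK'K hKE (by rwa [← zpow_neg]) hEF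
  -- The hypothesis `hb` says that `adE` kills `b`, so `b` would be a highest weight vector of
  -- negative weight. The factor `δ⁻¹` brings the commutator to the normalization of
  -- `highest_weight_nonneg`.
  refine hm.not_ge (highest_weight_nonneg (V := A) hq hd (e := δ⁻¹ • adE E K K') (f := adF F K')
    (κ := conj K K') (κ' := conj K' K) (conj_mul_conj hK'K hK'K) ?_ ?_ hb0 ?_ (m := m) ?_)
  · exact conj_mul_adF hKK' hK'K hKF
  · rw [smul_mul_assoc, mul_smul_comm]
    exact (smul_sub δ⁻¹ _ _).symm.trans (by rw [h, inv_smul_smul₀ hδ])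
  · rw [LinearMap.smul_apply, adE_apply, ← hb, ← mul_assoc, ← mul_assoc, hK'K, one_mul, sub_self,
      smul_zero]
  · exact conj_eq_smul hKK' hKb

/-- In a finite-dimensional algebra containing a rank one quantum group, no nonzero element of
positive weight commutes with `F`. -/
theorem eq_zero_of_commute_F [FiniteDimensional k A] (hq : IsGeneric q) {d : ℕ} (hd : 0 < d)
    {E F K K' : A} {δ : k}
    (hδ : δ ≠ 0) (hKK' : K * K' = 1) (hK'K : K' * K = 1)
    (hKE : K * E = q ^ (2 * d : ℤ) • (E * K)) (hKF : K * F = q ^ (-(2 * d : ℤ)) • (F * K))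
    (hEF : E * F - F * E = δ • (K - K')) {b : A} {m : ℤ} (hm : 0 < m)
    (hKb : K * b = q ^ m • (b * K)) (hb : F * b = b * F) : b = 0 := by
  by_contra hb0
  have hc : q ^ (2 * d : ℤ) ≠ 0 := zpow_ne_zero _ hq.ne_zero
  have h := adE_mul_adF_sub hc hKK' hK'K hKE (by rwa [← zpow_neg]) hEF
  have h' : adF F K' * adE E K K' - adE E K K' * adF F K' =
      δ • (conj (k := k) K' K - conj K K') := by
    rw [← neg_sub, h]
    refine LinearMap.ext fun b => ?_
    simp only [LinearMap.smul_apply, LinearMap.sub_apply, smul_sub, neg_sub]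
  have h1 := conj_mul_adE hK'K hKK' hKE
  have h2 : conj (k := k) K K' * conj K' K = 1 := conj_mul_conj hKK' hKK'
  have h3 : conj (k := k) K' K * conj K K' = 1 := conj_mul_conj hK'K hK'K
  -- The representation is read upside down: `adF` raises and the inverse conjugation plays the
  -- torus, so `b` is a highest weight vector of weight `-m`.
  refine absurd (highest_weight_nonneg (V := A) hq hd (e := δ⁻¹ • adF F K') (f := adE E K K')
    (κ := conj K' K) (κ' := conj K K') h2 ?_ ?_ hb0 ?_ (m := -m) ?_) (by omega)
  · have := mul_inv_comm_of (k := k) (A := Module.End k A) h2 h3 h1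
    rw [this, zpow_neg, inv_smul_smul₀ hc]
  · rw [smul_mul_assoc, mul_smul_comm]
    exact (smul_sub δ⁻¹ _ _).symm.trans
      (by rw [h', inv_smul_smul₀ hδ])
  · rw [LinearMap.smul_apply, adF_apply, hb, sub_self, zero_mul, smul_zero]
  · rw [zpow_neg]
    exact conj_inv_eq_smul (zpow_ne_zero _ hq.ne_zero) hK'K hKb

end RankOneAlgebra

end QuantumLevi

/-! ### Words, contents and twists in the free algebra -/

noncomputable section

namespace QuantumLevi

section FreeAlg

variable {k : Type*} [Field k] {J : Type*}

/-- The monomial of the free algebra attached to a word. -/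
def word : FreeMonoid J →* FreeAlgebra k J := FreeMonoid.lift (FreeAlgebra.ι k)

theorem word_of (j : J) : word (.of j) = FreeAlgebra.ι k j := FreeMonoid.lift_eval_of _ _

variable (k J) in
/-- The basis of words of the free algebra. -/
def wordBasis : Module.Basis (FreeMonoid J) k (FreeAlgebra k J) := FreeAlgebra.basisFreeMonoid k J

theorem wordBasis_apply (w : FreeMonoid J) : wordBasis k J w = word w := by
  simp [wordBasis, word, FreeAlgebra.basisFreeMonoid, FreeAlgebra.equivMonoidAlgebraFreeMonoid,
    Module.Basis.map_apply]

theorem linearMap_ext_word {W : Type*} [AddCommGroup W] [Module k W]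
    {f g : FreeAlgebra k J →ₗ[k] W} (h : ∀ w, f (word w) = g (word w)) : f = g :=
  (wordBasis k J).ext fun w => by rw [wordBasis_apply]; exact h w

theorem induction_word {P : FreeAlgebra k J → Prop} (h : ∀ w, P (word w))
    (add : ∀ x y, P x → P y → P (x + y)) (smul : ∀ (a : k) x, P x → P (a • x))
    (x : FreeAlgebra k J) : P x := by
  have hx : x ∈ Submodule.span k (Set.range (wordBasis k J)) := by
    rw [(wordBasis k J).span_eq]; trivial
  induction hx using Submodule.span_induction with
  | mem x hx =>
    obtain ⟨w, rfl⟩ := hx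
    rw [wordBasis_apply]; exact h w
  | zero => simpa using smul 0 _ (h 1)
  | add x y _ _ hx hy => exact add _ _ hx hy
  | smul a x _ hx => exact smul _ _ hx

theorem induction_right {P : FreeAlgebra k J → Prop} (one : P 1)
    (mul_ι : ∀ x j, P x → P (x * FreeAlgebra.ι k j))
    (add : ∀ x y, P x → P y → P (x + y)) (smul : ∀ (a : k) x, P x → P (a • x))
    (x : FreeAlgebra k J) : P x := by
  refine induction_word (fun w => ?_) add smul x
  induction w using List.reverseRecOn with
  | nil => exact (map_one (word (k := k) (J := J))).symm ▸ one
  | append_singleton l j ih =>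
    have := map_mul (word (k := k)) (FreeMonoid.ofList l) (.of j)
    rw [word_of] at this
    exact this.symm ▸ mul_ι _ j ih

theorem induction_left {P : FreeAlgebra k J → Prop} (one : P 1)
    (ι_mul : ∀ x j, P x → P (FreeAlgebra.ι k j * x))
    (add : ∀ x y, P x → P y → P (x + y)) (smul : ∀ (a : k) x, P x → P (a • x))
    (x : FreeAlgebra k J) : P x := by
  refine induction_word (fun w => ?_) add smul x
  induction w using FreeMonoid.recOn with
  | one => rwa [map_one]
  | of_mul j w ih => rw [map_mul, word_of]; exact ι_mul _ j ih

/-- The letters of a word, with multiplicities. -/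
def content (w : FreeMonoid J) : Multiset J := (w.toList : Multiset J)

theorem content_one : content (1 : FreeMonoid J) = 0 := rfl

theorem content_of (j : J) : content (.of j) = {j} := rfl

theorem content_mul (v w : FreeMonoid J) : content (v * w) = content v + content w := rfl

theorem card_content (w : FreeMonoid J) : (content w).card = w.length := rfl

/-- The value at `ν` of the additive function extending `a`. -/
def wt (a : J → ℤ) (ν : Multiset J) : ℤ := (ν.map a).sum

theorem wt_zero (a : J → ℤ) : wt a 0 = 0 := rfl

theorem wt_add (a : J → ℤ) (μ ν : Multiset J) : wt a (μ + ν) = wt a μ + wt a ν := by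
  simp [wt]

theorem wt_singleton (a : J → ℤ) (j : J) : wt a {j} = a j := by simp [wt]

theorem wt_cons (a : J → ℤ) (j : J) (ν : Multiset J) : wt a (j ::ₘ ν) = a j + wt a ν := by
  simp [wt]

/-- The automorphism of the free algebra scaling the generators by powers of `q`. -/
def twist (q : k) (a : J → ℤ) : FreeAlgebra k J →ₐ[k] FreeAlgebra k J :=
  FreeAlgebra.lift k fun j => q ^ a j • FreeAlgebra.ι k j

theorem twist_ι (q : k) (a : J → ℤ) (j : J) :
    twist q a (FreeAlgebra.ι k j) = q ^ a j • FreeAlgebra.ι k j := by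
  simp [twist]

theorem twist_word {q : k} (hq : q ≠ 0) (a : J → ℤ) (w : FreeMonoid J) :
    twist q a (word w) = q ^ wt a (content w) • word w := by
  induction w using FreeMonoid.recOn with
  | one => simp [content_one, wt_zero]
  | of_mul j w ih =>
    rw [map_mul, map_mul, ih, word_of, twist_ι, content_mul, content_of, wt_add, wt_singleton,
      zpow_add₀ hq, smul_mul_smul_comm]

theorem twist_comm (q : k) (a b : J → ℤ) (x : FreeAlgebra k J) :
    twist q a (twist q b x) = twist q b (twist q a x) := by
  have : (twist q a).comp (twist q b) = (twist q b).comp (twist q a) := by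
    refine FreeAlgebra.hom_ext (funext fun j => ?_)
    simp [twist_ι, smul_smul, mul_comm]
  exact DFunLike.congr_fun this x

section Projection

open Classical in
/-- The projection to the span of the words with property `p`. -/
def wordProj (p : FreeMonoid J → Prop) : FreeAlgebra k J →ₗ[k] FreeAlgebra k J :=
  (wordBasis k J).constr k fun w => if p w then word w else 0

open Classical in
theorem wordProj_word (p : FreeMonoid J → Prop) (w : FreeMonoid J) :
    wordProj (k := k) p (word w) = if p w then word w else 0 := by
  rw [← wordBasis_apply, wordProj, Module.Basis.constr_basis, wordBasis_apply]

theorem wordProj_mem_span (p : FreeMonoid J → Prop) (x : FreeAlgebra k J) :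
    wordProj p x ∈ Submodule.span k (word '' {w | p w}) := by
  induction x using induction_word with
  | h w =>
    rw [wordProj_word]
    split_ifs with h
    · exact Submodule.subset_span ⟨w, h, rfl⟩
    · exact zero_mem _
  | add x y hx hy => rw [map_add]; exact add_mem hx hy
  | smul a x hx => rw [map_smul]; exact Submodule.smul_mem _ _ hx

theorem wordProj_add_wordProj_not (p : FreeMonoid J → Prop) (x : FreeAlgebra k J) :
    wordProj p x + wordProj (fun w => ¬ p w) x = x := by
  have : wordProj (k := k) p + wordProj (fun w => ¬ p w) = LinearMap.id :=
    linearMap_ext_word fun w => by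
      simp only [LinearMap.add_apply, wordProj_word, LinearMap.id_apply]
      split_ifs <;> simp
  exact LinearMap.congr_fun this x

/-- Only the contents of the finitely many words occurring in `x` contribute; this gives the
decomposition into homogeneous components. -/
theorem exists_sum_wordProj (x : FreeAlgebra k J) : ∃ s : Finset (Multiset J),
    ∑ ν ∈ s, wordProj (fun w => content w = ν) x = x := by
  classical
  refine ⟨((wordBasis k J).repr x).support.image content, ?_⟩
  have hx : x = ∑ w ∈ ((wordBasis k J).repr x).support, (wordBasis k J).repr x w • word w := by
    conv_lhs => rw [← (wordBasis k J).linearCombination_repr x]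
    simp only [Finsupp.linearCombination_apply, Finsupp.sum, wordBasis_apply]
  conv_rhs => rw [hx]
  conv_lhs => enter [2, ν]; rw [hx]
  simp only [map_sum, map_smul, wordProj_word]
  rw [Finset.sum_comm]
  refine Finset.sum_congr rfl fun w hw => ?_
  rw [← Finset.smul_sum]
  congr 1
  exact (Finset.sum_eq_single_of_mem (content w) (Finset.mem_image_of_mem _ hw)
    fun ν _ h => if_neg (Ne.symm h)).trans (if_pos rfl)

end Projection

/-! ### Skew derivations and the bilinear form -/

section Skew

variable [DecidableEq J] (q : k) (c : J → J → ℤ)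

/-- The algebra homomorphism to upper triangular matrices encoding the right skew derivation. -/
def skewRightHom (i : J) : FreeAlgebra k J →ₐ[k] Matrix (Fin 2) (Fin 2) (FreeAlgebra k J) :=
  FreeAlgebra.lift k fun j => !![FreeAlgebra.ι k j, if i = j then 1 else 0;
    0, q ^ (-c i j) • FreeAlgebra.ι k j]

/-- The algebra homomorphism to upper triangular matrices encoding the left skew derivation. -/
def skewLeftHom (i : J) : FreeAlgebra k J →ₐ[k] Matrix (Fin 2) (Fin 2) (FreeAlgebra k J) :=
  FreeAlgebra.lift k fun j => !![q ^ (-c i j) • FreeAlgebra.ι k j, if i = j then 1 else 0;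
    0, FreeAlgebra.ι k j]

/-- The skew derivation `r_i` with `r_i(xy) = x r_i(y) + r_i(x) κ_i⁻¹(y)`. -/
def skewRight (i : J) : FreeAlgebra k J →ₗ[k] FreeAlgebra k J :=
  Matrix.entryLinearMap k (FreeAlgebra k J) 0 1 ∘ₗ (skewRightHom q c i).toLinearMap

/-- The skew derivation `r'_i` with `r'_i(xy) = r'_i(x) y + κ_i⁻¹(x) r'_i(y)`. -/
def skewLeft (i : J) : FreeAlgebra k J →ₗ[k] FreeAlgebra k J :=
  Matrix.entryLinearMap k (FreeAlgebra k J) 0 1 ∘ₗ (skewLeftHom q c i).toLinearMap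

/-- Multiplying upper triangular matrices with `x` and a twist of `x` on the diagonal is exactly the
twisted Leibniz rule for the corner entry. Taking the corner of an algebra homomorphism thus gives a
well-defined skew derivation at once. -/
theorem skewRightHom_apply (i : J) (x : FreeAlgebra k J) :
    skewRightHom q c i x = !![x, skewRight q c i x; 0, twist q (fun j => -c i j) x] := by
  have h : ∀ x, skewRightHom q c i x 0 0 = x ∧ skewRightHom q c i x 1 0 = 0 ∧
      skewRightHom q c i x 1 1 = twist q (fun j => -c i j) x := by
    intro x
    induction x using FreeAlgebra.induction with
    | grade0 r => simp [Matrix.algebraMap_matrix_apply]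
    | grade1 j => simp [skewRightHom, twist]
    | mul x y hx hy => simp [Matrix.mul_apply, hx, hy]
    | add x y hx hy => simp [hx, hy]
  ext a b
  fin_cases a <;> fin_cases b
  · exact (h x).1
  · rfl
  · exact (h x).2.1
  · exact (h x).2.2

theorem skewLeftHom_apply (i : J) (x : FreeAlgebra k J) :
    skewLeftHom q c i x = !![twist q (fun j => -c i j) x, skewLeft q c i x; 0, x] := by
  have h : ∀ x, skewLeftHom q c i x 0 0 = twist q (fun j => -c i j) x ∧
      skewLeftHom q c i x 1 0 = 0 ∧ skewLeftHom q c i x 1 1 = x := by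
    intro x
    induction x using FreeAlgebra.induction with
    | grade0 r => simp [Matrix.algebraMap_matrix_apply]
    | grade1 j => simp [skewLeftHom, twist]
    | mul x y hx hy => simp [Matrix.mul_apply, hx, hy]
    | add x y hx hy => simp [hx, hy]
  ext a b
  fin_cases a <;> fin_cases b
  · exact (h x).1
  · rfl
  · exact (h x).2.1
  · exact (h x).2.2

theorem skewRight_mul (i : J) (x y : FreeAlgebra k J) : skewRight q c i (x * y) =
    x * skewRight q c i y + skewRight q c i x * twist q (fun j => -c i j) y := by
  have h := congrFun (congrFun (map_mul (skewRightHom q c i) x y) 0) 1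
  rw [skewRightHom_apply q c i x, skewRightHom_apply q c i y] at h
  refine h.trans ?_
  simp [Matrix.mul_apply]

theorem skewLeft_mul (i : J) (x y : FreeAlgebra k J) : skewLeft q c i (x * y) =
    skewLeft q c i x * y + twist q (fun j => -c i j) x * skewLeft q c i y := by
  have h := congrFun (congrFun (map_mul (skewLeftHom q c i) x y) 0) 1
  rw [skewLeftHom_apply q c i x, skewLeftHom_apply q c i y] at h
  refine h.trans ?_
  simp [Matrix.mul_apply, add_comm]

theorem skewRight_ι (i j : J) :
    skewRight q c i (FreeAlgebra.ι k j) = if i = j then 1 else 0 := by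
  simp [skewRight, skewRightHom]

theorem skewLeft_ι (i j : J) :
    skewLeft q c i (FreeAlgebra.ι k j) = if i = j then 1 else 0 := by
  simp [skewLeft, skewLeftHom]

theorem skewRight_algebraMap (i : J) (a : k) : skewRight q c i (algebraMap k _ a) = 0 := by
  simp [skewRight, Matrix.algebraMap_matrix_apply]

theorem skewLeft_algebraMap (i : J) (a : k) : skewLeft q c i (algebraMap k _ a) = 0 := by
  simp [skewLeft, Matrix.algebraMap_matrix_apply]

theorem skewRight_one (i : J) : skewRight q c i 1 = 0 := by
  simpa using skewRight_algebraMap q c i 1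

theorem skewLeft_one (i : J) : skewLeft q c i 1 = 0 := by
  simpa using skewLeft_algebraMap q c i 1

theorem skewRight_twist (i : J) (a : J → ℤ) (x : FreeAlgebra k J) :
    skewRight q c i (twist q a x) = q ^ a i • twist q a (skewRight q c i x) := by
  induction x using FreeAlgebra.induction with
  | grade0 r => simp [skewRight_algebraMap, AlgHom.commutes]
  | grade1 j =>
    rw [twist_ι, map_smul, skewRight_ι]
    split_ifs with h <;> simp [h]
  | mul x y hx hy =>
    rw [map_mul, skewRight_mul, hx, hy, skewRight_mul, map_add, map_mul, map_mul, twist_comm q a,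
      mul_smul_comm, smul_mul_assoc, smul_add]
  | add x y hx hy => simp only [map_add, hx, hy, smul_add]

theorem skewLeft_twist (i : J) (a : J → ℤ) (x : FreeAlgebra k J) :
    skewLeft q c i (twist q a x) = q ^ a i • twist q a (skewLeft q c i x) := by
  induction x using FreeAlgebra.induction with
  | grade0 r => simp [skewLeft_algebraMap, AlgHom.commutes]
  | grade1 j =>
    rw [twist_ι, map_smul, skewLeft_ι]
    split_ifs with h <;> simp [h]
  | mul x y hx hy =>
    rw [map_mul, skewLeft_mul, hx, hy, skewLeft_mul, map_add, map_mul, map_mul, twist_comm q a,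
      mul_smul_comm, smul_mul_assoc, smul_add]
  | add x y hx hy => simp only [map_add, hx, hy, smul_add]

variable {q c}

/-- On a product, both composites have the same four terms up to the power of `q` from carrying a
derivation past a twist; these powers are `q ^ (-c j i)` and `q ^ (-c i j)`, equal by symmetry. -/
theorem skewRight_skewLeft (hc : ∀ i j, c i j = c j i) (i j : J) (x : FreeAlgebra k J) :
    skewRight q c i (skewLeft q c j x) = skewLeft q c j (skewRight q c i x) := by
  induction x using FreeAlgebra.induction with
  | grade0 r => simp [skewLeft_algebraMap, skewRight_algebraMap]
  | grade1 l =>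
    rw [skewLeft_ι, skewRight_ι]
    split_ifs <;> simp [skewLeft_one, skewRight_one]
  | mul x y hx hy =>
    simp only [skewLeft_mul, skewRight_mul, map_add, hx, hy, skewRight_twist, skewLeft_twist,
      smul_mul_assoc, mul_smul_comm, hc j i]
    abel
  | add x y hx hy => simp only [map_add, hx, hy]

variable (q c) in
/-- Words acting on the free algebra by iterated right skew derivations. -/
def skewAction : FreeAlgebra k J →ₐ[k] Module.End k (FreeAlgebra k J) :=
  FreeAlgebra.lift k (skewRight q c)

variable (q c) in
/-- The bilinear form on the free algebra for which right multiplication by a generator is adjoint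
to the right skew derivation. -/
def form : FreeAlgebra k J →ₗ[k] FreeAlgebra k J →ₗ[k] k :=
  (skewAction q c).toLinearMap.compr₂ (FreeAlgebra.algebraMapInv (R := k) (X := J)).toLinearMap

theorem form_apply (y x : FreeAlgebra k J) :
    form q c y x = FreeAlgebra.algebraMapInv (skewAction q c y x) := rfl

theorem form_one_left (x : FreeAlgebra k J) : form q c 1 x = FreeAlgebra.algebraMapInv x := by
  rw [form_apply, map_one, Module.End.one_apply]

theorem form_mul_ι_left (y x : FreeAlgebra k J) (i : J) :
    form q c (y * FreeAlgebra.ι k i) x = form q c y (skewRight q c i x) := by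
  rw [form_apply, form_apply, map_mul, Module.End.mul_apply, skewAction, FreeAlgebra.lift_ι_apply]

/-- Multiplying on the left applies `skewRight` last, just before the constant term is taken. There
it agrees with `skewLeft`, which commutes with all the right derivations and can be moved inside. -/
theorem form_ι_mul_left (hc : ∀ i j, c i j = c j i) (y x : FreeAlgebra k J) (i : J) :
    form q c (FreeAlgebra.ι k i * y) x = form q c y (skewLeft q c i x) := by
  have h1 : ∀ x, (FreeAlgebra.algebraMapInv (R := k)) (skewRight q c i x) =
      FreeAlgebra.algebraMapInv (skewLeft q c i x) := by
    intro x
    induction x using FreeAlgebra.induction with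
    | grade0 r => simp [skewLeft_algebraMap, skewRight_algebraMap]
    | grade1 l => rw [skewLeft_ι, skewRight_ι]
    | mul x y hx hy =>
      have ht : ∀ z, FreeAlgebra.algebraMapInv (R := k) (twist q (fun j => -c i j) z) =
          FreeAlgebra.algebraMapInv z := by
        intro z
        have : (FreeAlgebra.algebraMapInv (R := k)).comp (twist q (fun j => -c i j)) =
            FreeAlgebra.algebraMapInv := by
          refine FreeAlgebra.hom_ext (funext fun j => ?_)
          simp [twist_ι, FreeAlgebra.algebraMapInv]
        exact DFunLike.congr_fun this z
      simp only [skewLeft_mul, skewRight_mul, map_add, map_mul, hx, hy, ht]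
      ring
    | add x y hx hy => simp only [map_add, hx, hy]
  have h2 : ∀ y x, skewAction q c y (skewLeft q c i x) = skewLeft q c i (skewAction q c y x) := by
    intro y
    induction y using FreeAlgebra.induction with
    | grade0 r => intro x; simp
    | grade1 l =>
      intro x
      rw [skewAction, FreeAlgebra.lift_ι_apply, skewRight_skewLeft hc]
    | mul y z hy hz => intro x; simp only [map_mul, Module.End.mul_apply, hz, hy]
    | add y z hy hz => intro x; simp only [map_add, LinearMap.add_apply, hz, hy]
  rw [form_apply, form_apply, map_mul, Module.End.mul_apply, h2, ← h1]
  rw [skewAction, FreeAlgebra.lift_ι_apply]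

/-- The adjunction also holds in the second argument, which makes both radicals of the form stable
under skew derivations. Peeling the last letter off `y`, the two Leibniz rules produce the same
twist factor because `c` is symmetric. -/
theorem form_mul_ι_right (hc : ∀ i j, c i j = c j i) (y x : FreeAlgebra k J) (j : J) :
    form q c y (x * FreeAlgebra.ι k j) = form q c (skewRight q c j y) x := by
  induction y using induction_right generalizing x with
  | one => simp [form_one_left, skewRight_one, FreeAlgebra.algebraMapInv]
  | mul_ι y i ih =>
    rw [form_mul_ι_left, skewRight_mul, skewRight_mul, skewRight_ι, skewRight_ι, twist_ι, twist_ι,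
      map_add, mul_smul_comm, map_smul, ih, mul_smul_comm, map_add, map_smul, LinearMap.add_apply,
      LinearMap.smul_apply, form_mul_ι_left, hc i j]
    simp only [eq_comm (a := j)]
    split_ifs <;> simp
  | add y z hy hz => simp only [map_add, LinearMap.add_apply, hy, hz]
  | smul a y hy => simp only [map_smul, LinearMap.smul_apply, hy]

theorem form_ι_mul_right (hc : ∀ i j, c i j = c j i) (y x : FreeAlgebra k J) (j : J) :
    form q c y (FreeAlgebra.ι k j * x) = form q c (skewLeft q c j y) x := by
  induction y using induction_left generalizing x with
  | one => simp [form_one_left, skewLeft_one, FreeAlgebra.algebraMapInv]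
  | ι_mul y i ih =>
    rw [form_ι_mul_left hc, skewLeft_mul, skewLeft_mul, skewLeft_ι, skewLeft_ι, twist_ι, twist_ι,
      map_add, smul_mul_assoc, map_smul, ih, smul_mul_assoc, map_add, map_smul,
      LinearMap.add_apply, LinearMap.smul_apply, form_ι_mul_left hc, hc i j]
    simp only [eq_comm (a := j)]
    split_ifs <;> simp
  | add y z hy hz => simp only [map_add, LinearMap.add_apply, hy, hz]
  | smul a y hy => simp only [map_smul, LinearMap.smul_apply, hy]

theorem form_twist (a : J → ℤ) (y x : FreeAlgebra k J) :
    form q c (twist q a y) x = form q c y (twist q a x) := by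
  induction y using induction_right generalizing x with
  | one =>
    have : (FreeAlgebra.algebraMapInv (R := k)).comp (twist q a) = FreeAlgebra.algebraMapInv := by
      refine FreeAlgebra.hom_ext (funext fun j => ?_)
      simp [twist_ι, FreeAlgebra.algebraMapInv]
    rw [map_one, form_one_left, form_one_left]
    exact (DFunLike.congr_fun this x).symm
  | mul_ι y i ih =>
    rw [map_mul, twist_ι, mul_smul_comm, map_smul, LinearMap.smul_apply, form_mul_ι_left, ih,
      form_mul_ι_left, skewRight_twist, map_smul]
  | add y z hy hz => simp only [map_add, LinearMap.add_apply, hy, hz]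
  | smul a y hy => simp only [map_smul, LinearMap.smul_apply, hy]

/-- Twists are self-adjoint, so eigenvectors with different eigenvalues are orthogonal. The twist
counting a letter `j` separates two contents that contain `j` unequally often, as `q` is not a root
of unity. -/
theorem form_word_eq_zero (hq : IsGeneric q) {v w : FreeMonoid J} (h : content v ≠ content w) :
    form q c (word v) (word w) = 0 := by
  obtain ⟨j, hj⟩ : ∃ j, (content v).count j ≠ (content w).count j := by
    by_contra! h'
    exact h (Multiset.ext.2 h')
  have hwt : ∀ ν : Multiset J, wt (fun i => if j = i then 1 else 0) ν = ν.count j := by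
    intro ν
    induction ν using Multiset.induction_on with
    | empty => rfl
    | cons i ν ih => rw [wt_cons, ih, Multiset.count_cons]; split_ifs <;> push_cast <;> ring
  have := form_twist (q := q) (c := c) (fun i => if j = i then 1 else 0) (word v) (word w)
  rw [twist_word hq.ne_zero, twist_word hq.ne_zero, hwt, hwt, map_smul, map_smul,
    LinearMap.smul_apply, smul_eq_mul, smul_eq_mul, ← sub_eq_zero, ← sub_mul] at this
  refine (mul_eq_zero.1 this).resolve_left fun h0 => hj ?_
  exact_mod_cast hq.zpow_injective (sub_eq_zero.1 h0)

/-- Contents are mutually orthogonal, so projections that see only the content are self-adjoint.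
This is used for homogeneous components and for truncation by length. -/
theorem form_wordProj (hq : IsGeneric q) {p : FreeMonoid J → Prop}
    (hp : ∀ v w, content v = content w → (p v ↔ p w)) (y x : FreeAlgebra k J) :
    form q c (wordProj p y) x = form q c y (wordProj p x) := by
  induction y using induction_word with
  | h v =>
    induction x using induction_word with
    | h w =>
      rw [wordProj_word, wordProj_word]
      by_cases h : content v = content w
      · have := hp v w h
        by_cases h1 : p v
        · rw [if_pos h1, if_pos (this.1 h1)]
        · rw [if_neg h1, if_neg (this.not.1 h1), map_zero, map_zero, LinearMap.zero_apply]
      · have := form_word_eq_zero (c := c) hq h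
        split_ifs <;> simp [this]
    | add y z hy hz => simp only [map_add, hy, hz]
    | smul a y hy => simp only [map_smul, hy]
  | add y z hy hz => simp only [map_add, LinearMap.add_apply, hy, hz]
  | smul a y hy => simp only [map_smul, LinearMap.smul_apply, hy]

/-- The skew derivations remove a letter. -/
theorem skewRight_word_mem (hq : q ≠ 0) (i : J) (w : FreeMonoid J) : skewRight q c i (word w) ∈
    Submodule.span k (word '' {u | i ::ₘ content u = content w}) := by
  induction w using FreeMonoid.recOn with
  | one => rw [map_one, skewRight_one]; exact zero_mem _
  | of_mul j w ih =>
    rw [map_mul, word_of, skewRight_mul, skewRight_ι]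
    refine add_mem ?_ ?_
    · have := Submodule.mem_map_of_mem (f := LinearMap.mulLeft k (FreeAlgebra.ι k j)) ih
      rw [Submodule.map_span] at this
      refine Submodule.span_mono ?_ this
      rintro _ ⟨_, ⟨u, hu, rfl⟩, rfl⟩
      refine ⟨.of j * u, ?_, by rw [map_mul, word_of]; rfl⟩
      simp only [Set.mem_ofPred_eq, content_mul, content_of] at hu ⊢
      rw [← hu, Multiset.singleton_add, Multiset.singleton_add, Multiset.cons_swap]
    · split_ifs with h
      · subst h
        rw [one_mul, twist_word hq]
        exact Submodule.smul_mem _ _ (Submodule.subset_span ⟨w, rfl, rfl⟩)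
      · rw [zero_mul]; exact zero_mem _

theorem skewLeft_word_mem (i : J) (w : FreeMonoid J) : skewLeft q c i (word w) ∈
    Submodule.span k (word '' {u | i ::ₘ content u = content w}) := by
  induction w using FreeMonoid.recOn with
  | one => rw [map_one, skewLeft_one]; exact zero_mem _
  | of_mul j w ih =>
    rw [map_mul, word_of, skewLeft_mul, skewLeft_ι, twist_ι, smul_mul_assoc]
    refine add_mem ?_ (Submodule.smul_mem _ _ ?_)
    · split_ifs with h
      · subst h
        rw [one_mul]
        exact Submodule.subset_span ⟨w, rfl, rfl⟩
      · rw [zero_mul]; exact zero_mem _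
    · have := Submodule.mem_map_of_mem (f := LinearMap.mulLeft k (FreeAlgebra.ι k j)) ih
      rw [Submodule.map_span] at this
      refine Submodule.span_mono ?_ this
      rintro _ ⟨_, ⟨u, hu, rfl⟩, rfl⟩
      refine ⟨.of j * u, ?_, by rw [map_mul, word_of]; rfl⟩
      simp only [Set.mem_ofPred_eq, content_mul, content_of] at hu ⊢
      rw [← hu, Multiset.singleton_add, Multiset.singleton_add, Multiset.cons_swap]

variable (k) in
/-- The span of the words with a given content. -/
def homogeneous (ν : Multiset J) : Submodule k (FreeAlgebra k J) :=
  Submodule.span k (word '' {w | content w = ν})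

/-- Lets inductions on degree pass from a homogeneous element to its derivatives, with a separate
case when the letter `i` is absent and nothing can be removed. -/
theorem homogeneous_cases {f : FreeAlgebra k J →ₗ[k] FreeAlgebra k J} {i : J}
    (hf : ∀ w, f (word w) ∈ Submodule.span k (word '' {u | i ::ₘ content u = content w}))
    {ν : Multiset J} {x : FreeAlgebra k J} (hx : x ∈ homogeneous k ν) :
    f x = 0 ∨ ∃ μ, ν = i ::ₘ μ ∧ f x ∈ homogeneous k μ := by
  have h : f x ∈ Submodule.span k (word '' {u | i ::ₘ content u = ν}) := by
    induction hx using Submodule.span_induction with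
    | mem x hx => obtain ⟨w, rfl, rfl⟩ := hx; exact hf w
    | zero => rw [map_zero]; exact zero_mem _
    | add x y _ _ hx hy => rw [map_add]; exact add_mem hx hy
    | smul a x _ hx => rw [map_smul]; exact Submodule.smul_mem _ _ hx
  by_cases hi : i ∈ ν
  · obtain ⟨μ, rfl⟩ := Multiset.exists_cons_of_mem hi
    refine .inr ⟨μ, rfl, Submodule.span_mono (Set.image_mono fun u hu => ?_) h⟩
    exact (Multiset.cons_inj_right i).1 hu
  · left
    have he : {u : FreeMonoid J | i ::ₘ content u = ν} = ∅ := by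
      ext u
      simp only [Set.mem_ofPred_eq, Set.mem_empty_iff_false, iff_false]
      rintro rfl
      exact hi (Multiset.mem_cons_self i _)
    rwa [he, Set.image_empty, Submodule.span_empty, Submodule.mem_bot] at h

end Skew

end FreeAlg

end QuantumLevi

end

/-! ### Commutators with products of generators -/

noncomputable section

namespace QuantumLevi

/-- A symmetrized Cartan matrix `c` of finite type with symmetrizing integers `d`. -/
structure IsFiniteForm {J : Type*} (d : J → ℕ) (c : J → J → ℤ) : Prop where
  d_pos : ∀ i, 0 < d i
  diag : ∀ i, c i i = 2 * d i
  symm : ∀ i j, c i j = c j i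
  exists_pos : ∀ ν : Multiset J, ν ≠ 0 → ∃ i, 0 < wt (c i) ν

/-- Elements of an algebra satisfying the relations of a quantized enveloping algebra, the Serre
relations excepted. -/
structure IsQuantumFamily {k : Type*} [Field k] {J : Type*} (q : k) (d : J → ℕ) (c : J → J → ℤ)
    {A : Type*} [Ring A] [Algebra k A] (E F K K' : J → A) : Prop where
  K_mul_K' : ∀ i, K i * K' i = 1
  K'_mul_K : ∀ i, K' i * K i = 1
  K_mul_K : ∀ i j, K i * K j = K j * K i
  K_mul_E : ∀ i j, K i * E j = q ^ c i j • (E j * K i)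
  K_mul_F : ∀ i j, K i * F j = q ^ (-c i j) • (F j * K i)
  E_F : ∀ i, E i * F i - F i * E i = (q ^ d i - (q ^ d i)⁻¹)⁻¹ • (K i - K' i)
  E_F_of_ne : ∀ i j, i ≠ j → E i * F j = F j * E i

section Commutation

variable {k : Type*} [Field k] {J : Type*} {A : Type*} [Ring A] [Algebra k A] {q : k}

theorem mul_lift_eq {E : J → A} {u : A} {a : J → ℤ} (h : ∀ j, u * E j = q ^ a j • (E j * u))
    (x : FreeAlgebra k J) :
    u * FreeAlgebra.lift k E x = FreeAlgebra.lift k E (twist q a x) * u := by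
  induction x using FreeAlgebra.induction with
  | grade0 r => simp [Algebra.commutes]
  | grade1 j => simp [twist_ι, h]
  | mul x y hx hy => rw [map_mul, map_mul, map_mul, ← mul_assoc, hx, mul_assoc, hy, mul_assoc]
  | add x y hx hy => simp only [map_add, mul_add, add_mul, hx, hy]

/-- The antihomomorphism from the free algebra with given values on the generators. -/
def antiLift (g : J → A) : FreeAlgebra k J →ₐ[k] Aᵐᵒᵖ :=
  FreeAlgebra.lift k fun j => MulOpposite.op (g j)

theorem antiLift_ι (g : J → A) (j : J) :
    (antiLift (k := k) g (FreeAlgebra.ι k j)).unop = g j := by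
  simp [antiLift]

theorem mul_antiLift_eq {g : J → A} {u : A} {a : J → ℤ} (h : ∀ j, u * g j = q ^ a j • (g j * u))
    (x : FreeAlgebra k J) :
    u * (antiLift g x).unop = (antiLift g (twist q a x)).unop * u := by
  induction x using FreeAlgebra.induction with
  | grade0 r => simp [MulOpposite.algebraMap_apply, Algebra.commutes]
  | grade1 j => simp [twist_ι, antiLift_ι, h]
  | mul x y hx hy =>
    rw [map_mul, map_mul, map_mul, MulOpposite.unop_mul, MulOpposite.unop_mul, ← mul_assoc, hy,
      mul_assoc, hx, mul_assoc]
  | add x y hx hy => simp only [map_add, MulOpposite.unop_add, mul_add, add_mul, hx, hy]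

theorem mul_inv_comm {c : k} {X K K' : A} (hKK' : K * K' = 1) (hK'K : K' * K = 1)
    (hc : c ≠ 0) (h : K * X = c • (X * K)) : K' * X = c⁻¹ • (X * K') := by
  rw [mul_inv_comm_of hKK' hK'K h, inv_smul_smul₀ hc]

namespace IsQuantumFamily

variable {d : J → ℕ} {c : J → J → ℤ} {E F K K' : J → A}

theorem K'_mul_E (h : IsQuantumFamily q d c E F K K') (hq : q ≠ 0) (i j : J) :
    K' i * E j = q ^ (-c i j) • (E j * K' i) := by
  rw [zpow_neg]
  exact mul_inv_comm (h.K_mul_K' i) (h.K'_mul_K i) (zpow_ne_zero _ hq) (h.K_mul_E i j)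

theorem K_mul_K'_comm (h : IsQuantumFamily q d c E F K K') (i j : J) :
    K i * K' j = K' j * K i := by
  have := mul_inv_comm_of (k := k) (c := 1) (X := K i) (h.K_mul_K' j) (h.K'_mul_K j)
    (by rw [one_smul]; exact h.K_mul_K j i)
  rwa [one_smul] at this

/-- The rescaled generator `-(q_i - q_i⁻¹) F_i`. -/
def scaledF (q : k) (d : J → ℕ) (F : J → A) (i : J) : A := (-(q ^ d i - (q ^ d i)⁻¹)) • F i

/-- The rescaling clears the denominator of the commutator, so that the skew derivations occur below
with coefficients `1` and `-1`. -/
theorem E_mul_scaledF [DecidableEq J] (h : IsQuantumFamily q d c E F K K') (hq : IsGeneric q)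
    (hd : ∀ i, 0 < d i) (i j : J) :
    E j * scaledF q d F i - scaledF q d F i * E j = if i = j then K' i - K i else 0 := by
  rw [scaledF, mul_smul_comm, smul_mul_assoc, ← smul_sub]
  split_ifs with hij
  · subst hij
    rw [h.E_F, smul_smul, neg_mul, mul_inv_cancel₀ (hq.pow_sub_inv_ne_zero (hd i)), neg_smul,
      one_smul, neg_sub]
  · rw [h.E_F_of_ne j i (Ne.symm hij), sub_self, smul_zero]

theorem K_mul_scaledF (h : IsQuantumFamily q d c E F K K') (i j : J) :
    K i * scaledF q d F j = q ^ (-c i j) • (scaledF q d F j * K i) := by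
  rw [scaledF, mul_smul_comm, h.K_mul_F, smul_mul_assoc, smul_comm]

theorem K_mul_scaledF_mul_K' (h : IsQuantumFamily q d c E F K K') (i j : J) :
    K i * (scaledF q d F j * K' j) = q ^ (-c i j) • (scaledF q d F j * K' j * K i) := by
  rw [← mul_assoc, h.K_mul_scaledF, smul_mul_assoc, mul_assoc, h.K_mul_K'_comm, mul_assoc]

/-- The commutator of a product of `E`s with `F_i`. -/
theorem lift_mul_scaledF [DecidableEq J] (h : IsQuantumFamily q d c E F K K') (hq : IsGeneric q)
    (hd : ∀ i, 0 < d i) (i : J) (x : FreeAlgebra k J) :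
    FreeAlgebra.lift k E x * scaledF q d F i - scaledF q d F i * FreeAlgebra.lift k E x =
      FreeAlgebra.lift k E (skewRight q c i x) * K' i -
        K i * FreeAlgebra.lift k E (skewLeft q c i x) := by
  have hK' := mul_lift_eq (k := k) (fun j => h.K'_mul_E hq.ne_zero i j)
  have hK : ∀ x, FreeAlgebra.lift k E x * K i =
      K i * FreeAlgebra.lift k E (twist q (fun j => -c i j) x) := by
    intro x
    rw [← one_mul (FreeAlgebra.lift k E x), ← h.K_mul_K' i, mul_assoc (K i), hK', mul_assoc,
      mul_assoc, h.K'_mul_K, mul_one]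
  induction x using FreeAlgebra.induction with
  | grade0 r => simp [skewLeft_algebraMap, skewRight_algebraMap, Algebra.commutes]
  | grade1 j =>
    rw [FreeAlgebra.lift_ι_apply, h.E_mul_scaledF hq hd, skewLeft_ι, skewRight_ι]
    split_ifs <;> simp
  | mul x y hx hy =>
    -- The commutator with a fixed element is a derivation. Carrying `K' i` rightwards past `y` and
    -- `K i` leftwards past `x` creates exactly the twists of the two Leibniz rules.
    calc _ = FreeAlgebra.lift k E x * (FreeAlgebra.lift k E y * scaledF q d F i -
            scaledF q d F i * FreeAlgebra.lift k E y) +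
          (FreeAlgebra.lift k E x * scaledF q d F i -
            scaledF q d F i * FreeAlgebra.lift k E x) * FreeAlgebra.lift k E y := by
          rw [map_mul]; noncomm_ring
      _ = _ := by
          rw [hx, hy, skewRight_mul, skewLeft_mul, mul_sub, sub_mul, mul_assoc _ (K' i), hK',
            ← mul_assoc _ (K i), hK]
          simp only [map_add, map_mul]
          noncomm_ring
  | add x y hx hy =>
    calc _ = (FreeAlgebra.lift k E x * scaledF q d F i -
            scaledF q d F i * FreeAlgebra.lift k E x) +
          (FreeAlgebra.lift k E y * scaledF q d F i -
            scaledF q d F i * FreeAlgebra.lift k E y) := by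
          rw [map_add]; noncomm_ring
      _ = _ := by
          rw [hx, hy]; simp only [map_add]; noncomm_ring

/-- The antihomomorphism sending the `i`-th generator to `-(q_i - q_i⁻¹) F_i K_i⁻¹`. -/
def lower (q : k) (d : J → ℕ) (F K' : J → A) : FreeAlgebra k J →ₐ[k] Aᵐᵒᵖ :=
  antiLift fun j => scaledF q d F j * K' j

/-- The commutator of `K_i E_i` with a product of `F`s. -/
theorem K_mul_E_mul_lower [DecidableEq J] (h : IsQuantumFamily q d c E F K K')
    (hq : IsGeneric q) (hd : ∀ i, 0 < d i) (hc : ∀ i j, c i j = c j i)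
    (i : J) (x : FreeAlgebra k J) :
    K i * E i * (lower q d F K' x).unop - (lower q d F K' x).unop * (K i * E i) =
      K' i * (lower q d F K' (skewRight q c i x)).unop -
        (lower q d F K' (skewLeft q c i x)).unop * K i := by
  have hK := mul_antiLift_eq (k := k) (fun j => h.K_mul_scaledF_mul_K' i j)
  have hK' : ∀ x, (antiLift (fun j => scaledF q d F j * K' j) x).unop * K' i =
      K' i * (antiLift (fun j => scaledF q d F j * K' j) (twist q (fun j => -c i j) x)).unop := by
    intro x
    rw [← one_mul (antiLift _ x).unop, ← h.K'_mul_K i, mul_assoc (K' i), hK, mul_assoc,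
      mul_assoc, h.K_mul_K', mul_one]
  unfold lower
  induction x using FreeAlgebra.induction with
  | grade0 r =>
    simp [skewLeft_algebraMap, skewRight_algebraMap, MulOpposite.algebraMap_apply,
      Algebra.commutes]
  | grade1 j =>
    rw [antiLift_ι, skewLeft_ι, skewRight_ι]
    -- This is why `K i * E i` and `F_j K_j⁻¹` are paired: the powers of `q` from moving `K i` past
    -- `F j` and `K' j` past `E i` cancel, leaving the plain commutator of `E i` with `F j`.
    have h1 : K i * E i * (scaledF q d F j * K' j) - scaledF q d F j * K' j * (K i * E i) =
        K i * (E i * scaledF q d F j - scaledF q d F j * E i) * K' j := by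
      have e1 : scaledF q d F j * K' j * (K i * E i) = K i * scaledF q d F j * (E i * K' j) := by
        have hz : q ^ c i j * q ^ (-c i j) = 1 := by
          rw [← zpow_add₀ hq.ne_zero, add_neg_cancel, zpow_zero]
        calc scaledF q d F j * K' j * (K i * E i)
            = scaledF q d F j * (K' j * K i) * E i := by simp only [mul_assoc]
          _ = (scaledF q d F j * K i) * (K' j * E i) := by
              rw [← h.K_mul_K'_comm]; simp only [mul_assoc]
          _ = K i * scaledF q d F j * (E i * K' j) := by
              rw [h.K'_mul_E hq.ne_zero, h.K_mul_scaledF, hc j i, mul_smul_comm, smul_mul_assoc]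
      rw [e1]; noncomm_ring
    rw [h1, h.E_mul_scaledF hq hd]
    by_cases hij : i = j
    · subst hij
      simp only [if_true, map_one, MulOpposite.unop_one, mul_one, one_mul, mul_sub, sub_mul,
        h.K_mul_K']
      rw [mul_assoc (K i) (K i), h.K_mul_K', mul_one]
    · simp [hij, Ne.symm hij]
  | mul x y hx hy =>
    rw [map_mul, MulOpposite.unop_mul]
    generalize hX : (antiLift (fun j => scaledF q d F j * K' j) x).unop = X at hx ⊢
    generalize hY : (antiLift (fun j => scaledF q d F j * K' j) y).unop = Y at hy ⊢
    calc _ = Y * (K i * E i * X - X * (K i * E i)) +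
          (K i * E i * Y - Y * (K i * E i)) * X := by noncomm_ring
      _ = _ := by
          rw [hx, hy, skewRight_mul, skewLeft_mul, mul_sub, sub_mul, ← mul_assoc Y, ← hX, ← hY,
            hK', mul_assoc _ (K i), hK]
          simp only [map_add, map_mul, MulOpposite.unop_mul, MulOpposite.unop_add]
          noncomm_ring
  | add x y hx hy =>
    rw [map_add, MulOpposite.unop_add]
    calc _ = _ := by rw [mul_add, add_mul, add_sub_add_comm, hx, hy]
      _ = _ := by simp only [map_add, MulOpposite.unop_add]; noncomm_ring

end IsQuantumFamily

end Commutation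

end QuantumLevi

end

/-! ### The radical of the form acts by zero -/

noncomputable section

namespace QuantumLevi

section Radical

variable {k : Type*} [Field k] {J : Type*} {q : k}

theorem wt_neg (a : J → ℤ) (ν : Multiset J) : wt (fun j => -a j) ν = -wt a ν := by
  induction ν using Multiset.induction_on with
  | empty => rfl
  | cons j ν ih => rw [wt_cons, wt_cons, ih]; ring

theorem twist_eq_smul (hq : q ≠ 0) (a : J → ℤ) {ν : Multiset J} {x : FreeAlgebra k J}
    (hx : x ∈ homogeneous k ν) : twist q a x = q ^ wt a ν • x := by
  induction hx using Submodule.span_induction with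
  | mem x hx => obtain ⟨w, rfl, rfl⟩ := hx; exact twist_word hq a w
  | zero => simp
  | add x y _ _ hx hy => rw [map_add, hx, hy, smul_add]
  | smul b x _ hx => rw [map_smul, hx, smul_comm]

theorem exists_eq_smul_one {x : FreeAlgebra k J} (hx : x ∈ homogeneous k 0) :
    ∃ a : k, x = algebraMap k _ a := by
  induction hx using Submodule.span_induction with
  | mem x hx =>
    obtain ⟨w, hw, rfl⟩ := hx
    have : w = 1 := Multiset.coe_eq_zero _ |>.1 hw
    exact ⟨1, by rw [this, map_one, map_one]⟩
  | zero => exact ⟨0, by simp⟩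
  | add x y _ _ hx hy =>
    obtain ⟨a, rfl⟩ := hx
    obtain ⟨b, rfl⟩ := hy
    exact ⟨a + b, by simp⟩
  | smul b x _ hx =>
    obtain ⟨a, rfl⟩ := hx
    exact ⟨b * a, by rw [map_mul, Algebra.smul_def]⟩

/-- A linear map killing the homogeneous elements of a subspace that is stable under the projections
to homogeneous components kills the subspace. -/
theorem eq_zero_of_homogeneous {W : Type*} [AddCommGroup W] [Module k W]
    (f : FreeAlgebra k J →ₗ[k] W) {R : Submodule k (FreeAlgebra k J)}
    (hR : ∀ x ∈ R, ∀ ν, wordProj (fun w => content w = ν) x ∈ R)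
    (hf : ∀ ν, ∀ x ∈ homogeneous k ν, x ∈ R → f x = 0) {x : FreeAlgebra k J} (hx : x ∈ R) :
    f x = 0 := by
  obtain ⟨s, hs⟩ := exists_sum_wordProj x
  rw [← hs, map_sum]
  exact Finset.sum_eq_zero fun ν _ => hf ν _ (wordProj_mem_span _ x) (hR x hx ν)

/-- Modulo the left ideal generated by the `E`s, a product of `E`s is its constant term. -/
theorem lift_sub_mem {A : Type*} [Ring A] [Algebra k A] (E : J → A) (x : FreeAlgebra k J) :
    FreeAlgebra.lift k E x -
    algebraMap k A (FreeAlgebra.algebraMapInv x) ∈ Ideal.span (Set.range E) := by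
  induction x using FreeAlgebra.induction with
  | grade0 r => simp [FreeAlgebra.algebraMap_leftInverse r]
  | grade1 j =>
    simp only [FreeAlgebra.lift_ι_apply, FreeAlgebra.algebraMapInv, Pi.zero_apply, map_zero,
      sub_zero]
    exact Ideal.subset_span ⟨j, rfl⟩
  | mul x y hx hy =>
    -- Scalars are central, so the difference can be written with each summand ending in a factor
    -- already known to lie in the left ideal.
    have : FreeAlgebra.lift k E (x * y) - algebraMap k A (FreeAlgebra.algebraMapInv (x * y)) =
        FreeAlgebra.lift k E x *
          (FreeAlgebra.lift k E y - algebraMap k A (FreeAlgebra.algebraMapInv y)) +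
        algebraMap k A (FreeAlgebra.algebraMapInv y) *
          (FreeAlgebra.lift k E x - algebraMap k A (FreeAlgebra.algebraMapInv x)) := by
      rw [map_mul, map_mul, map_mul, mul_sub, mul_sub,
        Algebra.commutes _ (FreeAlgebra.lift k E x), Algebra.commutes _ (algebraMap k A _)]
      abel
    rw [this]
    exact add_mem (Ideal.mul_mem_left _ _ hy) (Ideal.mul_mem_left _ _ hx)
  | add x y hx hy =>
    have := add_mem hx hy
    rwa [← add_sub_add_comm, ← map_add, ← map_add, ← map_add] at this

variable [DecidableEq J] {d : J → ℕ} {c : J → J → ℤ}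
  {A : Type*} [Ring A] [Algebra k A] [FiniteDimensional k A] {E F K K' : J → A}

namespace IsQuantumFamily

/-- Both skew derivatives of a radical element are radical and of smaller degree, hence vanish in
the algebra by induction. The commutator formula then says that the image commutes with every `F_i`,
and in finite dimension a single rank one subalgebra is enough to kill it. -/
theorem lift_eq_zero_of_homogeneous (h : IsQuantumFamily q d c E F K K') (hq : IsGeneric q)
    (hf : IsFiniteForm d c) (ν : Multiset J) (x : FreeAlgebra k J) (hx : x ∈ homogeneous k ν)
    (h0 : ∀ y, form q c y x = 0) : FreeAlgebra.lift k E x = 0 := by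
  induction hn : ν.card generalizing ν x with
  | zero =>
    rw [Multiset.card_eq_zero] at hn
    subst hn
    obtain ⟨a, rfl⟩ := exists_eq_smul_one hx
    have := h0 1
    rw [form_one_left, FreeAlgebra.algebraMap_leftInverse] at this
    rw [this, map_zero, map_zero]
  | succ n ih =>
    have hr : ∀ i, FreeAlgebra.lift k E (skewRight q c i x) = 0 := by
      intro i
      rcases homogeneous_cases (skewRight_word_mem (c := c) hq.ne_zero i) hx with h1 | ⟨μ, rfl, h1⟩
      · rw [h1, map_zero]
      · exact ih μ _ h1 (fun y => by rw [← form_mul_ι_left, h0]) (by simpa using hn)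
    have hl : ∀ i, FreeAlgebra.lift k E (skewLeft q c i x) = 0 := by
      intro i
      rcases homogeneous_cases (skewLeft_word_mem (q := q) (c := c) i) hx with h1 | ⟨μ, rfl, h1⟩
      · rw [h1, map_zero]
      · exact ih μ _ h1 (fun y => by rw [← form_ι_mul_left hf.symm, h0]) (by simpa using hn)
    have hν : ν ≠ 0 := by rintro rfl; simp at hn
    -- Finite type is used here: some `K i` gives the image a strictly positive weight, and such an
    -- element cannot be a nonzero lowest weight vector.
    obtain ⟨i, hi⟩ := hf.exists_pos ν hν
    have hδ := hq.pow_sub_inv_ne_zero (hf.d_pos i)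
    refine eq_zero_of_commute_F hq (hf.d_pos i) (inv_ne_zero hδ) (h.K_mul_K' i) (h.K'_mul_K i)
      (by rw [← hf.diag]; exact h.K_mul_E i i) (by rw [← hf.diag]; exact h.K_mul_F i i)
      (h.E_F i) hi ?_ ?_
    · rw [mul_lift_eq (h.K_mul_E i), twist_eq_smul hq.ne_zero _ hx, map_smul, smul_mul_assoc]
    · have := h.lift_mul_scaledF hq hf.d_pos i x
      rw [hr, hl, zero_mul, mul_zero, sub_zero, sub_eq_zero, scaledF, mul_smul_comm,
        smul_mul_assoc] at this
      exact (smul_right_injective A (neg_ne_zero.2 hδ) this).symm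

/-- The mirror argument for the other radical: the image commutes with every `K_i E_i` and has
negative weight for a suitable `i`. -/
theorem lower_eq_zero_of_homogeneous (h : IsQuantumFamily q d c E F K K') (hq : IsGeneric q)
    (hf : IsFiniteForm d c) (ν : Multiset J) (x : FreeAlgebra k J) (hx : x ∈ homogeneous k ν)
    (h0 : ∀ y, form q c x y = 0) : lower q d F K' x = 0 := by
  induction hn : ν.card generalizing ν x with
  | zero =>
    rw [Multiset.card_eq_zero] at hn
    subst hn
    obtain ⟨a, rfl⟩ := exists_eq_smul_one hx
    have := h0 1
    rw [← mul_one (algebraMap k _ a), ← Algebra.smul_def, map_smul, LinearMap.smul_apply,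
      form_one_left, map_one, smul_eq_mul, mul_one] at this
    rw [this, map_zero, map_zero]
  | succ n ih =>
    have hr : ∀ i, lower q d F K' (skewRight q c i x) = 0 := by
      intro i
      rcases homogeneous_cases (skewRight_word_mem (c := c) hq.ne_zero i) hx with h1 | ⟨μ, rfl, h1⟩
      · rw [h1, map_zero]
      · exact ih μ _ h1 (fun y => by rw [← form_mul_ι_right hf.symm, h0]) (by simpa using hn)
    have hl : ∀ i, lower q d F K' (skewLeft q c i x) = 0 := by
      intro i
      rcases homogeneous_cases (skewLeft_word_mem (q := q) (c := c) i) hx with h1 | ⟨μ, rfl, h1⟩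
      · rw [h1, map_zero]
      · exact ih μ _ h1 (fun y => by rw [← form_ι_mul_right hf.symm, h0]) (by simpa using hn)
    have hν : ν ≠ 0 := by rintro rfl; simp at hn
    obtain ⟨i, hi⟩ := hf.exists_pos ν hν
    have hδ := hq.pow_sub_inv_ne_zero (hf.d_pos i)
    apply MulOpposite.unop_injective
    refine eq_zero_of_commute_KE hq (hf.d_pos i) (inv_ne_zero hδ) (h.K_mul_K' i) (h.K'_mul_K i)
      (by rw [← hf.diag]; exact h.K_mul_E i i) (by rw [← hf.diag]; exact h.K_mul_F i i)
      (h.E_F i) (neg_neg_of_pos hi) ?_ ?_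
    · rw [lower, mul_antiLift_eq (h.K_mul_scaledF_mul_K' i), twist_eq_smul hq.ne_zero _ hx,
        wt_neg, map_smul, MulOpposite.unop_smul, smul_mul_assoc]
    · have := h.K_mul_E_mul_lower hq hf.d_pos hf.symm i x
      rwa [hr, hl, MulOpposite.unop_zero, zero_mul, mul_zero, sub_zero, sub_eq_zero] at this

/-- Homogeneous projections are self-adjoint for the form, so the radical contains the homogeneous
components of its elements. -/
theorem lift_eq_zero (h : IsQuantumFamily q d c E F K K') (hq : IsGeneric q)
    (hf : IsFiniteForm d c) {x : FreeAlgebra k J} (h0 : ∀ y, form q c y x = 0) :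
    FreeAlgebra.lift k E x = 0 := by
  refine eq_zero_of_homogeneous (FreeAlgebra.lift k E).toLinearMap
    (R := LinearMap.ker (form q c).flip) (fun x hx ν => ?_) (fun ν x hx hR => ?_) ?_
  · refine LinearMap.ext fun y => ?_
    rw [LinearMap.flip_apply, ← form_wordProj hq (fun v w hvw => by rw [hvw])]
    exact LinearMap.congr_fun hx _
  · exact h.lift_eq_zero_of_homogeneous hq hf ν x hx fun y => LinearMap.congr_fun hR y
  · exact LinearMap.ext h0

theorem lower_eq_zero (h : IsQuantumFamily q d c E F K K') (hq : IsGeneric q)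
    (hf : IsFiniteForm d c) {x : FreeAlgebra k J} (h0 : ∀ y, form q c x y = 0) :
    lower q d F K' x = 0 := by
  refine eq_zero_of_homogeneous (lower q d F K').toLinearMap
    (R := LinearMap.ker (form q c)) (fun x hx ν => ?_) (fun ν x hx hR => ?_) ?_
  · refine LinearMap.ext fun y => ?_
    rw [form_wordProj hq (fun v w hvw => by rw [hvw])]
    exact LinearMap.congr_fun hx _
  · exact h.lower_eq_zero_of_homogeneous hq hf ν x hx fun y => LinearMap.congr_fun hR y
  · exact LinearMap.ext h0

/-- Linear functionals on the algebra generated by the `F`s are represented by the form. -/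
theorem exists_form_eq [Finite J] (h : IsQuantumFamily q d c E F K K') (hq : IsGeneric q)
    (hf : IsFiniteForm d c) {N : ℕ}
    (hN : ∀ w : FreeMonoid J, N ≤ w.length → lower q d F K' (word w) = 0) (φ : A →ₗ[k] k) :
    ∃ x, ∀ y, form q c y x = φ (lower q d F K' y).unop := by
  let T : Submodule k (FreeAlgebra k J) := Submodule.span k (word '' {w | w.length < N})
  have hT : FiniteDimensional k T := by
    refine FiniteDimensional.span_of_finite k (Set.Finite.image _ ?_)
    exact List.finite_length_lt J N
  let Φ : Subspace k (Module.Dual k (FreeAlgebra k J)) := T.map (form q c).flip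
  let ψ : Module.Dual k (FreeAlgebra k J) :=
    φ ∘ₗ (MulOpposite.opLinearEquiv k).symm.toLinearMap ∘ₗ (lower q d F K').toLinearMap
  -- The space `Φ` is finite-dimensional, hence equal to the annihilator of its coannihilator. It
  -- remains to see that `ψ` vanishes at every `y` orthogonal to all short words. The short part of
  -- such a `y` lies in the radical and the long part is killed by `hN`.
  have hψ : ψ ∈ Φ := by
    rw [← Subspace.dualCoannihilator_dualAnnihilator_eq (W := Φ), Submodule.mem_dualAnnihilator]
    intro y hy
    rw [Submodule.mem_dualCoannihilator] at hy
    have h1 : lower q d F K' (wordProj (fun w => w.length < N) y) = 0 := by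
      refine h.lower_eq_zero hq hf fun x => ?_
      rw [form_wordProj hq fun v w hvw => by rw [← card_content, hvw, card_content]]
      exact hy _ ⟨_, wordProj_mem_span _ x, rfl⟩
    have h2 : lower q d F K' (wordProj (fun w => ¬ w.length < N) y) = 0 := by
      have := wordProj_mem_span (fun w => ¬ w.length < N) y
      refine (Submodule.span_le (p := LinearMap.ker (lower q d F K').toLinearMap)).2 ?_ this
      rintro _ ⟨w, hw, rfl⟩
      exact hN w (not_lt.1 hw)
    have h3 : lower q d F K' y = 0 := by
      rw [← wordProj_add_wordProj_not (fun w => w.length < N) y, map_add, h1, h2, add_zero]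
    change φ (lower q d F K' y).unop = 0
    rw [h3, MulOpposite.unop_zero, map_zero]
  obtain ⟨x, -, hx⟩ := hψ
  exact ⟨x, fun y => LinearMap.congr_fun hx y⟩

/-! ### The Casimir element of a finite-dimensional algebra -/

section Casimir

variable {ι : Type*} [Fintype ι] {b : Module.Basis ι k A} {X : ι → FreeAlgebra k J}

/-- The tensor `∑ b a ⊗ X a` is canonical, so an operator `T` on one factor may be traded for its
adjoint on the other. The `X a` are determined only modulo the radical, which is harmless because
`lift` kills the radical. The map `S` allows further multiplication on the first factor. -/
theorem sum_mul_lift_eq (h : IsQuantumFamily q d c E F K K') (hq : IsGeneric q)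
    (hf : IsFiniteForm d c) (hX : ∀ a y, form q c y (X a) = b.coord a (lower q d F K' y).unop)
    {Z : ι → FreeAlgebra k J} {T : A →ₗ[k] A}
    (hZ : ∀ a y, form q c y (Z a) = b.coord a (T (lower q d F K' y).unop)) (S : A →ₗ[k] A) :
    ∑ a, S (b a) * FreeAlgebra.lift k E (Z a) =
      ∑ a, S (T (b a)) * FreeAlgebra.lift k E (X a) := by
  have h1 : ∀ a, FreeAlgebra.lift k E (Z a) =
      ∑ e, b.coord a (T (b e)) • FreeAlgebra.lift k E (X e) := by
    intro a
    rw [← sub_eq_zero]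
    have := h.lift_eq_zero hq hf (x := Z a - ∑ e, b.coord a (T (b e)) • X e) fun y => by
      rw [map_sub, map_sum, hZ, sub_eq_zero]
      conv_lhs => rw [← b.sum_repr (lower q d F K' y).unop]
      simp only [map_sum, map_smul, hX, smul_eq_mul, Module.Basis.coord_apply, mul_comm]
    simpa only [map_sub, map_sum, map_smul] using this
  simp only [h1, Finset.mul_sum, mul_smul_comm, ← smul_mul_assoc]
  rw [Finset.sum_comm]
  refine Finset.sum_congr rfl fun e _ => ?_
  rw [← Finset.sum_mul]
  congr 1
  conv_rhs => rw [← b.sum_repr (T (b e))]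
  simp only [map_sum, map_smul, Module.Basis.coord_apply]

/-- The quantum Casimir element of a finite-dimensional algebra containing a quantized enveloping
algebra. -/
theorem exists_casimir [Finite J] (h : IsQuantumFamily q d c E F K K') (hq : IsGeneric q)
    (hf : IsFiniteForm d c) {N : ℕ}
    (hN : ∀ w : FreeMonoid J, N ≤ w.length → lower q d F K' (word w) = 0) :
    ∃ Ω : A, (∀ i, Ω * F i = F i * K' i * Ω * K' i) ∧
      (∀ (u u' : A) (a : J → ℤ), u * u' = 1 → u' * u = 1 → (∀ j, u * E j = q ^ a j • (E j * u)) →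
        (∀ j, u * F j = q ^ (-a j) • (F j * u)) → (∀ j, u * K' j = K' j * u) → u * Ω = Ω * u) ∧
      Ω - 1 ∈ Ideal.span (Set.range E) := by
  let b := Module.finBasis k A
  choose X hX using fun a => h.exists_form_eq hq hf hN (b.coord a)
  have htr := fun {Z} {T} hZ S => h.sum_mul_lift_eq hq hf (b := b) hX (Z := Z) (T := T) hZ S
  -- The elements `X a` are dual to the basis `b` through the form, and `Ω` is the canonical tensor
  -- contracted by multiplication.
  refine ⟨∑ a, b a * FreeAlgebra.lift k E (X a), fun i => ?_, fun u u' a h1 h2 hE hF hK => ?_, ?_⟩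
  · have hδ := hq.pow_sub_inv_ne_zero (hf.d_pos i)
    apply smul_right_injective A (neg_ne_zero.2 hδ)
    change (-(q ^ d i - (q ^ d i)⁻¹)) • (_ * F i) =
      (-(q ^ d i - (q ^ d i)⁻¹)) • (F i * K' i * _ * _)
    rw [← mul_smul_comm, ← smul_mul_assoc, ← smul_mul_assoc, ← smul_mul_assoc]
    change _ * scaledF q d F i = scaledF q d F i * K' i * _ * _
    -- The right derivation is adjoint to left multiplication by `F_i K_i⁻¹`, since `lower` reverses
    -- products; in `e2` the left derivation is adjoint to right multiplication, and the extra
    -- factor `K i` there removes `K' i`.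
    have e1 := htr (Z := fun a => skewRight q c i (X a))
      (T := LinearMap.mulLeft k (scaledF q d F i * K' i)) (fun a y => by
        rw [← form_mul_ι_left, hX, map_mul, MulOpposite.unop_mul, lower, antiLift_ι]; rfl)
      LinearMap.id
    have e2 := htr (Z := fun a => skewLeft q c i (X a))
      (T := LinearMap.mulRight k (scaledF q d F i * K' i)) (fun a y => by
        rw [← form_ι_mul_left hf.symm, hX, map_mul, MulOpposite.unop_mul, lower, antiLift_ι]; rfl)
      (LinearMap.mulRight k (K i))
    simp only [LinearMap.id_apply, LinearMap.mulLeft_apply, LinearMap.mulRight_apply] at e1 e2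
    have e3 : ∀ z, z * (scaledF q d F i * K' i) * K i = z * scaledF q d F i := fun z => by
      rw [mul_assoc, mul_assoc, h.K'_mul_K, mul_one]
    simp only [e3] at e2
    have e4 : ∀ a, b a * FreeAlgebra.lift k E (X a) * scaledF q d F i =
        b a * scaledF q d F i * FreeAlgebra.lift k E (X a) +
        b a * FreeAlgebra.lift k E (skewRight q c i (X a)) * K' i -
        b a * K i * FreeAlgebra.lift k E (skewLeft q c i (X a)) := fun a => by
      have := h.lift_mul_scaledF hq hf.d_pos i (X a)
      rw [sub_eq_iff_eq_add] at this
      rw [mul_assoc, this]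
      noncomm_ring
    -- In the expansion `e4` the first and third sums cancel by `e2`, and `e1` evaluates the middle
    -- one.
    rw [Finset.sum_mul, Finset.sum_congr rfl fun a _ => e4 a, Finset.sum_sub_distrib,
      Finset.sum_add_distrib, e2, ← Finset.sum_mul, e1, Finset.mul_sum, add_sub_cancel_left]
    simp only [mul_assoc]
  · have hg : ∀ j, u * (scaledF q d F j * K' j) = q ^ (-a j) • (scaledF q d F j * K' j * u) := by
      intro j
      rw [scaledF, smul_mul_assoc, mul_smul_comm, ← mul_assoc, hF, smul_mul_assoc, mul_assoc, hK,
        smul_comm, ← mul_assoc, smul_mul_assoc]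
    -- On products of `F`s, conjugation by `u` is inverse to the twist; on products of `E`s it is
    -- the twist. Twists being self-adjoint, the two effects cancel in the canonical tensor.
    have hP : ∀ y, (lower q d F K' (twist q a y)).unop =
        u' * ((lower q d F K' y).unop * u) := by
      intro y
      have h3 := mul_antiLift_eq hg (twist q a y)
      have h4 : twist q (fun j => -a j) (twist q a y) = y := by
        have : (twist q fun j => -a j).comp (twist q a) = AlgHom.id k _ := by
          refine FreeAlgebra.hom_ext (funext fun j => ?_)
          simp [twist_ι, smul_smul, zpow_neg, hq.ne_zero, zpow_ne_zero]
        exact DFunLike.congr_fun this y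
      rw [h4] at h3
      rw [lower, ← h3, ← mul_assoc, h2, one_mul]
    have e1 := htr (Z := fun e => twist q a (X e))
      (T := LinearMap.mulLeft k u' ∘ₗ LinearMap.mulRight k u) (fun e y => by
        rw [← form_twist, hX, hP]; rfl) (LinearMap.mulLeft k u ∘ₗ LinearMap.mulRight k u')
    simp only [LinearMap.comp_apply, LinearMap.mulLeft_apply, LinearMap.mulRight_apply] at e1
    have e2 : ∀ z, u * (u' * (z * u) * u') = z := fun z => by
      rw [← mul_assoc, ← mul_assoc, h1, one_mul, mul_assoc, h1, mul_one]
    simp only [e2] at e1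
    conv_rhs => rw [← e1]
    rw [Finset.mul_sum, Finset.sum_mul]
    refine Finset.sum_congr rfl fun e _ => ?_
    calc u * (b e * FreeAlgebra.lift k E (X e))
        = u * b e * (u' * u) * FreeAlgebra.lift k E (X e) := by
          rw [h2]; simp only [mul_assoc, one_mul]
      _ = u * (b e * u') * (u * FreeAlgebra.lift k E (X e)) := by simp only [mul_assoc]
      _ = _ := by rw [mul_lift_eq hE]; simp only [mul_assoc]
  -- Pairing `X a` with `1` is taking its constant term, which by duality is the `a`-th coordinate
  -- of `1`.
  · have h1 : (1 : A) = ∑ a, b a * algebraMap k A (FreeAlgebra.algebraMapInv (X a)) := by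
      conv_lhs => rw [← b.sum_repr 1]
      refine Finset.sum_congr rfl fun a _ => ?_
      rw [← form_one_left (q := q) (c := c), hX, map_one (lower q d F K'), MulOpposite.unop_one,
        ← Algebra.commutes, ← Algebra.smul_def, Module.Basis.coord_apply]
    rw [h1]
    rw [← Finset.sum_sub_distrib]
    refine sum_mem fun a _ => ?_
    rw [← mul_sub]
    exact Ideal.mul_mem_left _ _ (lift_sub_mem E _)

end Casimir

end IsQuantumFamily

end Radical

end QuantumLevi

end

/-! ### Root-lattice weight spaces -/

noncomputable section

namespace QuantumLevi

section Weights

variable {I : Type*} [Fintype I]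

/-- The pairing of the root lattice element `β` with the simple root `α_j`. -/
def pairing (c : I → I → ℤ) (β : I → ℤ) (j : I) : ℤ := ∑ i, β i * c i j

theorem pairing_add (c : I → I → ℤ) (β γ : I → ℤ) (j : I) :
    pairing c (β + γ) j = pairing c β j + pairing c γ j := by
  simp [pairing, add_mul, Finset.sum_add_distrib]

theorem pairing_sub (c : I → I → ℤ) (β γ : I → ℤ) (j : I) :
    pairing c (β - γ) j = pairing c β j - pairing c γ j := by
  simp [pairing, sub_mul, Finset.sum_sub_distrib]

theorem pairing_zero (c : I → I → ℤ) (j : I) : pairing c 0 j = 0 := by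
  simp [pairing]

theorem pairing_single [DecidableEq I] (c : I → I → ℤ) (i j : I) :
    pairing c (Pi.single i 1) j = c i j := by
  simp [pairing, Pi.single_apply]

variable {k : Type*} [Field k] {M : Type*} [AddCommGroup M] [Module k M]

/-- The weight space for commuting operators `K_j`, of weight `β` in the root lattice. -/
def weightSpace (q : k) (c : I → I → ℤ) (K : I → Module.End k M) (β : I → ℤ) :
    Submodule k M where
  carrier := {m | ∀ j, K j m = q ^ pairing c β j • m}
  add_mem' {x y} hx hy j := by rw [map_add, hx, hy, smul_add]
  zero_mem' j := by rw [map_zero, smul_zero]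
  smul_mem' a x hx j := by rw [map_smul, hx, smul_comm]

variable {q : k} {c : I → I → ℤ} {K : I → Module.End k M}

/-- A stable subspace contains the weight components of its elements. -/
theorem component_mem (hq : IsGeneric q) (hinj : ∀ β, (∀ j, pairing c β j = 0) → β = 0)
    {p : Submodule k M} (hp : ∀ j, ∀ m ∈ p, K j m ∈ p) (B : Finset (I → ℤ)) {u : (I → ℤ) → M}
    (hu : ∀ β ∈ B, u β ∈ weightSpace q c K β) (hsum : ∑ β ∈ B, u β ∈ p) : ∀ β ∈ B, u β ∈ p := by
  classical
  have key : ∀ (B : Finset (I → ℤ)) (γ : I → ℤ) (u : (I → ℤ) → M), γ ∉ B →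
      (∀ β ∈ B, u β ∈ weightSpace q c K β) → u γ ∈ weightSpace q c K γ →
      u γ + ∑ β ∈ B, u β ∈ p → u γ ∈ p := by
    intro B γ
    induction B using Finset.induction_on with
    | empty => intro u _ _ _ h; simpa using h
    | insert δ B hδ ih =>
      intro u hγ hu hγu h
      rw [Finset.mem_insert, not_or] at hγ
      obtain ⟨j, hj⟩ : ∃ j, pairing c γ j ≠ pairing c δ j := by
        by_contra! h'
        exact hγ.1 (sub_eq_zero.1 (hinj _ fun j => by rw [pairing_sub, h', sub_self]))
      have hne : q ^ pairing c γ j - q ^ pairing c δ j ≠ 0 := fun h0 =>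
        hj (hq.zpow_injective (sub_eq_zero.1 h0))
      have hK : ∀ β, u β ∈ weightSpace q c K β → K j (u β) - q ^ pairing c δ j • u β =
          (q ^ pairing c β j - q ^ pairing c δ j) • u β := fun β hβ => by
        rw [hβ j, sub_smul]
      -- Subtracting the eigenvalue at `δ` from `K j` removes the `δ`-component and multiplies that
      -- at `γ` by a nonzero scalar, which shortens the sum.
      have h1 := p.sub_mem (hp j _ h) (p.smul_mem (q ^ pairing c δ j) h)
      have h2 : K j (u γ + ∑ β ∈ insert δ B, u β) - q ^ pairing c δ j •
          (u γ + ∑ β ∈ insert δ B, u β) = (q ^ pairing c γ j - q ^ pairing c δ j) • u γ +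
            ∑ β ∈ B, (q ^ pairing c β j - q ^ pairing c δ j) • u β := by
        rw [map_add, map_sum, smul_add, Finset.smul_sum, add_sub_add_comm, hK γ hγu,
          ← Finset.sum_sub_distrib, Finset.sum_insert hδ, hK δ (hu δ (Finset.mem_insert_self _ _)),
          sub_self, zero_smul, zero_add]
        exact congrArg _ (Finset.sum_congr rfl fun β hβ =>
          hK β (hu β (Finset.mem_insert_of_mem hβ)))
      rw [h2] at h1
      have h3 := ih (fun β => (q ^ pairing c β j - q ^ pairing c δ j) • u β) hγ.2
        (fun β hβ => Submodule.smul_mem _ _ (hu β (Finset.mem_insert_of_mem hβ)))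
        (Submodule.smul_mem _ _ hγu) h1
      have := p.smul_mem (q ^ pairing c γ j - q ^ pairing c δ j)⁻¹ h3
      rwa [inv_smul_smul₀ hne] at this
  intro β hβ
  refine key (B.erase β) β u (Finset.notMem_erase β B)
    (fun γ hγ => hu γ (Finset.mem_of_mem_erase hγ)) (hu β hβ) ?_
  rwa [Finset.add_sum_erase B u hβ]

theorem iSupIndep_weightSpace (hq : IsGeneric q)
    (hinj : ∀ β, (∀ j, pairing c β j = 0) → β = 0) : iSupIndep (weightSpace q c K) := by
  rw [iSupIndep_iff_finsetSum_eq_zero_imp_eq_zero]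
  intro B u hu hsum β hβ
  have := component_mem hq hinj (p := ⊥) (K := K) (fun j m hm => by simpa using congrArg (K j) hm) B
    hu (by simpa using hsum) β hβ
  simpa using this

/-- A stable subspace is the sum of its weight spaces. -/
theorem le_iSup_inf_weightSpace (hq : IsGeneric q)
    (hinj : ∀ β, (∀ j, pairing c β j = 0) → β = 0) (hspan : ⨆ β, weightSpace q c K β = ⊤)
    {p : Submodule k M} (hp : ∀ j, ∀ m ∈ p, K j m ∈ p) : p ≤ ⨆ β, p ⊓ weightSpace q c K β := by
  intro m hm
  have h : m ∈ ⨆ β, weightSpace q c K β := hspan ▸ Submodule.mem_top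
  obtain ⟨g, hg, rfl⟩ := (Submodule.mem_iSup_iff_exists_finsupp _ _).1 h
  have hc := component_mem hq hinj hp g.support (fun β _ => hg β) hm
  exact Submodule.sum_mem _ fun β hβ => Submodule.mem_iSup_of_mem β ⟨hc β hβ, hg β⟩

/-- Linear maps that agree on the weight spaces are equal. -/
theorem ext_weightSpace {M' : Type*} [AddCommGroup M'] [Module k M']
    (hspan : ⨆ β, weightSpace q c K β = ⊤) {f g : M →ₗ[k] M'}
    (h : ∀ β, ∀ m ∈ weightSpace q c K β, f m = g m) : f = g := by
  have : (⊤ : Submodule k M) ≤ LinearMap.eqLocus f g :=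
    hspan ▸ iSup_le fun β m hm => h β m hm
  exact LinearMap.ext fun m => this Submodule.mem_top

/-- An operator with prescribed eigenvalues on the weight spaces. -/
theorem exists_diagonal (hq : IsGeneric q) (hinj : ∀ β, (∀ j, pairing c β j = 0) → β = 0)
    (hspan : ⨆ β, weightSpace q c K β = ⊤) (t : (I → ℤ) → k) :
    ∃ T : Module.End k M, ∀ β, ∀ m ∈ weightSpace q c K β, T m = t β • m := by
  classical
  have hint := DirectSum.isInternal_submodule_of_iSupIndep_of_iSup_eq_top
    (iSupIndep_weightSpace (K := K) hq hinj) hspan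
  let e := LinearEquiv.ofBijective (DirectSum.coeLinearMap (weightSpace q c K)) hint
  refine ⟨DirectSum.toModule k _ M (fun β => t β • (weightSpace q c K β).subtype) ∘ₗ
    e.symm.toLinearMap, fun β m hm => ?_⟩
  have : e.symm m = DirectSum.lof k _ _ β ⟨m, hm⟩ := by
    rw [LinearEquiv.symm_apply_eq]
    exact (DirectSum.coeLinearMap_lof (weightSpace q c K) β ⟨m, hm⟩).symm
  rw [LinearMap.comp_apply, LinearEquiv.coe_coe, this, DirectSum.toModule_lof]
  rfl

/-- The projection onto a weight space. -/
theorem exists_weightProj (hq : IsGeneric q) (hinj : ∀ β, (∀ j, pairing c β j = 0) → β = 0)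
    (hspan : ⨆ β, weightSpace q c K β = ⊤) (β : I → ℤ) :
    ∃ π : Module.End k M, (∀ m ∈ weightSpace q c K β, π m = m) ∧
      ∀ γ ≠ β, ∀ m ∈ weightSpace q c K γ, π m = 0 := by
  classical
  obtain ⟨π, hπ⟩ := exists_diagonal hq hinj hspan fun γ => if γ = β then 1 else 0
  exact ⟨π, fun m hm => by simpa using hπ β m hm, fun γ hγ m hm => by simpa [hγ] using hπ γ m hm⟩

theorem finite_weightSpace_ne_bot [FiniteDimensional k M] (hq : IsGeneric q)
    (hinj : ∀ β, (∀ j, pairing c β j = 0) → β = 0) :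
    {β | weightSpace q c K β ≠ ⊥}.Finite :=
  WellFoundedGT.finite_ne_bot_of_iSupIndep (iSupIndep_weightSpace hq hinj)

end Weights

/-! ### The Casimir exponent -/

section Quadratic

variable {I : Type*} [Fintype I]

/-- The exponent of the eigenvalue of the quantum Casimir operator on a singular vector. -/
def casimirExp (c : I → I → ℤ) (β : I → ℤ) : ℤ := -∑ i, β i * (pairing c β i + c i i)

theorem casimirExp_add {c : I → I → ℤ} (hc : ∀ i j, c i j = c j i) (β γ : I → ℤ) :
    casimirExp c (β + γ) = casimirExp c β - ∑ i, γ i * pairing c β i -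
      ∑ i, γ i * pairing c (β + γ) i - ∑ i, γ i * c i i := by
  have h : ∑ i, β i * pairing c γ i = ∑ i, γ i * pairing c β i := by
    simp only [pairing, Finset.mul_sum]
    rw [Finset.sum_comm]
    exact Finset.sum_congr rfl fun i _ => Finset.sum_congr rfl fun j _ => by rw [hc i j]; ring
  simp only [casimirExp, pairing_add, Pi.add_apply, add_mul, mul_add, Finset.sum_add_distrib] at h ⊢
  rw [h]
  ring

/-- The exponent is `-(β, β + 2ρ)`, where `2ρ` pairs with `α_i` as `(α_i, α_i)`, so the terms
quadratic in `α_i` cancel. The remaining `2 (β, α_i)` compensates the two factors `K' i` in the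
commutation of `Ω` with `F i`. -/
theorem casimirExp_sub_single [DecidableEq I] {c : I → I → ℤ} (hc : ∀ i j, c i j = c j i)
    (β : I → ℤ) (i : I) :
    casimirExp c (β - Pi.single i 1) = casimirExp c β + 2 * pairing c β i := by
  have h := casimirExp_add hc (β - Pi.single i 1) (Pi.single i 1)
  rw [sub_add_cancel] at h
  simp only [Pi.single_apply, ite_mul, one_mul, zero_mul, Finset.sum_ite_eq',
    Finset.mem_univ, if_true, pairing_sub, pairing_single] at h
  rw [h]
  ring

end Quadratic

end QuantumLevi

end

/-! ### Sums of simple roots and comparison of dominant weights -/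

noncomputable section

namespace QuantumLevi

section Shift

variable {I J : Type*} [DecidableEq I]

/-- The weight of a multiset of simple roots. -/
def shift (s : J → I) (ν : Multiset J) : I → ℤ := (ν.map fun i => Pi.single (s i) 1).sum

theorem shift_zero (s : J → I) : shift s 0 = 0 := rfl

theorem shift_cons (s : J → I) (i : J) (ν : Multiset J) :
    shift s (i ::ₘ ν) = Pi.single (s i) 1 + shift s ν := by
  simp [shift]

theorem shift_add (s : J → I) (μ ν : Multiset J) : shift s (μ + ν) = shift s μ + shift s ν := by
  simp [shift]

theorem shift_singleton (s : J → I) (i : J) : shift s {i} = Pi.single (s i) 1 := by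
  simp [shift]

theorem sum_shift_mul [Fintype I] (s : J → I) (ν : Multiset J) (g : I → ℤ) :
    ∑ i, shift s ν i * g i = (ν.map fun i => g (s i)).sum := by
  induction ν using Multiset.induction with
  | empty => simp [shift_zero]
  | cons j ν ih =>
    simp [shift_cons, add_mul, Finset.sum_add_distrib, ih, Pi.single_apply]

theorem sum_shift [Fintype I] (s : J → I) (ν : Multiset J) : ∑ i, shift s ν i = ν.card := by
  have := sum_shift_mul s ν 1
  simpa using this

theorem shift_ne_zero [Fintype I] (s : J → I) {ν : Multiset J} (hν : ν ≠ 0) : shift s ν ≠ 0 := by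
  intro h
  have := sum_shift s ν
  rw [h] at this
  simp only [Pi.zero_apply, Finset.sum_const_zero] at this
  exact hν (Multiset.card_eq_zero.1 (by exact_mod_cast this.symm))

/-- Comparable dominant weights have different Casimir exponents. -/
theorem casimirExp_ne [Fintype I] {c : I → I → ℤ} (hc : ∀ i j, c i j = c j i) {s : J → I}
    (hpos : ∀ i, 0 < c (s i) (s i)) {β : I → ℤ} {ν : Multiset J} (hν : ν ≠ 0)
    (h1 : ∀ i, 0 ≤ pairing c β (s i)) (h2 : ∀ i, 0 ≤ pairing c (β + shift s ν) (s i)) :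
    casimirExp c (β + shift s ν) ≠ casimirExp c β := by
  have hsum : ∀ g : I → ℤ, (∀ i, 0 ≤ g (s i)) → 0 ≤ ∑ i, shift s ν i * g i := fun g hg => by
    rw [sum_shift_mul]
    exact Multiset.sum_nonneg fun x hx => by
      obtain ⟨i, -, rfl⟩ := Multiset.mem_map.1 hx
      exact hg i
  have h3 : 0 < ∑ i, shift s ν i * c i i := by
    rw [sum_shift_mul s ν fun i => c i i]
    obtain ⟨i, ν', rfl⟩ : ∃ i ν', ν = i ::ₘ ν' := by
      induction ν using Multiset.induction with
      | empty => exact absurd rfl hν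
      | cons i ν' _ => exact ⟨i, ν', rfl⟩
    rw [Multiset.map_cons, Multiset.sum_cons]
    exact add_pos_of_pos_of_nonneg (hpos i) (Multiset.sum_nonneg fun x hx => by
      obtain ⟨i, -, rfl⟩ := Multiset.mem_map.1 hx
      exact (hpos i).le)
  -- With `γ = shift s ν`, the exponent drops by `(β, γ) + (β + γ, γ) + (2ρ, γ)`. Dominance makes
  -- the first two terms nonnegative, and the last is positive as `γ` is a nonempty sum of simple
  -- roots.
  rw [casimirExp_add hc]
  have h4 := hsum _ h1
  have h5 := hsum _ h2
  omega

end Shift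

/-! ### Stable subspaces and the operators preserving them -/

section Stable

variable {k : Type*} [Field k] {M : Type*} [AddCommGroup M] [Module k M] {I J : Type*}

/-- A subspace is stable under the given operators. -/
structure IsStable (E F : J → Module.End k M) (K K' : I → Module.End k M) (N : Submodule k M) :
    Prop where
  E_mem : ∀ i, ∀ m ∈ N, E i m ∈ N
  F_mem : ∀ i, ∀ m ∈ N, F i m ∈ N
  K_mem : ∀ j, ∀ m ∈ N, K j m ∈ N
  K'_mem : ∀ j, ∀ m ∈ N, K' j m ∈ N

/-- The algebra of operators which preserve all stable subspaces. -/
def stableOps (E F : J → Module.End k M) (K K' : I → Module.End k M) :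
    Subalgebra k (Module.End k M) where
  carrier := {x | ∀ N, IsStable E F K K' N → ∀ m ∈ N, x m ∈ N}
  mul_mem' hx hy N hN m hm := hx N hN _ (hy N hN m hm)
  add_mem' hx hy N hN m hm := N.add_mem (hx N hN m hm) (hy N hN m hm)
  algebraMap_mem' r N _ _ hm := N.smul_mem r hm

/-- The smallest stable subspace containing `w`. -/
def generated (E F : J → Module.End k M) (K K' : I → Module.End k M) (w : M) : Submodule k M :=
  sInf {N | IsStable E F K K' N ∧ w ∈ N}

variable {E F : J → Module.End k M} {K K' : I → Module.End k M}

theorem isStable_bot : IsStable E F K K' ⊥ := by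
  constructor <;> (rintro i m hm; rw [Submodule.mem_bot] at hm ⊢; rw [hm, map_zero])

theorem isStable_top : IsStable E F K K' ⊤ := by
  constructor <;> (intros; trivial)

theorem isStable_sInf {P : Set (Submodule k M)} (hP : ∀ N ∈ P, IsStable E F K K' N) :
    IsStable E F K K' (sInf P) := by
  constructor <;> intro i m hm <;> rw [Submodule.mem_sInf] at hm ⊢ <;> intro N hN
  · exact (hP N hN).E_mem i m (hm N hN)
  · exact (hP N hN).F_mem i m (hm N hN)
  · exact (hP N hN).K_mem i m (hm N hN)
  · exact (hP N hN).K'_mem i m (hm N hN)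

theorem isStable_iSup {ι : Sort*} {P : ι → Submodule k M} (hP : ∀ i, IsStable E F K K' (P i)) :
    IsStable E F K K' (⨆ i, P i) := by
  have h : ∀ f : Module.End k M, (∀ i, ∀ m ∈ P i, f m ∈ P i) →
      ∀ m ∈ ⨆ i, P i, f m ∈ ⨆ i, P i := fun f hf m hm =>
    (iSup_le fun i m hm => Submodule.mem_iSup_of_mem i (hf i m hm) :
      ⨆ i, P i ≤ (⨆ i, P i).comap f) hm
  exact ⟨fun j => h _ fun i => (hP i).E_mem j, fun j => h _ fun i => (hP i).F_mem j,
    fun j => h _ fun i => (hP i).K_mem j, fun j => h _ fun i => (hP i).K'_mem j⟩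

theorem isStable_generated (w : M) : IsStable E F K K' (generated E F K K' w) :=
  isStable_sInf fun _ hN => hN.1

theorem mem_generated (w : M) : w ∈ generated E F K K' w :=
  (Submodule.mem_sInf).2 fun _ hN => hN.2

theorem generated_le {w : M} {N : Submodule k M} (hN : IsStable E F K K' N) (hw : w ∈ N) :
    generated E F K K' w ≤ N :=
  sInf_le ⟨hN, hw⟩

theorem E_mem_stableOps (i : J) : E i ∈ stableOps E F K K' := fun _ hN => hN.E_mem i

theorem F_mem_stableOps (i : J) : F i ∈ stableOps E F K K' := fun _ hN => hN.F_mem i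

theorem K_mem_stableOps (j : I) : K j ∈ stableOps E F K K' := fun _ hN => hN.K_mem j

theorem K'_mem_stableOps (j : I) : K' j ∈ stableOps E F K K' := fun _ hN => hN.K'_mem j

end Stable

/-- A sum of weight spaces, with operators satisfying the relations of a quantized Levi
subalgebra, the Serre relations excepted. -/
structure IsWeightModule {k : Type*} [Field k] {I J : Type*} [Fintype I] (q : k) (d : I → ℕ)
    (c : I → I → ℤ) (s : J → I) {M : Type*} [AddCommGroup M] [Module k M]
    (E F : J → Module.End k M) (K K' : I → Module.End k M) : Prop where
  K_mul_K' : ∀ j, K j * K' j = 1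
  K'_mul_K : ∀ j, K' j * K j = 1
  K_mul_K : ∀ i j, K i * K j = K j * K i
  K_mul_E : ∀ j i, K j * E i = q ^ c j (s i) • (E i * K j)
  K_mul_F : ∀ j i, K j * F i = q ^ (-c j (s i)) • (F i * K j)
  E_F : ∀ i, E i * F i - F i * E i =
    (q ^ d (s i) - (q ^ d (s i))⁻¹)⁻¹ • (K (s i) - K' (s i))
  E_F_of_ne : ∀ i j, i ≠ j → E i * F j = F j * E i
  iSup_weightSpace : ⨆ β, weightSpace q c K β = ⊤

/-! ### The Casimir operator of a weight module -/

namespace IsWeightModule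

variable {k : Type*} [Field k] {I J : Type*} [Fintype I] {q : k} {d : I → ℕ}
  {c : I → I → ℤ} {s : J → I} {M : Type*} [AddCommGroup M] [Module k M]
  {E F : J → Module.End k M} {K K' : I → Module.End k M}

theorem K'_apply (h : IsWeightModule q d c s E F K K') {β : I → ℤ} {m : M}
    (hm : m ∈ weightSpace q c K β) (hq : q ≠ 0) (j : I) :
    K' j m = q ^ (-pairing c β j) • m := by
  have h1 : K' j (K j m) = m := LinearMap.congr_fun (h.K'_mul_K j) m
  rw [hm j, map_smul] at h1
  rw [zpow_neg, eq_inv_smul_iff₀ (zpow_ne_zero _ hq), h1]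

theorem K_mul_K'_comm (h : IsWeightModule q d c s E F K K') (i j : I) :
    K i * K' j = K' j * K i := by
  have := mul_inv_comm_of (k := k) (c := 1) (X := K i) (h.K_mul_K' j) (h.K'_mul_K j)
    (by rw [one_smul, h.K_mul_K])
  rwa [one_smul] at this

/-- The operators form a quantum family in the algebra of operators preserving the stable
subspaces. -/
theorem isQuantumFamily (h : IsWeightModule q d c s E F K K') :
    IsQuantumFamily q (fun i => d (s i)) (fun i j => c (s i) (s j))
      (A := stableOps E F K K') (fun i => ⟨E i, E_mem_stableOps i⟩)
      (fun i => ⟨F i, F_mem_stableOps i⟩) (fun i => ⟨K (s i), K_mem_stableOps _⟩)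
      (fun i => ⟨K' (s i), K'_mem_stableOps _⟩) where
  K_mul_K' _ := Subtype.ext (h.K_mul_K' _)
  K'_mul_K _ := Subtype.ext (h.K'_mul_K _)
  K_mul_K _ _ := Subtype.ext (h.K_mul_K _ _)
  K_mul_E _ _ := Subtype.ext (h.K_mul_E _ _)
  K_mul_F _ _ := Subtype.ext (h.K_mul_F _ _)
  E_F _ := Subtype.ext (h.E_F _)
  E_F_of_ne _ _ hij := Subtype.ext (h.E_F_of_ne _ _ hij)

variable [DecidableEq I]

theorem E_mem_weightSpace (h : IsWeightModule q d c s E F K K') (hq : q ≠ 0)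
    (hc : ∀ i j, c i j = c j i) {β : I → ℤ} {m : M} (hm : m ∈ weightSpace q c K β) (i : J) :
    E i m ∈ weightSpace q c K (β + Pi.single (s i) 1) := fun j => by
  have h1 : K j (E i m) = q ^ c j (s i) • E i (K j m) := LinearMap.congr_fun (h.K_mul_E j i) m
  rw [h1, hm j, map_smul, smul_smul, ← zpow_add₀ hq, pairing_add, pairing_single, hc j, add_comm]

theorem F_mem_weightSpace (h : IsWeightModule q d c s E F K K') (hq : q ≠ 0)
    (hc : ∀ i j, c i j = c j i) {β : I → ℤ} {m : M} (hm : m ∈ weightSpace q c K β) (i : J) :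
    F i m ∈ weightSpace q c K (β - Pi.single (s i) 1) := fun j => by
  have h1 : K j (F i m) = q ^ (-c j (s i)) • F i (K j m) := LinearMap.congr_fun (h.K_mul_F j i) m
  rw [h1, hm j, map_smul, smul_smul, ← zpow_add₀ hq, pairing_sub, pairing_single, hc j, add_comm,
    sub_eq_add_neg]

theorem lower_mem_weightSpace (h : IsWeightModule q d c s E F K K') (hq : q ≠ 0)
    (hc : ∀ i j, c i j = c j i) (w : FreeMonoid J) : ∀ {β : I → ℤ} {m : M},
    m ∈ weightSpace q c K β →
    ((IsQuantumFamily.lower q (fun i => d (s i)) (A := stableOps E F K K')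
      (fun i => ⟨F i, F_mem_stableOps i⟩) (fun i => ⟨K' (s i), K'_mem_stableOps _⟩)
      (word w)).unop : Module.End k M) m ∈ weightSpace q c K (β - shift s (content w)) := by
  induction w using FreeMonoid.inductionOn' with
  | one =>
    intro β m hm
    simpa [content_one, shift_zero] using hm
  | of_mul i w ih =>
    intro β m hm
    rw [map_mul, map_mul, word_of, content_mul, content_of, shift_add, shift_singleton, ← sub_sub]
    have h1 : F i (K' (s i) m) ∈ weightSpace q c K (β - Pi.single (s i) 1) := by
      rw [h.K'_apply hm hq, map_smul]
      exact Submodule.smul_mem _ _ (h.F_mem_weightSpace hq hc hm i)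
    have h2 := ih (Submodule.smul_mem _ (-(q ^ d (s i) - (q ^ d (s i))⁻¹)) h1)
    rw [MulOpposite.unop_mul, IsQuantumFamily.lower, antiLift_ι]
    exact h2

variable [FiniteDimensional k M]

/-- A word lowers the height of a weight by its length. The finitely many weights have heights
between `-C` and `C`, so length `2 * C + 1` is too long to act. -/
theorem exists_lower_eq_zero (h : IsWeightModule q d c s E F K K') (hq : IsGeneric q)
    (hc : ∀ i j, c i j = c j i) (hinj : ∀ β, (∀ j, pairing c β j = 0) → β = 0) :
    ∃ N, ∀ w : FreeMonoid J, N ≤ w.length →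
      IsQuantumFamily.lower q (fun i => d (s i)) (A := stableOps E F K K')
        (fun i => ⟨F i, F_mem_stableOps i⟩) (fun i => ⟨K' (s i), K'_mem_stableOps _⟩)
        (word w) = 0 := by
  have hfin := finite_weightSpace_ne_bot (M := M) (c := c) (K := K) hq hinj
  obtain ⟨C, hC⟩ := (hfin.image fun β => (∑ i, β i).natAbs).bddAbove
  refine ⟨2 * C + 1, fun w hw => MulOpposite.unop_injective (Subtype.ext ?_)⟩
  refine ext_weightSpace h.iSup_weightSpace fun β m hm => ?_
  by_contra hne
  have h1 := h.lower_mem_weightSpace hq.ne_zero hc w hm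
  have hm0 : m ≠ 0 := fun h0 => hne (by rw [h0, map_zero, map_zero])
  have h2 := hC ⟨β, (Submodule.ne_bot_iff _).2 ⟨m, hm, hm0⟩, rfl⟩
  have h3 := hC ⟨_, (Submodule.ne_bot_iff _).2 ⟨_, h1, hne⟩, rfl⟩
  simp only [Pi.sub_apply, Finset.sum_sub_distrib, sum_shift, card_content] at h3
  simp only at h2
  omega

/-- The quantum Casimir operator. -/
theorem exists_casimir [Finite J] (h : IsWeightModule q d c s E F K K') (hq : IsGeneric q)
    (hc : ∀ i j, c i j = c j i) (hinj : ∀ β, (∀ j, pairing c β j = 0) → β = 0)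
    (hf : IsFiniteForm (fun i => d (s i)) fun i j => c (s i) (s j)) :
    ∃ T : Module.End k M, (∀ i, T * E i = E i * T) ∧ (∀ i, F i * T = T * F i) ∧
      (∀ j, K j * T = T * K j) ∧ (∀ j, K' j * T = T * K' j) ∧
      ∀ N, IsStable E F K K' N → ∀ β, ∀ v ∈ weightSpace q c K β, (∀ i, E i v ∈ N) →
        T v - q ^ casimirExp c β • v ∈ N := by
  classical
  have hq0 := hq.ne_zero
  obtain ⟨n, hn⟩ := h.exists_lower_eq_zero hq hc hinj
  obtain ⟨Ω, hΩF, hΩ, hΩE⟩ := h.isQuantumFamily.exists_casimir hq hf hn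
  obtain ⟨Q, hQ⟩ := exists_diagonal hq hinj h.iSup_weightSpace fun β => q ^ casimirExp c β
  have hKΩ : ∀ j, K j * (Ω : Module.End k M) = Ω * K j := fun j =>
    congrArg Subtype.val (hΩ ⟨K j, K_mem_stableOps j⟩ ⟨K' j, K'_mem_stableOps j⟩
      (fun i => c j (s i)) (Subtype.ext (h.K_mul_K' j)) (Subtype.ext (h.K'_mul_K j))
      (fun i => Subtype.ext (h.K_mul_E j i)) (fun i => Subtype.ext (h.K_mul_F j i))
      (fun i => Subtype.ext (h.K_mul_K'_comm j (s i))))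
  have hΩw : ∀ β, ∀ m ∈ weightSpace q c K β, (Ω : Module.End k M) m ∈ weightSpace q c K β := by
    intro β m hm j
    have : K j ((Ω : Module.End k M) m) = (Ω : Module.End k M) (K j m) :=
      LinearMap.congr_fun (hKΩ j) m
    rw [this, hm j, map_smul]
  obtain ⟨T, hTw⟩ : ∃ T : Module.End k M, ∀ β, ∀ m ∈ weightSpace q c K β,
      T m = q ^ casimirExp c β • (Ω : Module.End k M) m :=
    ⟨Ω * Q, fun β m hm => by rw [Module.End.mul_apply, hQ β m hm, map_smul]⟩
  have hKT : ∀ j, K j * T = T * K j := fun j => by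
    refine ext_weightSpace h.iSup_weightSpace fun β m hm => ?_
    rw [Module.End.mul_apply, Module.End.mul_apply, hTw β m hm, hm j, map_smul, map_smul,
      hΩw β m hm j, hTw β m hm, smul_comm]
  have hK'T : ∀ j, K' j * T = T * K' j := fun j => by
    have := mul_inv_comm_of (k := k) (c := 1) (X := T) (h.K_mul_K' j) (h.K'_mul_K j)
      (by rw [one_smul, hKT])
    rw [this, one_smul]
  -- On weight `β` the two factors `K' i` contribute `q ^ (-2 (β, α_i))`, which the change in
  -- `casimirExp` under lowering by `α_i` undoes.
  have hFT : ∀ i, F i * T = T * F i := fun i => by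
    refine ext_weightSpace h.iSup_weightSpace fun β m hm => ?_
    have h1 : (Ω : Module.End k M) (F i m) = F i (K' (s i) ((Ω : Module.End k M) (K' (s i) m))) :=
      LinearMap.congr_fun (congrArg Subtype.val (hΩF i)) m
    rw [Module.End.mul_apply, Module.End.mul_apply, hTw β m hm,
      hTw _ _ (h.F_mem_weightSpace hq0 hc hm i), h1, h.K'_apply hm hq0, map_smul, map_smul,
      map_smul, h.K'_apply (hΩw β m hm) hq0, casimirExp_sub_single hc, map_smul, map_smul,
      smul_smul, smul_smul, ← zpow_add₀ hq0, ← zpow_add₀ hq0]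
    congr 2
    ring
  refine ⟨T, fun i => ?_, hFT, hKT, hK'T, fun N hN β v hv hE => ?_⟩
  -- The commutator of `T` with `E i` commutes with `F i`, because `T` commutes with `F i`, `K (s
  -- i)` and `K' (s i)`. Its weight under `K (s i)` is positive, so the rank one lemma in `End M`
  -- makes it zero.
  · have hd := hf.d_pos i
    have hdiag : c (s i) (s i) = 2 * d (s i) := hf.diag i
    refine sub_eq_zero.1 (eq_zero_of_commute_F (E := E i) (F := F i) (K := K (s i))
      (K' := K' (s i)) hq hd (inv_ne_zero (hq.pow_sub_inv_ne_zero hd)) (h.K_mul_K' _)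
      (h.K'_mul_K _) ?_ ?_ (h.E_F i) (m := c (s i) (s i)) (by omega) ?_ ?_)
    · rw [h.K_mul_E, hdiag]
    · rw [h.K_mul_F, hdiag]
    · rw [mul_sub, sub_mul, ← mul_assoc, hKT, mul_assoc, ← mul_assoc (K _), h.K_mul_E, mul_assoc T,
        mul_assoc (E i), ← hKT]
      simp only [mul_smul_comm, smul_mul_assoc, mul_assoc]
      exact (smul_sub _ _ _).symm
    · have h1 : F i * (T * E i - E i * T) - (T * E i - E i * T) * F i =
          (E i * F i - F i * E i) * T - T * (E i * F i - F i * E i) := by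
        have h2 : F i * (T * E i) = T * (F i * E i) := by
          rw [← mul_assoc, hFT, mul_assoc]
        have h3 : E i * (T * F i) = E i * F i * T := by
          rw [← hFT, mul_assoc]
        rw [mul_sub, sub_mul, mul_sub, sub_mul, h2, mul_assoc (E i) T, h3]
        simp only [mul_assoc]
        abel
      have h4 : (E i * F i - F i * E i) * T = T * (E i * F i - F i * E i) := by
        rw [h.E_F, smul_mul_assoc, mul_smul_comm, sub_mul, mul_sub, hKT, hK'T]
      exact sub_eq_zero.1 (h1.trans (sub_eq_zero.2 h4))
  · rw [hTw β v hv]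
    suffices h1 : (Ω : Module.End k M) v - v ∈ N by
      have := N.smul_mem (q ^ casimirExp c β) h1
      rwa [smul_sub] at this
    -- The left coefficients lie in `stableOps`, hence preserve `N`. This is the reason for building
    -- `Ω` in that algebra and not in the full endomorphism algebra.
    have h2 : ∀ x ∈ Ideal.span (Set.range fun i => (⟨E i, E_mem_stableOps i⟩ :
        stableOps E F K K')), (x : Module.End k M) v ∈ N := by
      intro x hx
      induction hx using Submodule.span_induction with
      | mem x hx =>
        obtain ⟨i, rfl⟩ := hx
        exact hE i
      | zero => simp
      | add x y _ _ hx hy => exact N.add_mem hx hy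
      | smul a x _ hx => exact a.2 N hN _ hx
    exact h2 _ hΩE

end IsWeightModule

end QuantumLevi

end

/-! ### Complete reducibility of weight modules -/

noncomputable section

namespace QuantumLevi

section Polynomial

variable {k : Type*} [Field k] {M : Type*} [AddCommGroup M] [Module k M]

theorem aeval_apply_mem {T : Module.End k M} {N : Submodule k M} (hN : ∀ m ∈ N, T m ∈ N)
    (p : Polynomial k) : ∀ m ∈ N, Polynomial.aeval T p m ∈ N := by
  induction p using Polynomial.induction_on with
  | C a => exact fun m hm => by simpa using N.smul_mem a hm
  | add p r hp hr => exact fun m hm => by simpa using N.add_mem (hp m hm) (hr m hm)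
  | monomial n a h =>
    intro m hm
    rw [pow_succ, ← mul_assoc, map_mul, Polynomial.aeval_X]
    exact h _ (hN m hm)

/-- The polynomial `p - p(r)` is divisible by `X - r`, and the other factor, evaluated at `T`,
preserves `N`. -/
theorem aeval_apply_sub_mem {T : Module.End k M} {N : Submodule k M} (hN : ∀ m ∈ N, T m ∈ N)
    (p : Polynomial k) {r : k} {m : M} (hm : T m - r • m ∈ N) :
    Polynomial.aeval T p m - p.eval r • m ∈ N := by
  obtain ⟨g, hg⟩ := Polynomial.X_sub_C_dvd_sub_C_eval (a := r) (p := p)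
  have h1 := congrArg (fun x => Polynomial.aeval T x m) (hg.trans (mul_comm _ _))
  simp only [map_sub, map_mul, Polynomial.aeval_X, Polynomial.aeval_C] at h1
  have h2 : Polynomial.aeval T p m - p.eval r • m = Polynomial.aeval T g (T m - r • m) := h1
  rw [h2]
  exact aeval_apply_mem hN g _ hm

theorem aeval_apply_of_eq_smul {T : Module.End k M} (p : Polynomial k) {r : k} {m : M}
    (hm : T m = r • m) : Polynomial.aeval T p m = p.eval r • m :=
  sub_eq_zero.1 (aeval_apply_sub_mem (N := ⊥) (by simp) p (sub_eq_zero.2 hm))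

theorem apply_aeval_comm {f T : Module.End k M} (h : f * T = T * f) (p : Polynomial k) (m : M) :
    f (Polynomial.aeval T p m) = Polynomial.aeval T p (f m) := by
  have : Commute f (Polynomial.aeval T p) := by
    induction p using Polynomial.induction_on with
    | C a => simpa using Algebra.commute_algebraMap_right a f
    | add p r hp hr => simpa using hp.add_right hr
    | monomial n a ih =>
      rw [pow_succ, ← mul_assoc, map_mul, Polynomial.aeval_X]
      exact ih.mul_right h
  exact LinearMap.congr_fun this m

end Polynomial

section Scalar

variable {k : Type*} [Field k] {I J : Type*} {M : Type*} [AddCommGroup M] [Module k M]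
  {E F : J → Module.End k M} {K K' : I → Module.End k M}

/-- An operator commuting with the action is a scalar on the submodule generated by an
eigenvector. -/
theorem apply_eq_smul_of_mem_generated {T : Module.End k M} (hE : ∀ i, T * E i = E i * T)
    (hF : ∀ i, F i * T = T * F i) (hK : ∀ j, K j * T = T * K j) (hK' : ∀ j, K' j * T = T * K' j)
    {r : k} {w : M} (hw : T w = r • w) {m : M} (hm : m ∈ generated E F K K' w) :
    T m = r • m := by
  have key : ∀ f : Module.End k M, f * T = T * f → ∀ m ∈ LinearMap.ker (T - r • LinearMap.id),
      f m ∈ LinearMap.ker (T - r • LinearMap.id) := by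
    intro f hf m hm
    have h1 : f (T m) = T (f m) := LinearMap.congr_fun hf m
    rw [LinearMap.mem_ker, LinearMap.sub_apply, LinearMap.smul_apply, LinearMap.id_apply,
      sub_eq_zero] at hm ⊢
    rw [← h1, hm, map_smul]
  have hst : IsStable E F K K' (LinearMap.ker (T - r • LinearMap.id)) :=
    ⟨fun i => key _ (hE i).symm, fun i => key _ (hF i), fun j => key _ (hK j),
      fun j => key _ (hK' j)⟩
  have h2 := generated_le hst (by simp [hw]) hm
  rwa [LinearMap.mem_ker, LinearMap.sub_apply, sub_eq_zero] at h2

end Scalar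

namespace IsWeightModule

variable {k : Type*} [Field k] {I J : Type*} [Fintype I] {q : k} {d : I → ℕ}
  {c : I → I → ℤ} {s : J → I} {M : Type*} [AddCommGroup M] [Module k M]
  {E F : J → Module.End k M} {K K' : I → Module.End k M}

/-- A weight vector which is singular modulo a stable subspace has a dominant weight. -/
theorem pairing_nonneg [FiniteDimensional k M] (h : IsWeightModule q d c s E F K K')
    (hq : IsGeneric q) (hf : IsFiniteForm (fun i => d (s i)) fun i j => c (s i) (s j))
    {N : Submodule k M} (hN : IsStable E F K K' N) {β : I → ℤ} {v : M}
    (hv : v ∈ weightSpace q c K β) (hvN : v ∉ N) (i : J) (hE : E i v ∈ N) :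
    0 ≤ pairing c β (s i) := by
  have hd := hf.d_pos i
  have hδ := hq.pow_sub_inv_ne_zero hd
  have hdiag : c (s i) (s i) = 2 * d (s i) := hf.diag i
  -- In the quotient by `N` the vector is nonzero and killed by `E i`. The scalar on `F i` clears
  -- the denominator of the commutator.
  refine highest_weight_nonneg hq hd (V := M ⧸ N) (e := N.mapQ N (E i) (hN.E_mem i))
    (f := (q ^ d (s i) - (q ^ d (s i))⁻¹) • N.mapQ N (F i) (hN.F_mem i))
    (κ := N.mapQ N (K (s i)) (hN.K_mem _)) (κ' := N.mapQ N (K' (s i)) (hN.K'_mem _)) ?_ ?_ ?_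
    (v := N.mkQ v) (by simpa using hvN) (by simpa using hE) ?_
  · refine Submodule.linearMap_qext _ (LinearMap.ext fun m => ?_)
    exact congrArg N.mkQ (LinearMap.congr_fun (h.K'_mul_K (s i)) m)
  · refine Submodule.linearMap_qext _ (LinearMap.ext fun m => ?_)
    have h1 : K (s i) (F i m) = q ^ (-c (s i) (s i)) • F i (K (s i) m) :=
      LinearMap.congr_fun (h.K_mul_F (s i) i) m
    have h2 := congrArg (fun x => (q ^ d (s i) - (q ^ d (s i))⁻¹) • N.mkQ x) h1
    rw [hdiag] at h2
    simp only [map_smul] at h2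
    simp only [LinearMap.comp_apply, Module.End.mul_apply, LinearMap.smul_apply, map_smul,
      Submodule.mkQ_apply, Submodule.mapQ_apply]
    rw [smul_comm (q ^ (-(2 * d (s i) : ℤ)))]
    exact h2
  · refine Submodule.linearMap_qext _ (LinearMap.ext fun m => ?_)
    have h1 : E i (F i m) - F i (E i m) =
        (q ^ d (s i) - (q ^ d (s i))⁻¹)⁻¹ • (K (s i) m - K' (s i) m) :=
      LinearMap.congr_fun (h.E_F i) m
    have h2 := congrArg (fun x => (q ^ d (s i) - (q ^ d (s i))⁻¹) • N.mkQ x) h1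
    simp only [map_smul, smul_inv_smul₀ hδ, map_sub, smul_sub] at h2
    simp only [LinearMap.comp_apply, Module.End.mul_apply, LinearMap.smul_apply, map_smul,
      LinearMap.sub_apply, Submodule.mkQ_apply, Submodule.mapQ_apply]
    exact h2
  · have h1 := congrArg N.mkQ (hv (s i))
    rw [map_smul] at h1
    exact h1

variable [DecidableEq I]

/-- A vector of maximal weight of one subspace modulo another. -/
theorem exists_singular_mod [FiniteDimensional k M] (h : IsWeightModule q d c s E F K K')
    (hq : IsGeneric q) (hc : ∀ i j, c i j = c j i)
    (hinj : ∀ β, (∀ j, pairing c β j = 0) → β = 0) {N₁ N₂ : Submodule k M}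
    (hN : IsStable E F K K' N₂) (hle : ¬ N₂ ≤ N₁) :
    ∃ β, ∃ v ∈ N₂, v ∈ weightSpace q c K β ∧ v ∉ N₁ ∧ ∀ i, E i v ∈ N₁ := by
  set Γ := {β | ¬ N₂ ⊓ weightSpace q c K β ≤ N₁} with hΓ
  have hfin : Γ.Finite := (finite_weightSpace_ne_bot (M := M) (c := c) (K := K) hq hinj).subset
    fun β hβ h0 => hβ (by rw [h0, inf_bot_eq]; exact bot_le)
  have hne : Γ.Nonempty := by
    by_contra! h0
    refine hle ((le_iSup_inf_weightSpace hq hinj h.iSup_weightSpace hN.K_mem).trans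
      (iSup_le fun β => ?_))
    by_contra hβ
    exact Set.notMem_empty β (h0 ▸ hβ)
  -- Maximal height suffices, since each `E i` raises the height by one.
  obtain ⟨β, hβ, hmax⟩ := Set.exists_max_image Γ (fun β => ∑ i, β i) hfin hne
  obtain ⟨v, ⟨hv2, hvβ⟩, hv1⟩ := SetLike.not_le_iff_exists.1 hβ
  refine ⟨β, v, hv2, hvβ, hv1, fun i => ?_⟩
  by_contra hi
  have := hmax (β + Pi.single (s i) 1) fun hle' =>
    hi (hle' ⟨hN.E_mem i _ hv2, h.E_mem_weightSpace hq.ne_zero hc hvβ i⟩)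
  simp [Finset.sum_add_distrib] at this

/-- Words in the `F`s alone already span a stable subspace: an `E i` moves through a word leaving
only torus terms, which act by scalars on weight vectors, and it kills `w` at the end. -/
theorem isStable_span_words (h : IsWeightModule q d c s E F K K') (hq : q ≠ 0)
    (hc : ∀ i j, c i j = c j i) {β : I → ℤ} {w : M} (hw : w ∈ weightSpace q c K β)
    (hE : ∀ i, E i w = 0) :
    (∀ u : FreeMonoid J, FreeAlgebra.lift k F (word u) w ∈
      weightSpace q c K (β - shift s (content u))) ∧
    IsStable E F K K' (Submodule.span k
      (Set.range fun u : FreeMonoid J => FreeAlgebra.lift k F (word u) w)) := by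
  have hwt : ∀ u : FreeMonoid J, FreeAlgebra.lift k F (word u) w ∈
      weightSpace q c K (β - shift s (content u)) := by
    intro u
    induction u using FreeMonoid.inductionOn' with
    | one => simpa [content_one, shift_zero] using hw
    | of_mul i u ih =>
      rw [map_mul, map_mul, word_of, FreeAlgebra.lift_ι_apply, content_mul, content_of, shift_add,
        shift_singleton, add_comm, ← sub_sub]
      exact h.F_mem_weightSpace hq hc ih i
  have hspan : ∀ f : Module.End k M, (∀ u : FreeMonoid J,
      f (FreeAlgebra.lift k F (word u) w) ∈ Submodule.span k
        (Set.range fun u : FreeMonoid J => FreeAlgebra.lift k F (word u) w)) →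
      ∀ m ∈ Submodule.span k (Set.range fun u : FreeMonoid J => FreeAlgebra.lift k F (word u) w),
        f m ∈ Submodule.span k
          (Set.range fun u : FreeMonoid J => FreeAlgebra.lift k F (word u) w) := by
    intro f hf m hm
    rw [← Submodule.mem_comap]
    refine Submodule.span_le.2 (Set.range_subset_iff.2 fun u => ?_) hm
    exact hf u
  refine ⟨hwt, fun i => hspan _ fun u => ?_, fun i => hspan _ fun u => ?_,
    fun j => hspan _ fun u => ?_, fun j => hspan _ fun u => ?_⟩
  · induction u using FreeMonoid.inductionOn' with
    | one => simp [hE]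
    | of_mul j u ih =>
      have hF : F j (E i (FreeAlgebra.lift k F (word u) w)) ∈ Submodule.span k
          (Set.range fun u : FreeMonoid J => FreeAlgebra.lift k F (word u) w) := by
        refine hspan _ (fun u => Submodule.subset_span ⟨.of j * u, ?_⟩) _ ih
        beta_reduce
        rw [map_mul, map_mul, word_of, FreeAlgebra.lift_ι_apply]; rfl
      rw [map_mul, map_mul, word_of, FreeAlgebra.lift_ι_apply, Module.End.mul_apply]
      by_cases hij : i = j
      · subst hij
        set m := FreeAlgebra.lift k F (word u) w with hm
        have h1 : E i (F i m) - F i (E i m) =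
            (q ^ d (s i) - (q ^ d (s i))⁻¹)⁻¹ • (K (s i) m - K' (s i) m) :=
          LinearMap.congr_fun (h.E_F i) m
        rw [sub_eq_iff_eq_add.1 h1, hwt u, h.K'_apply (hwt u) hq]
        have h2 := Submodule.subset_span (R := k) (Set.mem_range_self (f := fun u : FreeMonoid J =>
          FreeAlgebra.lift k F (word u) w) u)
        exact Submodule.add_mem _ (Submodule.smul_mem _ _ (Submodule.sub_mem _
          (Submodule.smul_mem _ _ h2) (Submodule.smul_mem _ _ h2))) hF
      · have h1 : E i (F j (FreeAlgebra.lift k F (word u) w)) =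
            F j (E i (FreeAlgebra.lift k F (word u) w)) :=
          LinearMap.congr_fun (h.E_F_of_ne i j hij) _
        rw [h1]
        exact hF
  · refine Submodule.subset_span ⟨.of i * u, ?_⟩
    beta_reduce
    rw [map_mul, map_mul, word_of, FreeAlgebra.lift_ι_apply]; rfl
  · rw [hwt u j]
    exact Submodule.smul_mem _ _ (Submodule.subset_span ⟨u, rfl⟩)
  · rw [h.K'_apply (hwt u) hq]
    exact Submodule.smul_mem _ _ (Submodule.subset_span ⟨u, rfl⟩)

/-- The submodule generated by a singular weight vector lies in lower weight spaces. -/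
theorem generated_le_weights (h : IsWeightModule q d c s E F K K') (hq : q ≠ 0)
    (hc : ∀ i j, c i j = c j i) {β : I → ℤ} {w : M} (hw : w ∈ weightSpace q c K β)
    (hE : ∀ i, E i w = 0) :
    generated E F K K' w ≤ Submodule.span k {w} ⊔
      ⨆ ν : {ν : Multiset J // ν ≠ 0}, weightSpace q c K (β - shift s ν) := by
  obtain ⟨hwt, hst⟩ := h.isStable_span_words hq hc hw hE
  refine (generated_le hst (Submodule.subset_span ⟨1, by simp⟩)).trans
    (Submodule.span_le.2 (Set.range_subset_iff.2 fun u => ?_))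
  by_cases hu : content u = 0
  · have : u = 1 := FreeMonoid.length_eq_zero.1 (by rw [← card_content, hu]; rfl)
    subst this
    exact Submodule.mem_sup_left (Submodule.mem_span_singleton.2 ⟨1, by simp⟩)
  · exact Submodule.mem_sup_right (Submodule.mem_iSup_of_mem ⟨content u, hu⟩ (hwt u))

/-- Apart from the line of `w`, everything generated lies in weights `β - shift s ν` with `ν ≠ 0`,
all killed by `π`. This covers both `γ = β` and weights that do not occur in the module at all. -/
theorem exists_proj_eq_smul (h : IsWeightModule q d c s E F K K') (hq : q ≠ 0)
    (hc : ∀ i j, c i j = c j i) {β : I → ℤ} {w : M}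
    (hw : w ∈ weightSpace q c K β) (hE : ∀ i, E i w = 0) {γ : I → ℤ} {m : M}
    (hm : m ∈ generated E F K K' w) {π : Module.End k M}
    (hπ : ∀ γ' ≠ γ, ∀ m ∈ weightSpace q c K γ', π m = 0)
    (hγ : ∀ ν : Multiset J, ν ≠ 0 → γ ≠ β - shift s ν) : ∃ a : k, π m = a • π w := by
  have h1 : generated E F K K' w ≤ (Submodule.span k {π w}).comap π := by
    refine (h.generated_le_weights hq hc hw hE).trans (sup_le ?_ (iSup_le fun ν => ?_))
    · rw [Submodule.span_singleton_le_iff_mem]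
      exact Submodule.mem_span_singleton_self _
    · intro x hx
      rw [Submodule.mem_comap, hπ _ (hγ ν ν.2).symm x hx]
      exact Submodule.zero_mem _
  obtain ⟨a, ha⟩ := Submodule.mem_span_singleton.1 (h1 hm)
  exact ⟨a, ha.symm⟩

variable [FiniteDimensional k M] [Finite J]

/-- The submodule generated by a singular weight vector is irreducible. -/
theorem eq_generated_of_le (h : IsWeightModule q d c s E F K K') (hq : IsGeneric q)
    (hc : ∀ i j, c i j = c j i) (hinj : ∀ β, (∀ j, pairing c β j = 0) → β = 0)
    (hf : IsFiniteForm (fun i => d (s i)) fun i j => c (s i) (s j)) {β : I → ℤ} {w : M}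
    (hw : w ∈ weightSpace q c K β) (hE : ∀ i, E i w = 0) {N : Submodule k M}
    (hN : IsStable E F K K' N) (hle : N ≤ generated E F K K' w) (hN0 : N ≠ ⊥) :
    N = generated E F K K' w := by
  obtain ⟨T, hTE, hFT, hKT, hK'T, hT⟩ := h.exists_casimir hq hc hinj hf
  have hT0 : ∀ γ, ∀ v ∈ weightSpace q c K γ, (∀ i, E i v = 0) → T v = q ^ casimirExp c γ • v :=
    fun γ v hv hEv => sub_eq_zero.1 (hT ⊥ isStable_bot γ v hv hEv)
  obtain ⟨γ, v, hvN, hvγ, hv0, hEv⟩ :=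
    h.exists_singular_mod hq hc hinj (N₁ := ⊥) hN fun h0 => hN0 (le_bot_iff.1 h0)
  replace hEv : ∀ i, E i v = 0 := hEv
  replace hv0 : v ≠ 0 := hv0
  have hw0 : w ≠ 0 := by
    rintro rfl
    exact hv0 ((generated_le (isStable_bot (E := E) (F := F) (K := K) (K' := K'))
      (Submodule.zero_mem _)) (hle hvN))
  -- The Casimir operator is one scalar on all that `w` generates, and `v` is both there and
  -- singular.
  have hf' : casimirExp c β = casimirExp c γ := by
    have h1 := apply_eq_smul_of_mem_generated hTE hFT hKT hK'T (hT0 β w hw hE) (hle hvN)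
    rw [hT0 γ v hvγ hEv] at h1
    exact (hq.zpow_injective (smul_left_injective k hv0 h1)).symm
  have hpos : ∀ i, 0 < c (s i) (s i) := fun i => by
    have h1 := hf.d_pos i
    have h2 : c (s i) (s i) = 2 * d (s i) := hf.diag i
    omega
  obtain ⟨π, hπ, hπ'⟩ := exists_weightProj (K := K) hq hinj h.iSup_weightSpace γ
  -- If `γ` were strictly below `β`, two comparable dominant weights would share a Casimir exponent.
  -- So `γ = β` and `v` is a multiple of `w`.
  obtain ⟨a, ha⟩ := h.exists_proj_eq_smul hq.ne_zero hc hw hE (hle hvN) hπ' fun ν hν hγ => by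
    have hβ : β = γ + shift s ν := by rw [hγ, sub_add_cancel]
    refine casimirExp_ne hc hpos hν (β := γ)
      (fun i => h.pairing_nonneg hq hf isStable_bot hvγ hv0 i (hEv i)) ?_ (hβ ▸ hf')
    rw [← hβ]
    exact fun i => h.pairing_nonneg hq hf isStable_bot hw hw0 i (hE i)
  rw [hπ v hvγ] at ha
  have hγβ : γ = β := by
    by_contra hne
    rw [hπ' β (Ne.symm hne) w hw, smul_zero] at ha
    exact hv0 ha
  subst hγβ
  rw [hπ w hw] at ha
  refine le_antisymm hle (generated_le hN ?_)
  have ha0 : a ≠ 0 := by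
    rintro rfl
    exact hv0 (by rw [ha, zero_smul])
  have := N.smul_mem a⁻¹ hvN
  rwa [ha, inv_smul_smul₀ ha0] at this

/-- A weight module is the sum of the submodules generated by singular weight vectors. -/
theorem iSup_generated (h : IsWeightModule q d c s E F K K') (hq : IsGeneric q)
    (hc : ∀ i j, c i j = c j i) (hinj : ∀ β, (∀ j, pairing c β j = 0) → β = 0)
    (hf : IsFiniteForm (fun i => d (s i)) fun i j => c (s i) (s j)) :
    ⨆ w : {w : M // w ≠ 0 ∧ (∃ β, w ∈ weightSpace q c K β) ∧ ∀ i, E i w = 0},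
      generated E F K K' (w : M) = ⊤ := by
  classical
  set N := ⨆ w : {w : M // w ≠ 0 ∧ (∃ β, w ∈ weightSpace q c K β) ∧ ∀ i, E i w = 0},
      generated E F K K' (w : M) with hNdef
  by_contra hne
  have hN : IsStable E F K K' N := isStable_iSup fun _ => isStable_generated _
  obtain ⟨T, hTE, hFT, hKT, hK'T, hT⟩ := h.exists_casimir hq hc hinj hf
  have hT0 : ∀ γ, ∀ v ∈ weightSpace q c K γ, (∀ i, E i v = 0) → T v = q ^ casimirExp c γ • v :=
    fun γ v hv hEv => sub_eq_zero.1 (hT ⊥ isStable_bot γ v hv hEv)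
  obtain ⟨μ, v, -, hvμ, hvN, hEv⟩ :=
    h.exists_singular_mod hq hc hinj (N₁ := N) isStable_top fun h0 => hne (top_le_iff.1 h0)
  have hpos : ∀ i, 0 < c (s i) (s i) := fun i => by
    have h1 := hf.d_pos i
    have h2 : c (s i) (s i) = 2 * d (s i) := hf.diag i
    omega
  have hTgen : ∀ β, ∀ w ∈ weightSpace q c K β, (∀ i, E i w = 0) →
      ∀ m ∈ generated E F K K' w, T m = q ^ casimirExp c β • m := fun β w hw hE m hm =>
    apply_eq_smul_of_mem_generated hTE hFT hKT hK'T (hT0 β w hw hE) hm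
  have hTN : ∀ m ∈ N, T m ∈ N := by
    have : N ≤ N.comap T := by
      refine iSup_le fun w m hm => ?_
      obtain ⟨w, hw0, ⟨β, hw⟩, hE⟩ := w
      rw [Submodule.mem_comap, hTgen β w hw hE m hm]
      exact N.smul_mem _ (Submodule.mem_iSup_of_mem ⟨w, hw0, ⟨β, hw⟩, hE⟩ hm)
    exact this
  have hfin := finite_weightSpace_ne_bot (M := M) (c := c) (K := K) hq hinj
  set c₀ := q ^ casimirExp c μ with hc₀
  -- The polynomial `p` vanishes at every possible Casimir eigenvalue other than `c₀`, the one
  -- belonging to `μ`. Since `v` has eigenvalue `c₀` modulo `N`, the vector `p(T) v` stays outside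
  -- `N`.
  set Γ := (hfin.toFinset.image fun γ => q ^ casimirExp c γ).erase c₀ with hΓ
  set p : Polynomial k := ∏ r ∈ Γ, (Polynomial.X - Polynomial.C r) with hp
  have hp0 : p.eval c₀ ≠ 0 := by
    rw [hp, Polynomial.eval_prod, Finset.prod_ne_zero_iff]
    intro r hr
    rw [Polynomial.eval_sub, Polynomial.eval_X, Polynomial.eval_C, sub_ne_zero]
    exact (Finset.ne_of_mem_erase hr).symm
  set v' := Polynomial.aeval T p v with hv'
  have hv'N : v' ∉ N := fun h1 => by
    have h2 := aeval_apply_sub_mem hTN p (hT N hN μ v hvμ hEv)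
    have h3 := N.smul_mem (p.eval c₀)⁻¹ (N.sub_mem h1 h2)
    rw [sub_sub_cancel, inv_smul_smul₀ hp0] at h3
    exact hvN h3
  have hpw : ∀ γ, ∀ m ∈ weightSpace q c K γ, Polynomial.aeval T p m ∈ weightSpace q c K γ :=
    fun γ m hm j => by rw [apply_aeval_comm (hKT j), hm j, map_smul]
  have hE' : ∀ i, E i v' = 0 := by
    intro i
    obtain ⟨π, hπ, hπ'⟩ := exists_weightProj (K := K) hq hinj h.iSup_weightSpace
      (μ + Pi.single (s i) 1)
    -- The vector `E i v` lies in `N` and has weight `μ + α_i`, so `p(T)` kills it once it kills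
    -- that weight component of `N`. A generator `w` with eigenvalue different from `c₀` is killed
    -- by `p(T)`. One with eigenvalue `c₀` cannot have weight at or above `μ + α_i`, by comparison
    -- of dominant weights, and so contributes nothing in that weight.
    have hker : N ≤ LinearMap.ker (π * Polynomial.aeval T p) := by
      refine iSup_le fun w m hm => ?_
      obtain ⟨w, hw0, ⟨β, hw⟩, hE⟩ := w
      rw [LinearMap.mem_ker, Module.End.mul_apply,
        aeval_apply_of_eq_smul p (hTgen β w hw hE m hm)]
      by_cases hβ : q ^ casimirExp c β = c₀
      · have hlow : ∀ ν : Multiset J, μ + Pi.single (s i) 1 ≠ β - shift s ν := fun ν hν => by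
          have hβμ : β = μ + shift s (i ::ₘ ν) := by
            rw [shift_cons, ← add_assoc, hν, sub_add_cancel]
          refine casimirExp_ne hc hpos (Multiset.cons_ne_zero (a := i) (m := ν)) (β := μ)
            (fun j => h.pairing_nonneg hq hf hN hvμ hvN j (hEv j)) ?_
            (hβμ ▸ hq.zpow_injective hβ)
          rw [← hβμ]
          exact fun j => h.pairing_nonneg hq hf isStable_bot hw hw0 j (hE j)
        obtain ⟨a, ha⟩ := h.exists_proj_eq_smul hq.ne_zero hc hw hE hm hπ' fun ν _ => hlow ν
        have hβ0 : β ≠ μ + Pi.single (s i) 1 := fun h0 => hlow 0 (by rw [shift_zero, sub_zero, h0])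
        rw [map_smul, ha, hπ' β hβ0 w hw, smul_zero, smul_zero]
      · have hmem : q ^ casimirExp c β ∈ Γ := Finset.mem_erase.2 ⟨hβ, Finset.mem_image.2 ⟨β,
          hfin.mem_toFinset.2 ((Submodule.ne_bot_iff _).2 ⟨w, hw, hw0⟩), rfl⟩⟩
        have : p.eval (q ^ casimirExp c β) = 0 := by
          rw [hp, Polynomial.eval_prod]
          exact Finset.prod_eq_zero hmem (by simp)
        rw [this, zero_smul, map_zero]
    have h1 : π (Polynomial.aeval T p (E i v)) = 0 := hker (hEv i)
    rwa [hπ _ (hpw _ _ (h.E_mem_weightSpace hq.ne_zero hc hvμ i)),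
      ← apply_aeval_comm (hTE i).symm] at h1
  have hv'μ := hpw μ v hvμ
  refine hv'N (Submodule.mem_iSup_of_mem ⟨v', ?_, ⟨μ, hv'μ⟩, hE'⟩ (mem_generated v'))
  rintro h0
  exact hv'N (h0 ▸ N.zero_mem)

end IsWeightModule

end QuantumLevi

end

/-! ### Positivity of the root form -/

noncomputable section

namespace QuantumLevi

section RootSystem

variable {ι R M N : Type*} [Finite ι] [Field R] [CharZero R] [AddCommGroup M] [Module R M]
  [AddCommGroup N] [Module R N] {P : RootPairing ι R M N} [P.IsCrystallographic]

/-- Positivity of the root form, in terms of the Cartan matrix. -/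
theorem exists_pos_cartanMatrix (b : P.Base) [Fintype b.support] {ν : b.support → ℤ} (hν : ν ≠ 0) :
    ∃ i, 0 < ν i * ∑ j, ν j * b.cartanMatrix j i := by
  have := Fintype.ofFinite ι
  set B := P.posRootForm ℤ with hB
  set x : P.rootSpan ℤ := ∑ i, ν i • P.rootSpanMem ℤ (i : ι) with hx
  have hx0 : x ≠ 0 := fun h0 => hν (funext (Fintype.linearIndependent_iff.1
    b.linearIndependentInt ν h0))
  have hpos : 0 < B.posForm x x := P.posRootForm_posForm_pos_of_ne_zero ℤ hx0
  have hij : ∀ i j : ι, 2 * B.posForm (P.rootSpanMem ℤ j) (P.rootSpanMem ℤ i) =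
      P.pairingIn ℤ j i * B.rootLength i := fun i j => by
    apply FaithfulSMul.algebraMap_injective ℤ R
    rw [map_mul, map_mul, map_ofNat, B.algebraMap_rootLength, P.algebraMap_pairingIn,
      B.algebraMap_posForm]
    exact B.toInvariantForm.two_mul_apply_root_root j i
  have hxi : ∀ i : b.support, 2 * B.posForm x (P.rootSpanMem ℤ (i : ι)) =
      (∑ j, ν j * b.cartanMatrix j i) * B.rootLength (i : ι) := fun i => by
    rw [hx, map_sum, LinearMap.sum_apply, Finset.mul_sum, Finset.sum_mul]
    refine Finset.sum_congr rfl fun j _ => ?_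
    rw [map_smul, LinearMap.smul_apply, smul_eq_mul, mul_left_comm, hij, ← mul_assoc]
    rfl
  -- With `x = ∑ ν_i α_i`, the number `2 (x, x)` is the sum of the quantities in the goal weighted
  -- by the positive root lengths. If none were positive, this would contradict `(x, x) > 0`.
  by_contra! hle
  have h1 : 2 * B.posForm x x = ∑ i, ν i * ((∑ j, ν j * b.cartanMatrix j i) *
      B.rootLength (i : ι)) := by
    conv_lhs => rw [hx, map_sum, Finset.mul_sum]
    refine Finset.sum_congr rfl fun i _ => ?_
    rw [map_smul, smul_eq_mul, mul_left_comm, ← hx, hxi]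
  have h2 : 2 * B.posForm x x ≤ 0 := by
    rw [h1]
    refine Finset.sum_nonpos fun i _ => ?_
    rw [← mul_assoc]
    exact mul_nonpos_of_nonpos_of_nonneg (hle i) (B.rootLength_pos (i : ι)).le
  omega

end RootSystem

section Lie

open LieAlgebra.IsKilling

variable {L : Type*} [LieRing L] [LieAlgebra ℂ L] [FiniteDimensional ℂ L]
  [LieAlgebra.IsSemisimple ℂ L] {H : LieSubalgebra ℂ L} [H.IsCartanSubalgebra]
  (b : (rootSystem H).Base) {d : b.support → ℕ}

/-- Nondegeneracy, a consequence of positivity; it ensures that a root-lattice weight is determined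
by the eigenvalues of the `K_j`. -/
theorem eq_zero_of_pairing_eq_zero [Fintype b.support] (hd : ∀ i, 0 < d i)
    (hsymm : ∀ i j, (d i : ℤ) * cartanInt b i j = d j * cartanInt b j i) (β : b.support → ℤ)
    (hβ : ∀ j, pairing (fun i j => (d i : ℤ) * cartanInt b i j) β j = 0) : β = 0 := by
  by_contra h0
  obtain ⟨i, hi⟩ := exists_pos_cartanMatrix b h0
  have h1 : (d i : ℤ) * ∑ j, β j * b.cartanMatrix j i = 0 := by
    rw [← hβ i, pairing, Finset.mul_sum]
    refine Finset.sum_congr rfl fun j _ => ?_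
    rw [hsymm j i, mul_left_comm]
    rfl
  rw [mul_eq_zero, Int.natCast_eq_zero] at h1
  have h2 : ∑ j, β j * b.cartanMatrix j i = 0 := h1.resolve_left (hd i).ne'
  rw [h2, mul_zero] at hi
  exact lt_irrefl _ hi

/-- Positivity yields an index where the coefficient times the pairing is positive. The coefficients
of a multiset on `S` are nonnegative and vanish off `S`, so this index lies in `S` and the pairing
itself is positive. -/
theorem isFiniteForm_restrict (hd : ∀ i, 0 < d i)
    (hsymm : ∀ i j, (d i : ℤ) * cartanInt b i j = d j * cartanInt b j i) (S : Set b.support) :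
    IsFiniteForm (fun i : S => d i) fun i j => (d i : ℤ) * cartanInt b (i : b.support) j where
  d_pos i := hd i
  diag i := by
    rw [cartanInt, b.cartanMatrix_apply_same, mul_comm]
  symm i j := hsymm i j
  exists_pos ν hν := by
    classical
    have := Fintype.ofFinite b.support
    obtain ⟨i, hi⟩ := exists_pos_cartanMatrix b (shift_ne_zero (Subtype.val : S → b.support) hν)
    rw [sum_shift_mul _ ν fun j => b.cartanMatrix j i] at hi
    have h1 := sum_shift_mul (Subtype.val : S → b.support) ν (Pi.single i 1)
    simp only [Pi.single_apply, mul_ite, mul_one, mul_zero, Finset.sum_ite_eq', Finset.mem_univ,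
      if_true] at h1
    obtain ⟨j, hj⟩ : ∃ j : S, (j : b.support) = i := by
      by_contra! hne
      have h2 : shift (Subtype.val : S → b.support) ν i = 0 := by
        rw [h1]
        simp [hne]
      rw [h2, zero_mul] at hi
      exact lt_irrefl _ hi
    have h3 : 0 ≤ shift (Subtype.val : S → b.support) ν i := by
      rw [h1]
      refine Multiset.sum_nonneg fun x hx => ?_
      obtain ⟨l, -, rfl⟩ := Multiset.mem_map.1 hx
      positivity
    refine ⟨j, ?_⟩
    rw [wt, Multiset.sum_map_mul_left, hj]
    exact mul_pos (by exact_mod_cast hd i) (pos_of_mul_pos_right hi h3)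

end Lie

end QuantumLevi

end

/-! ### Cyclic adjoint modules as weight modules -/

noncomputable section

namespace QuantumLevi

section Restrict

variable {k : Type*} [Field k] {M : Type*} [AddCommGroup M] [Module k M] {I : Type*} [Fintype I]

/-- A stable subspace of a sum of weight spaces is the sum of its own weight spaces. -/
theorem iSup_weightSpace_restrict {q : k} (hq : IsGeneric q) {c : I → I → ℤ}
    (hinj : ∀ β, (∀ j, pairing c β j = 0) → β = 0) {K : I → Module.End k M}
    (hspan : ⨆ β, weightSpace q c K β = ⊤) {p : Submodule k M} {K₀ : I → Module.End k p}
    (hK₀ : ∀ j x, (K₀ j x : M) = K j x) : ⨆ β, weightSpace q c K₀ β = ⊤ := by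
  refine Submodule.map_injective_of_injective p.injective_subtype (le_antisymm
    (Submodule.map_mono le_top) ?_)
  rw [Submodule.map_top, Submodule.range_subtype, Submodule.map_iSup]
  refine (le_iSup_inf_weightSpace hq hinj hspan (p := p) fun j m hm => ?_).trans
    (iSup_mono fun β => ?_)
  · rw [← hK₀ j ⟨m, hm⟩]
    exact (K₀ j ⟨m, hm⟩).2
  · rintro m ⟨hm, hmβ⟩
    refine ⟨⟨m, hm⟩, fun j => Subtype.ext ?_, rfl⟩
    rw [hK₀ j ⟨m, hm⟩]
    exact hmβ j

end Restrict

open Uq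

variable {k : Type*} [Field k] {I : Type*}

/-- The symmetrized Cartan matrix. -/
def CartanDatum.form (D : CartanDatum I) (i j : I) : ℤ := D.d i * D.a i j

variable (D : CartanDatum I) {q : k} (hq : IsGeneric q)

section Weights

variable [Fintype I]

/-- The quantized enveloping algebra is the sum of its weight spaces. -/
theorem iSup_weightSpace_adL :
    ⨆ β, weightSpace q D.form (fun j => adL D hq (K D q j)) β = ⊤ := by
  classical
  have hmem : ∀ {β : I → ℤ} {x : Uq D q}, (∀ j, K D q j * x * Kinv D q j =
      q ^ pairing D.form β j • x) →
      x ∈ ⨆ β, weightSpace q D.form (fun j => adL D hq (K D q j)) β := fun {β x} h =>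
    Submodule.mem_iSup_of_mem β fun j => by rw [adL_K, h]
  -- Conjugation is multiplicative, so the sum of the weight spaces is closed under products; it
  -- then suffices that it contains the scalars and the generators.
  have hmul : ∀ x ∈ ⨆ β, weightSpace q D.form (fun j => adL D hq (K D q j)) β,
      ∀ y ∈ ⨆ β, weightSpace q D.form (fun j => adL D hq (K D q j)) β,
      x * y ∈ ⨆ β, weightSpace q D.form (fun j => adL D hq (K D q j)) β := by
    intro x hx y hy
    induction hx using Submodule.iSup_induction' with
    | mem β x hx =>
      induction hy using Submodule.iSup_induction' with
      | mem γ y hy =>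
        refine hmem (β := β + γ) fun j => ?_
        have h1 := hx j
        have h2 := hy j
        rw [adL_K] at h1 h2
        rw [pairing_add, zpow_add₀ hq.ne_zero, mul_smul, ← mul_smul_comm, ← smul_mul_assoc,
          smul_mul_assoc, ← smul_mul_assoc, ← h1, ← h2]
        simp only [mul_assoc]
        rw [← mul_assoc (Kinv D q j) (K D q j), Kinv_mul_K, one_mul]
      | zero => rw [mul_zero]; exact Submodule.zero_mem _
      | add y z _ _ hy hz => rw [mul_add]; exact Submodule.add_mem _ hy hz
    | zero => rw [zero_mul]; exact Submodule.zero_mem _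
    | add x z _ _ hx hz => rw [add_mul]; exact Submodule.add_mem _ hx hz
  refine Submodule.eq_top_iff'.2 fun x => ?_
  obtain ⟨x, rfl⟩ := RingQuot.mkAlgHom_surjective k (Rel D q) x
  change mk D q x ∈ _
  induction x using FreeAlgebra.induction with
  | grade0 r =>
    refine hmem (β := 0) fun j => ?_
    rw [AlgHom.commutes, ← Algebra.commutes, mul_assoc, K_mul_Kinv, mul_one, pairing_zero,
      zpow_zero, one_smul]
  | grade1 g =>
    cases g with
    | E i =>
      refine hmem (β := Pi.single i 1) fun j => ?_
      rw [pairing_single, CartanDatum.form, D.symm]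
      exact K_E_Kinv j i
    | F i =>
      refine hmem (β := 0 - Pi.single i 1) fun j => ?_
      rw [pairing_sub, pairing_zero, zero_sub, pairing_single, CartanDatum.form, D.symm]
      exact K_F_Kinv j i
    | K i =>
      refine hmem (β := 0) fun j => ?_
      rw [pairing_zero, zpow_zero, one_smul]
      exact K_K_Kinv j i
    | Kinv i =>
      refine hmem (β := 0) fun j => ?_
      rw [pairing_zero, zpow_zero, one_smul]
      exact K_Kinv_Kinv j i
  | mul x y hx hy => rw [map_mul]; exact hmul _ hx _ hy
  | add x y hx hy => rw [map_add]; exact Submodule.add_mem _ hx hy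

end Weights

variable {S : Set I}

variable (q) in
theorem E_mem_levi (i : S) : E D q i ∈ levi D q S :=
  Algebra.subset_adjoin (.inl (.inl (.inl ⟨i, i.2, rfl⟩)))

variable (q) in
theorem F_mem_levi (i : S) : F D q i ∈ levi D q S :=
  Algebra.subset_adjoin (.inl (.inl (.inr ⟨i, i.2, rfl⟩)))

variable (q S) in
theorem K_mem_levi (j : I) : K D q j ∈ levi D q S :=
  Algebra.subset_adjoin (.inl (.inr ⟨j, rfl⟩))

variable (q S) in
theorem Kinv_mem_levi (j : I) : Kinv D q j ∈ levi D q S :=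
  Algebra.subset_adjoin (.inr ⟨j, rfl⟩)

theorem isLeviSubmodule_cyclic (v : Uq D q) :
    IsLeviSubmodule D hq S (cyclic D hq S v) := by
  intro a ha x hx
  obtain ⟨b, hb, rfl⟩ := (mem_cyclic D hq).1 hx
  exact (mem_cyclic D hq).2 ⟨a * b, mul_mem ha hb, by rw [map_mul]; rfl⟩

theorem mem_cyclic_self (v : Uq D q) : v ∈ cyclic D hq S v :=
  (mem_cyclic D hq).2 ⟨1, one_mem _, by rw [map_one]; rfl⟩

theorem cyclic_le {v : Uq D q} {N : Submodule k (Uq D q)} (hN : IsLeviSubmodule D hq S N)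
    (hv : v ∈ N) : cyclic D hq S v ≤ N := by
  intro x hx
  obtain ⟨a, ha, rfl⟩ := (mem_cyclic D hq).1 hx
  exact hN a ha v hv

variable (S) in
/-- The adjoint action of the quantum Levi subalgebra on a cyclic module. -/
def leviAction (v : Uq D q) : levi D q S →ₐ[k] Module.End k (cyclic D hq S v) where
  toFun a := (adL D hq a).restrict fun x hx => isLeviSubmodule_cyclic D hq v a a.2 x hx
  map_one' := LinearMap.ext fun x => Subtype.ext (by
    rw [LinearMap.coe_restrict_apply, OneMemClass.coe_one, map_one]; rfl)
  map_mul' a b := LinearMap.ext fun x => Subtype.ext (by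
    rw [LinearMap.coe_restrict_apply, MulMemClass.coe_mul, map_mul]; rfl)
  map_zero' := LinearMap.ext fun x => Subtype.ext (by
    rw [LinearMap.coe_restrict_apply, ZeroMemClass.coe_zero, map_zero]; rfl)
  map_add' a b := LinearMap.ext fun x => Subtype.ext (by
    rw [LinearMap.coe_restrict_apply, AddMemClass.coe_add, map_add]; rfl)
  commutes' r := LinearMap.ext fun x => Subtype.ext (by
    rw [LinearMap.coe_restrict_apply, SubalgebraClass.coe_algebraMap, AlgHom.commutes]; rfl)

variable (S)

/-- The operator of `E_i` on a cyclic adjoint module. -/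
def opE (v : Uq D q) (i : S) := leviAction D hq S v ⟨E D q i, E_mem_levi D q i⟩

/-- The operator of `F_i` on a cyclic adjoint module. -/
def opF (v : Uq D q) (i : S) := leviAction D hq S v ⟨F D q i, F_mem_levi D q i⟩

/-- The operator of `K_j` on a cyclic adjoint module. -/
def opK (v : Uq D q) (j : I) := leviAction D hq S v ⟨K D q j, K_mem_levi D q S j⟩

/-- The operator of `K_j⁻¹` on a cyclic adjoint module. -/
def opKinv (v : Uq D q) (j : I) := leviAction D hq S v ⟨Kinv D q j, Kinv_mem_levi D q S j⟩

theorem isWeightModule_cyclic [Fintype I]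
    (hinj : ∀ β, (∀ j, pairing D.form β j = 0) → β = 0) (v : Uq D q) :
    IsWeightModule q D.d D.form (Subtype.val : S → I) (opE D hq S v) (opF D hq S v)
      (opK D hq S v) (opKinv D hq S v) where
  K_mul_K' j := by
    rw [opK, opKinv, ← map_mul, ← map_one (leviAction D hq S v)]
    exact congrArg _ (Subtype.ext (K_mul_Kinv j))
  K'_mul_K j := by
    rw [opK, opKinv, ← map_mul, ← map_one (leviAction D hq S v)]
    exact congrArg _ (Subtype.ext (Kinv_mul_K j))
  K_mul_K i j := by
    rw [opK, opK, ← map_mul, ← map_mul]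
    exact congrArg _ (Subtype.ext (K_mul_K i j))
  K_mul_E j i := by
    rw [opK, opE, ← map_mul, ← map_mul, ← map_smul]
    exact congrArg _ (Subtype.ext (K_mul_E j _))
  K_mul_F j i := by
    rw [opK, opF, ← map_mul, ← map_mul, ← map_smul]
    exact congrArg _ (Subtype.ext (K_mul_F j _))
  E_F i := by
    have h := congrArg (leviAction D hq S v) (Subtype.ext (E_F (i : I)) :
      (⟨E D q i, E_mem_levi D q i⟩ * ⟨F D q i, F_mem_levi D q i⟩ -
        ⟨F D q i, F_mem_levi D q i⟩ * ⟨E D q i, E_mem_levi D q i⟩ : levi D q S) =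
      (q ^ D.d i - (q ^ D.d i)⁻¹)⁻¹ •
        (⟨K D q i, K_mem_levi D q S i⟩ - ⟨Kinv D q i, Kinv_mem_levi D q S i⟩))
    rw [map_sub, map_mul, map_mul, map_smul, map_sub] at h
    exact h
  E_F_of_ne i j h := by
    rw [opE, opF, ← map_mul, ← map_mul]
    exact congrArg _ (Subtype.ext (E_F_of_ne (Subtype.coe_ne_coe.2 h)))
  iSup_weightSpace := iSup_weightSpace_restrict hq hinj (iSup_weightSpace_adL D hq) fun _ _ => rfl

variable {S}

/-- A subspace stable under the generators is stable under the quantum Levi subalgebra. -/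
theorem leviAction_mem {v : Uq D q} {N : Submodule k (cyclic D hq S v)}
    (hN : IsStable (opE D hq S v) (opF D hq S v) (opK D hq S v) (opKinv D hq S v) N)
    (a : levi D q S) : ∀ x ∈ N, leviAction D hq S v a x ∈ N := by
  obtain ⟨a, ha⟩ := a
  induction ha using Algebra.adjoin_induction with
  | mem a ha =>
    rcases ha with ((⟨i, hi, rfl⟩ | ⟨i, hi, rfl⟩) | ⟨j, rfl⟩) | ⟨j, rfl⟩
    · exact hN.E_mem ⟨i, hi⟩
    · exact hN.F_mem ⟨i, hi⟩
    · exact hN.K_mem j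
    · exact hN.K'_mem j
  | algebraMap r =>
    intro x hx
    have := AlgHom.commutes (leviAction D hq S v) r
    change leviAction D hq S v (algebraMap k _ r) x ∈ N
    rw [this]
    exact N.smul_mem r hx
  | add a b ha hb iha ihb =>
    intro x hx
    change leviAction D hq S v (⟨a, ha⟩ + ⟨b, hb⟩) x ∈ N
    rw [map_add]
    exact N.add_mem (iha x hx) (ihb x hx)
  | mul a b ha hb iha ihb =>
    intro x hx
    change leviAction D hq S v (⟨a, ha⟩ * ⟨b, hb⟩) x ∈ N
    rw [map_mul]
    exact iha _ (ihb x hx)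

theorem isStable_comap {v : Uq D q} {N : Submodule k (Uq D q)} (hN : IsLeviSubmodule D hq S N) :
    IsStable (opE D hq S v) (opF D hq S v) (opK D hq S v) (opKinv D hq S v)
      (N.comap (cyclic D hq S v).subtype) where
  E_mem i _ hm := hN _ (E_mem_levi D q i) _ hm
  F_mem i _ hm := hN _ (F_mem_levi D q i) _ hm
  K_mem j _ hm := hN _ (K_mem_levi D q S j) _ hm
  K'_mem j _ hm := hN _ (Kinv_mem_levi D q S j) _ hm

/-- Identifies abstract generation by the operators on `M(v)` with cyclic adjoint modules inside
`U_q(g)`, which is how the general results are carried back. -/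
theorem map_generated {v : Uq D q} (w : cyclic D hq S v) :
    (generated (opE D hq S v) (opF D hq S v) (opK D hq S v) (opKinv D hq S v) w).map
      (cyclic D hq S v).subtype = cyclic D hq S (w : Uq D q) := by
  apply le_antisymm
  · rw [Submodule.map_le_iff_le_comap]
    exact generated_le (isStable_comap D hq (isLeviSubmodule_cyclic D hq _))
      (mem_cyclic_self D hq _)
  · intro x hx
    obtain ⟨a, ha, rfl⟩ := (mem_cyclic D hq).1 hx
    exact ⟨leviAction D hq S v ⟨a, ha⟩ w, leviAction_mem D hq (isStable_generated w) _ _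
      (mem_generated w), rfl⟩

variable [Fintype I]

theorem isHighestWeightVector_of_singular {v : Uq D q} {w : cyclic D hq S v} (hw0 : w ≠ 0)
    {β : I → ℤ} (hw : w ∈ weightSpace q D.form (opK D hq S v) β)
    (hE : ∀ i, opE D hq S v i w = 0) : IsHighestWeightVector D hq S (w : Uq D q) := by
  -- The integral weight is `β` evaluated on coroots: its value at `α_j^∨` is `∑ β_i a_ji`.
  refine ⟨fun h0 => hw0 (Subtype.ext h0), ⟨fun j => ∑ i, β i * D.a j i, fun j => ?_⟩,
    fun i hi => congrArg Subtype.val (hE ⟨i, hi⟩)⟩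
  have h1 : D.d j * ∑ i, β i * D.a j i = pairing D.form β j := by
    rw [pairing, Finset.mul_sum]
    refine Finset.sum_congr rfl fun i _ => ?_
    rw [CartanDatum.form, D.symm, mul_left_comm]
  rw [h1]
  exact congrArg Subtype.val (hw j)

/-- Locally finite cyclic adjoint modules are finite sums of irreducible highest weight modules. -/
theorem cyclic_eq_iSup_irreducible (hinj : ∀ β, (∀ j, pairing D.form β j = 0) → β = 0)
    (hf : IsFiniteForm (fun i : S => D.d i) fun i j => D.form (i : I) j) {v : Uq D q}
    (hv : v ∈ locallyFinitePart D hq S) :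
    ∃ (n : ℕ) (w : Fin n → Uq D q), (∀ i, w i ∈ cyclic D hq S v ∧
      IsHighestWeightVector D hq S (w i) ∧ cyclic D hq S (w i) ≤ cyclic D hq S v ∧
      IsIrreducibleLeviSubmodule D hq S (cyclic D hq S (w i))) ∧
      cyclic D hq S v = ⨆ i, cyclic D hq S (w i) := by
  classical
  have : FiniteDimensional k (cyclic D hq S v) := hv
  have hc : ∀ i j, D.form i j = D.form j i := D.symm
  have hM := isWeightModule_cyclic D hq S hinj v
  have htop := hM.iSup_generated hq hc hinj hf
  -- A finitely generated module is a compact element of its lattice of submodules, so finitely many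
  -- singular vectors already generate it.
  obtain ⟨s, hs⟩ := CompleteLattice.IsCompactElement.exists_finset_of_le_iSup _
    ((Submodule.fg_iff_compact _).1 (Module.Finite.fg_top (R := k) (M := cyclic D hq S v))) _
    htop.ge
  have e := s.equivFin
  refine ⟨s.card, fun i => ((e.symm i).1.1 : Uq D q), fun i => ?_, ?_⟩
  · beta_reduce
    generalize e.symm i = u
    obtain ⟨⟨w, hw0, ⟨β, hw⟩, hE⟩, -⟩ := u
    have hw0' : (w : Uq D q) ≠ 0 := fun h0 => hw0 (Subtype.ext h0)
    have hle : cyclic D hq S (w : Uq D q) ≤ cyclic D hq S v :=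
      cyclic_le D hq (isLeviSubmodule_cyclic D hq v) w.2
    refine ⟨w.2, isHighestWeightVector_of_singular D hq hw0 hw hE, hle,
      isLeviSubmodule_cyclic D hq _, fun h0 => hw0' ?_, fun N hN hNw => ?_⟩
    · exact (Submodule.mem_bot k).1 (h0 ▸ mem_cyclic_self D hq _)
    -- Irreducibility is known for stable subspaces of `M(v)`; as `N` lies in `M(v)`, nothing is
    -- lost by pulling it back and pushing it forward.
    · have hmap : (N.comap (cyclic D hq S v).subtype).map (cyclic D hq S v).subtype = N :=
        Submodule.map_comap_eq_self (by rw [Submodule.range_subtype]; exact hN.trans hle)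
      have hle' : N.comap (cyclic D hq S v).subtype ≤ generated (opE D hq S v) (opF D hq S v)
          (opK D hq S v) (opKinv D hq S v) w := by
        rw [← Submodule.map_le_map_iff_of_injective (cyclic D hq S v).injective_subtype, hmap,
          map_generated]
        exact hN
      by_cases h0 : N.comap (cyclic D hq S v).subtype = ⊥
      · exact .inl (by rw [← hmap, h0, Submodule.map_bot])
      · refine .inr ?_
        rw [← hmap, hM.eq_generated_of_le hq hc hinj hf hw hE (isStable_comap D hq hNw) hle' h0,
          map_generated]
  · have htop' : ⨆ i, generated (opE D hq S v) (opF D hq S v) (opK D hq S v) (opKinv D hq S v)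
        ((e.symm i).1.1 : cyclic D hq S v) = ⊤ := by
      refine top_le_iff.1 (hs.trans (iSup₂_le fun w hw => ?_))
      refine le_iSup_of_le (e ⟨w, hw⟩) ?_
      rw [Equiv.symm_apply_apply]
    have := congrArg (Submodule.map (cyclic D hq S v).subtype) htop'
    rw [Submodule.map_iSup, Submodule.map_top, Submodule.range_subtype] at this
    exact this.symm.trans (iSup_congr fun i => map_generated D hq _)

end QuantumLevi

end

/-- The Lie algebra contributes two facts: its symmetrized Cartan matrix is nondegenerate, and the
restriction of that matrix to `S` is of finite type. -/
theorem mainTheorem4 {k : Type*} [Field k] [CharZero k] {q : k} (hq : IsGeneric q)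
    {L : Type*} [LieRing L] [LieAlgebra ℂ L] [FiniteDimensional ℂ L]
    [LieAlgebra.IsSemisimple ℂ L] (H : LieSubalgebra ℂ L) [H.IsCartanSubalgebra]
    (b : (LieAlgebra.IsKilling.rootSystem H).Base)
    (d : b.support → ℕ) (hd : ∀ i, 0 < d i)
    (hsymm : ∀ i j,
      (d i : ℤ) * cartanInt b i j = d j * cartanInt b j i)
    (S : Set b.support)
    (v : Uq (lieDatum b d hd hsymm) q)
    (hv : v ∈ locallyFinitePart (lieDatum b d hd hsymm) hq S) :
    ∃ (n : ℕ) (w : Fin n → Uq (lieDatum b d hd hsymm) q),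
      (∀ i, w i ∈ cyclic (lieDatum b d hd hsymm) hq S v ∧
        IsHighestWeightVector (lieDatum b d hd hsymm) hq S (w i) ∧
        cyclic (lieDatum b d hd hsymm) hq S (w i) ≤
          cyclic (lieDatum b d hd hsymm) hq S v ∧
        IsIrreducibleLeviSubmodule (lieDatum b d hd hsymm) hq S
          (cyclic (lieDatum b d hd hsymm) hq S (w i))) ∧
      cyclic (lieDatum b d hd hsymm) hq S v =
        ⨆ i, cyclic (lieDatum b d hd hsymm) hq S (w i) := by
  have := Fintype.ofFinite b.support
  exact cyclic_eq_iSup_irreducible _ hq (eq_zero_of_pairing_eq_zero b hd hsymm)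
    (isFiniteForm_restrict b hd hsymm S) hv
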